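/- Conventions. For $p,q\ge 0$ let $C\ell_{p,q}$ be the real Clifford algebra with units $e_1,\dots,e_{p+q}$, $e_ie_j=-e_je_i$ $(i\ne j)$, $e_i^2=1$ for $i\le p$ and $e_i^2=-1$ for $i>p$; let $\omega=e_1e_2\cdots e_{p+q}$, and call $p-q \bmod 8$ the type of $C\ell_{p,q}$. Let $\star$ (involution, $e_i\mapsto -e_i$), $\sim$ (reversion, the antiautomorphism with $e_i\mapsto e_i$) and $\widetilde\star$ (conjugation, the antiautomorphism with $e_i\mapsto -e_i$) be the fundamental automorphisms. For an isomorphism $\gamma$ of a Clifford algebra with a matrix algebra $M_N(\mathbb K)$ put $\mathcal E_i=\gamma(e_i)$; if every $\mathcal E_i$ is symmetric or skewsymmetric (for plain transposition), $\{\mathcal E_i\}$ is called a spinbasis over $\mathbb K$. Matrices $W,E,C$ represent the fundamental automorphisms if $W=\gamma(\omega)$, $\gamma(a^\star)=W\gamma(a)W^{-1}$ for all $a$, and $E,C$ are invertible with $\mathcal E_i=E\mathcal E_i^{T}E^{-1}$, $-\mathcal E_i=C\mathcal E_i^{T}C^{-1}$ for all $i$ (over $\mathbb R$ and $\mathbb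 C$ one then also has $\gamma(\tilde a)=E\gamma(a)^TE^{-1}$, $\gamma(\widetilde{a^\star})=C\gamma(a)^TC^{-1}$ for all $a$). The group $\mathsf{Aut}=\{I,W,E,C\}$ is understood up to sign, through the double covering $\widehat{\mathsf{Aut}}=\{\pm I,\pm W,\pm E,\pm C\}$ of the Klein group $\{\mathrm{Id},\star,\sim,\widetilde\star\}$ (each matrix being labelled by the automorphism that it represents). It has signature $(a,b,c)$, $a,b,c\in\{+,-\}$, if $W^2=aI$, $E^2=bI$, $C^2=cI$. It is written $\mathsf{Aut}_-$ (Abelian) if $W,E,C$ pairwise commute and $\mathsf{Aut}_+$ (non-Abelian) if they pairwise anticommute. It is said to be $\simeq\mathbb Z_2\otimes\mathbb Z_2$, $\simeq\mathbb Z_4$, $\simeq D_4/\mathbb Z_2$, $\simeq Q_4/\mathbb Z_2$ if $\widehat{\mathsf{Aut}}$ is isomorphic to $\mathbb Z_2^3$, $\mathbb Z_2\times\mathbb Z_4$, the dihedral group $D_4$ of order $8$, the quaternion group $Q_4$ of order $8$, respectively, and the named group is the quotient of $\widehat{\mathsf{Aut}}$ by a subgroup of order two (by $\{\pm I\}$ in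 the first, third and fourth case, and by a subgroup not containing $-I$ in the case of $\mathbb Z_4$). Theorem. 1) $\mathbb K\simeq\mathbb R$, types $p-q\equiv 0,2\pmod 8$. There are spinbases of $C\ell_{p,q}$ over $\mathbb R$, with $N=2^{(p+q)/2}$, and in each of them $\mathcal E_i$ is symmetric for $i\le p$ and skewsymmetric for $i>p$. If $p,q$ are even, then $E=\mathcal E_{p+1}\cdots\mathcal E_{p+q}$, $C=\mathcal E_1\cdots\mathcal E_p$ and $W=\gamma(\omega)$ represent the fundamental automorphisms, and for type $0$ one has $\mathsf{Aut}_-\simeq\mathbb Z_2\otimes\mathbb Z_2$ with $(+,+,+)$ if $p,q\equiv 0\pmod 4$ and $\mathsf{Aut}_-\simeq\mathbb Z_4$ with $(+,-,-)$ if $p,q\equiv 2\pmod 4$; for type $2$ one has $\mathsf{Aut}_-\simeq\mathbb Z_4$ with $(-,-,+)$ if $p\equiv 0,\ q\equiv 2\pmod 4$, and with $(-,+,-)$ if $p\equiv 2,\ q\equiv 0\pmod 4$. If $p,q$ are odd, then $E=\mathcal E_1\cdots\mathcal E_p$, $C=\mathcal E_{p+1}\cdots\mathcal E_{p+q}$ and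 $W=\gamma(\omega)$ represent the fundamental automorphisms, and for type $0$ one has $\mathsf{Aut}_+\simeq D_4/\mathbb Z_2$ with $(+,-,+)$ if $p,q\equiv 3\pmod 4$ and with $(+,+,-)$ if $p,q\equiv 1\pmod 4$; for type $2$ one has $\mathsf{Aut}_+\simeq Q_4/\mathbb Z_2$ with $(-,-,-)$ if $p\equiv 3,\ q\equiv 1\pmod 4$ and $\mathsf{Aut}_+\simeq D_4/\mathbb Z_2$ with $(-,+,+)$ if $p\equiv 1,\ q\equiv 3\pmod 4$. 2) $\mathbb K\simeq\mathbb H$, types $p-q\equiv 4,6\pmod 8$. There are spinbases of $C\ell_{p,q}$ over $\mathbb H$, with $N=2^{(p+q)/2-1}$. For a spinbasis let $k$ be the number of skewsymmetric $\mathcal E_i$, of which $l$ have square $+I$ and $t$ have square $-I$, and let $h$ and $g$ be the numbers of symmetric $\mathcal E_i$ with square $+I$ and $-I$. If $k$ is even, then $E=$ the product of the skewsymmetric $\mathcal E_i$, $C=$ the product of the symmetric $\mathcal E_i$ and $W=\gamma(\omega)$ represent the fundamental automorphisms, and for type $4$ one has $\mathsf{Aut}_-\simeq\mathbb Z_2\otimes\mathbb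 Z_2$ with $(+,+,+)$ if $l-t,\ h-g\equiv 0,1,4,5\pmod 8$, and $\mathsf{Aut}_-\simeq\mathbb Z_4$ with $(+,-,-)$ if $l-t,\ h-g\equiv 2,3,6,7\pmod 8$; for type $6$ one has $\mathsf{Aut}_-\simeq\mathbb Z_4$ with $(-,+,-)$ if $l-t\equiv 0,1,4,5$, $h-g\equiv 2,3,6,7\pmod 8$, and with $(-,-,+)$ if $l-t\equiv 2,3,6,7$, $h-g\equiv 0,1,4,5\pmod 8$. If $k$ is odd, then $E=$ the product of the symmetric $\mathcal E_i$, $C=$ the product of the skewsymmetric $\mathcal E_i$ and $W=\gamma(\omega)$ represent the fundamental automorphisms, and for type $4$ one has $\mathsf{Aut}_+\simeq D_4/\mathbb Z_2$ with $(+,-,+)$ if $h-g\equiv 2,3,6,7$, $l-t\equiv 0,1,4,5\pmod 8$, and with $(+,+,-)$ if $h-g\equiv 0,1,4,5$, $l-t\equiv 2,3,6,7\pmod 8$; for type $6$ one has $\mathsf{Aut}_+\simeq Q_4/\mathbb Z_2$ with $(-,-,-)$ if $h-g,\ l-t\equiv 2,3,6,7\pmod 8$, and $\mathsf{Aut}_+\simeq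 D_4/\mathbb Z_2$ with $(-,+,+)$ if $h-g,\ l-t\equiv 0,1,4,5\pmod 8$. Each of these eight cases occurs for some $p,q$ and some spinbasis. 3) $\mathbb K\simeq\mathbb R\oplus\mathbb R$, $\mathbb K\simeq\mathbb H\oplus\mathbb H$, types $p-q\equiv 1,5\pmod 8$. The idempotents $\frac12(1\pm\omega)$ decompose $C\ell_{p,q}$ as $C\ell_{p,q-1}\oplus C\ell_{p,q-1}$ if $q\ge1$, and as $C\ell_{q,p-1}\oplus C\ell_{q,p-1}$ if $p\ge 1$; the automorphism groups of $C\ell_{p,q}$ are those formed by matrices representing the fundamental automorphisms of the summand in a spinbasis of it over $\mathbb R$ or $\mathbb H$. The groups that occur among all the algebras $C\ell_{0,q}$ of types $1,5$ taken together are exactly the Abelian $\mathbb Z_4$ with $(-,-,+)$ and with $(-,+,-)$ and the non-Abelian $Q_4/\mathbb Z_2$ with $(-,-,-)$ and $D_4/\mathbb Z_2$ with $(-,+,+)$. Those that occur among all the algebras $C\ell_{p,0}$ of types $1,5$ taken together are exactly the Abelian $\mathbb Z_2\otimes\mathbb Z_2$ with $(+,+,+)$ and $\mathbb Z_4$ with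 $(+,-,-)$ and the non-Abelian $D_4/\mathbb Z_2$ with $(+,-,+)$ and with $(+,+,-)$. For each of the types $1$ and $5$, all eight groups occur when $p,q$ range over all algebras $C\ell_{p,q}$ of the type. 4) $\mathbb K\simeq\mathbb C$, types $p-q\equiv 3,7\pmod 8$. Let $p+q=2m+1$. Then $C\ell_{p,q}$ is isomorphic over $\mathbb R$ to the complex Clifford algebra $\mathbb C_{2m}$, whose units can be taken to be complex multiples of units of $C\ell_{p,q}$, with squares $\pm1$. Consider the spinbases of $\mathbb C_{2m}$ over $\mathbb C$ with $N=2^m$ in which $\mathcal E_1,\dots,\mathcal E_m$ are symmetric and $\mathcal E_{m+1},\dots,\mathcal E_{2m}$ are skewsymmetric, and let $W=\mathcal E_1\cdots\mathcal E_{2m}$. If $p$ is even and $q$ is odd, then $m$ is even, $W$, $E=\mathcal E_{m+1}\cdots\mathcal E_{2m}$, $C=\mathcal E_1\cdots\mathcal E_m$ represent the fundamental automorphisms of $\mathbb C_{2m}$ and pairwise commute, and for a suitable choice of the units and of the spinbasis $\mathsf{Aut}_-\simeq\mathbb Z_2\otimes\mathbb Z_2$ with $(+,+,+)$. If $p$ is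 odd and $q$ is even, then $m$ is odd, $W$, $E=\mathcal E_1\cdots\mathcal E_m$, $C=\mathcal E_{m+1}\cdots\mathcal E_{2m}$ represent the fundamental automorphisms of $\mathbb C_{2m}$ and pairwise anticommute, and for a suitable choice of the units and of the spinbasis $\mathsf{Aut}_+\simeq Q_4/\mathbb Z_2$ with $(-,-,-)$. -/

import Mathlib

open scoped Quaternion

noncomputable section

namespace CliffordAut

/-! ### Clifford algebras with an orthogonal basis of units -/

/-- The quadratic form `∑ i, s i * x i ^ 2` on `F ^ n` for a vector of signs `s`. -/
def diagForm (F : Type) [Field F] {n : ℕ} (s : Fin n → ℤˣ) : QuadraticForm F (Fin n → F) :=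
  QuadraticMap.weightedSumSquares F (fun i => ((s i : ℤ) : F))

/-- The Clifford algebra of `diagForm F s`, so that the units satisfy
`e i * e i = s i` and `e i * e j = - e j * e i` for `i ≠ j`. -/
abbrev CliffAlg (F : Type) [Field F] {n : ℕ} (s : Fin n → ℤˣ) : Type :=
  CliffordAlgebra (diagForm F s)

/-- The unit `e i`. -/
def unit (F : Type) [Field F] {n : ℕ} (s : Fin n → ℤˣ) (i : Fin n) : CliffAlg F s :=
  CliffordAlgebra.ι (diagForm F s) (Pi.single i 1)

/-- The volume element `ω = e 0 * e 1 * ⋯ * e (n-1)`. -/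
def volume (F : Type) [Field F] {n : ℕ} (s : Fin n → ℤˣ) : CliffAlg F s :=
  ((List.finRange n).map (unit F s)).prod

/-- The signs `+, …, +, -, …, -` (`p` times `+`, then `q` times `-`). -/
def sgn (p q : ℕ) (i : Fin (p + q)) : ℤˣ := if i.val < p then 1 else -1

/-- The real Clifford algebra of signature `(p, q)`. -/
abbrev Cl (p q : ℕ) : Type := CliffAlg ℝ (sgn p q)

/-! ### Spinbases and matrices of the fundamental automorphisms -/

/-- A matrix realization of a Clifford algebra as the full algebra of `N × N` matrices over `K`,
in which each of the units is represented by a symmetric or by a skewsymmetric matrix (with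
respect to plain transposition). -/
structure SpinBasis (F : Type) [Field F] {n : ℕ} (s : Fin n → ℤˣ)
    (K : Type) [Ring K] [Algebra F K] (N : ℕ) where
  /-- the isomorphism onto the matrix algebra -/
  γ : CliffAlg F s ≃ₐ[F] Matrix (Fin N) (Fin N) K
  symm_or_skew : ∀ i, (γ (unit F s i)).transpose = γ (unit F s i) ∨
    (γ (unit F s i)).transpose = - γ (unit F s i)

namespace SpinBasis

variable {F : Type} [Field F] {n : ℕ} {s : Fin n → ℤˣ} {K : Type} [Ring K] [Algebra F K] {N : ℕ}

/-- The matrix of the unit `e i`. -/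
def mat (B : SpinBasis F s K N) (i : Fin n) : Matrix (Fin N) (Fin N) K := B.γ (unit F s i)

def IsSymm (B : SpinBasis F s K N) (i : Fin n) : Prop := (B.mat i).transpose = B.mat i

def IsSkew (B : SpinBasis F s K N) (i : Fin n) : Prop := (B.mat i).transpose = - B.mat i

open Classical in
/-- The product, in increasing order of the indices, of the basis matrices with index in `P`. -/
def prodOver (B : SpinBasis F s K N) (P : Fin n → Prop) : Matrix (Fin N) (Fin N) K :=
  (((List.finRange n).filter (fun i => decide (P i))).map B.mat).prod

/-- The matrix of the volume element. -/
def volMat (B : SpinBasis F s K N) : Matrix (Fin N) (Fin N) K := B.γ (volume F s)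

/-- Number of skewsymmetric basis matrices. -/
def numSkew (B : SpinBasis F s K N) : ℕ := {i | B.IsSkew i}.ncard

/-- Number of skewsymmetric basis matrices with square `+I`. -/
def numSkewPos (B : SpinBasis F s K N) : ℕ := {i | B.IsSkew i ∧ B.mat i * B.mat i = 1}.ncard

/-- Number of skewsymmetric basis matrices with square `-I`. -/
def numSkewNeg (B : SpinBasis F s K N) : ℕ := {i | B.IsSkew i ∧ B.mat i * B.mat i = -1}.ncard

/-- Number of symmetric basis matrices with square `+I`. -/
def numSymmPos (B : SpinBasis F s K N) : ℕ := {i | B.IsSymm i ∧ B.mat i * B.mat i = 1}.ncard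

/-- Number of symmetric basis matrices with square `-I`. -/
def numSymmNeg (B : SpinBasis F s K N) : ℕ := {i | B.IsSymm i ∧ B.mat i * B.mat i = -1}.ncard

/-- `W`, `E`, `C` are matrices of the involution, of the reversion and of the conjugation:
`W` is the matrix of the volume element and `γ(a⋆) = W γ(a) W⁻¹`, while `E` and `C` are
invertible and, on the units, `γ(e i) = E γ(e i)ᵀ E⁻¹` and `-γ(e i) = C γ(e i)ᵀ C⁻¹`. -/
structure Represents (B : SpinBasis F s K N) (W E C : Matrix (Fin N) (Fin N) K) : Prop where
  W_eq : W = B.volMat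
  isUnit_W : IsUnit W
  isUnit_E : IsUnit E
  isUnit_C : IsUnit C
  involution : ∀ a, B.γ (CliffordAlgebra.involute a) * W = W * B.γ a
  reversion : ∀ i, B.mat i * E = E * (B.mat i).transpose
  conjugation : ∀ i, -B.mat i * C = C * (B.mat i).transpose

/-- The relations `γ(ã) = E γ(a)ᵀ E⁻¹` and `γ(ã⋆) = C γ(a)ᵀ C⁻¹` on the whole algebra
(to be expected over commutative `K`, where transposition is an antiautomorphism). -/
def RepresentsOnAlgebra (B : SpinBasis F s K N) (E C : Matrix (Fin N) (Fin N) K) : Prop :=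
  ∀ a, B.γ (CliffordAlgebra.reverse a) * E = E * (B.γ a).transpose ∧
    B.γ (CliffordAlgebra.reverse (CliffordAlgebra.involute a)) * C = C * (B.γ a).transpose

end SpinBasis

/-! ### The group `{I, W, E, C}` -/

/-- The Klein four-group `{Id, ⋆, ~, ~⋆}` of the fundamental automorphisms. -/
abbrev Label : Type := Multiplicative (ZMod 2) × Multiplicative (ZMod 2)

/-- The label of the involution. -/
def star : Label := (Multiplicative.ofAdd 1, 1)

/-- The label of the reversion. -/
def rev : Label := (1, Multiplicative.ofAdd 1)

/-- The group of the matrices `±I, ±W, ±E, ±C`, each one labelled by the fundamental automorphism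
that it represents: the double covering of the Klein four-group belonging to `{I, W, E, C}`.
(The labels matter only if two of `I, W, E, C` coincide up to sign.) -/
def cover {R : Type} [Ring R] (W E C : R) : Subgroup (Label × Rˣ) :=
  Subgroup.closure {x | (x.1 = 1 ∧ (x.2 : R) = -1) ∨ (x.1 = star ∧ (x.2 : R) = W) ∨
    (x.1 = rev ∧ (x.2 : R) = E) ∨ (x.1 = star * rev ∧ (x.2 : R) = C)}

/-- The elements of the covering that lie over the identity automorphism. -/
def signs {R : Type} [Ring R] (W E C : R) : Subgroup (cover W E C) :=
  ((MonoidHom.fst Label Rˣ).comp (cover W E C).subtype).ker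

/-- The four isomorphism types: `ℤ₂ ⊗ ℤ₂`, `ℤ₄`, `D₄/ℤ₂`, `Q₄/ℤ₂`. -/
inductive AutType
  | klein
  | cyclic
  | dihedral
  | quaternion

/-- `W`, `E`, `C` pairwise commute. -/
def Commuting {R : Type} [Ring R] (W E C : R) : Prop :=
  W * E = E * W ∧ W * C = C * W ∧ E * C = C * E

/-- `W`, `E`, `C` pairwise anticommute. -/
def Anticommuting {R : Type} [Ring R] (W E C : R) : Prop :=
  W * E = -(E * W) ∧ W * C = -(C * W) ∧ E * C = -(C * E)

/-- The group `{I, W, E, C}` is of the given type. It is regarded as a quotient by `ℤ₂` of its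
double covering `{±I, ±W, ±E, ±C}`; the latter is `ℤ₂ ⊗ ℤ₂ ⊗ ℤ₂`, `ℤ₂ ⊗ ℤ₄`, the dihedral group
of order 8 and the quaternion group, respectively. For `ℤ₂ ⊗ ℤ₂`, `D₄/ℤ₂`, `Q₄/ℤ₂` the kernel
is `{±I}`; for `ℤ₄` it has order two and does not contain `-I`. -/
def IsOfType {R : Type} [Ring R] (W E C : R) : AutType → Prop
  | .klein =>
      Nonempty (cover W E C ≃*
        Multiplicative (ZMod 2) × Multiplicative (ZMod 2) × Multiplicative (ZMod 2)) ∧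
      ∃ φ : cover W E C →* Multiplicative (ZMod 2) × Multiplicative (ZMod 2),
        Function.Surjective φ ∧ φ.ker = signs W E C
  | .cyclic =>
      Nonempty (cover W E C ≃* Multiplicative (ZMod 2) × Multiplicative (ZMod 4)) ∧
      ∃ φ : cover W E C →* Multiplicative (ZMod 4),
        Function.Surjective φ ∧ Nat.card φ.ker = 2 ∧ Disjoint φ.ker (signs W E C)
  | .dihedral =>
      Nonempty (cover W E C ≃* DihedralGroup 4) ∧
      ∃ φ : cover W E C →* DihedralGroup 4 ⧸ Subgroup.center (DihedralGroup 4),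
        Function.Surjective φ ∧ φ.ker = signs W E C
  | .quaternion =>
      Nonempty (cover W E C ≃* QuaternionGroup 2) ∧
      ∃ φ : cover W E C →* QuaternionGroup 2 ⧸ Subgroup.center (QuaternionGroup 2),
        Function.Surjective φ ∧ φ.ker = signs W E C

/-- `{I, W, E, C}` is an Abelian group `Aut₋` (all elements commute) of type `τ` with
signature `(a, b, c) = (W², E², C²)`. -/
def IsAutMinus {R : Type} [Ring R] (W E C : R) (τ : AutType) (a b c : ℤˣ) : Prop :=
  Commuting W E C ∧ W * W = ((a : ℤ) : R) ∧ E * E = ((b : ℤ) : R) ∧ C * C = ((c : ℤ) : R) ∧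
    IsOfType W E C τ

/-- `{I, W, E, C}` is a non-Abelian group `Aut₊` (`W`, `E`, `C` anticommute) of type `τ` with
signature `(a, b, c) = (W², E², C²)`. -/
def IsAutPlus {R : Type} [Ring R] (W E C : R) (τ : AutType) (a b c : ℤˣ) : Prop :=
  Anticommuting W E C ∧ W * W = ((a : ℤ) : R) ∧ E * E = ((b : ℤ) : R) ∧ C * C = ((c : ℤ) : R) ∧
    IsOfType W E C τ

/-- The two classes of residues modulo 8. -/
def ResPlus (d : ℤ) : Prop :=
  d ≡ 0 [ZMOD 8] ∨ d ≡ 1 [ZMOD 8] ∨ d ≡ 4 [ZMOD 8] ∨ d ≡ 5 [ZMOD 8]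

def ResMinus (d : ℤ) : Prop :=
  d ≡ 2 [ZMOD 8] ∨ d ≡ 3 [ZMOD 8] ∨ d ≡ 6 [ZMOD 8] ∨ d ≡ 7 [ZMOD 8]

/-- The type of `Cl p q`: the residue of `p - q` modulo 8. -/
def HasType (p q : ℕ) (r : ℤ) : Prop := (p : ℤ) - (q : ℤ) ≡ r [ZMOD 8]

/-! ### Semisimple types -/

/-- Some spinbasis of `Cl p q` over `ℝ` or over `ℍ` has an automorphism group `{I, W, E, C}` that
is Abelian (`ab = true`) or non-Abelian (`ab = false`), of type `τ` and of signature
`(a, b, c)`. -/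
def SimpleAdmits (p q : ℕ) (ab : Bool) (τ : AutType) (a b c : ℤˣ) : Prop :=
  (∃ (N : ℕ) (B : SpinBasis ℝ (sgn p q) ℝ N) (W E C : Matrix (Fin N) (Fin N) ℝ),
    B.Represents W E C ∧ if ab then IsAutMinus W E C τ a b c else IsAutPlus W E C τ a b c) ∨
  (∃ (N : ℕ) (B : SpinBasis ℝ (sgn p q) ℍ[ℝ] N) (W E C : Matrix (Fin N) (Fin N) ℍ[ℝ]),
    B.Represents W E C ∧ if ab then IsAutMinus W E C τ a b c else IsAutPlus W E C τ a b c)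

/-- `Cl p q` is the direct sum of two copies of `Cl p' q'`, cut out by the central idempotents
`(1 ± ω) / 2`. -/
def Decomposes (p q p' q' : ℕ) : Prop :=
  ∃ φ : Cl p q ≃ₐ[ℝ] Cl p' q' × Cl p' q', φ (volume ℝ (sgn p q)) = (1, -1)

/-- `Cl p q` decomposes into two copies of `Cl p (q-1)` or of `Cl q (p-1)`, and this summand has
an automorphism group as described. -/
def SemisimpleAdmits (p q : ℕ) (ab : Bool) (τ : AutType) (a b c : ℤˣ) : Prop :=
  ∃ p' q' : ℕ, ((p' = p ∧ q' + 1 = q) ∨ (p' = q ∧ q' + 1 = p)) ∧ Decomposes p q p' q' ∧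
    SimpleAdmits p' q' ab τ a b c

/-- The four groups with `W² = -I`. -/
def NegList (ab : Bool) (τ : AutType) (a b c : ℤˣ) : Prop :=
  (ab, τ, a, b, c) ∈ ({(true, .cyclic, -1, -1, 1), (true, .cyclic, -1, 1, -1),
    (false, .quaternion, -1, -1, -1), (false, .dihedral, -1, 1, 1)} :
      Set (Bool × AutType × ℤˣ × ℤˣ × ℤˣ))

/-- The four groups with `W² = I`. -/
def PosList (ab : Bool) (τ : AutType) (a b c : ℤˣ) : Prop :=
  (ab, τ, a, b, c) ∈ ({(true, .klein, 1, 1, 1), (true, .cyclic, 1, -1, -1),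
    (false, .dihedral, 1, -1, 1), (false, .dihedral, 1, 1, -1)} :
      Set (Bool × AutType × ℤˣ × ℤˣ × ℤˣ))

/-! ### Types with division ring `ℂ` -/

/-- A realization of `Cl p q` (`p + q = 2m + 1`) as a complex Clifford algebra `ℂ_{2m}` with units
of square `±1`, which are complex multiples of units of `Cl p q`, together with a spinbasis of
`ℂ_{2m}` over `ℂ` whose first `m` matrices are symmetric and whose last `m` are skewsymmetric. -/
structure ComplexRealization (p q m : ℕ) where
  s : Fin (2 * m) → ℤˣ
  iso : Cl p q ≃ₐ[ℝ] CliffAlg ℂ s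
  gen : Fin (2 * m) ↪ Fin (p + q)
  coeff : Fin (2 * m) → ℂ
  iso_unit : ∀ i, iso (unit ℝ (sgn p q) (gen i)) = coeff i • unit ℂ s i
  basis : SpinBasis ℂ s ℂ (2 ^ m)
  symm_first : ∀ i, i.val < m → basis.IsSymm i
  skew_last : ∀ i, m ≤ i.val → basis.IsSkew i

/-- The product of the first `m` basis matrices. -/
def ComplexRealization.firstProd {p q m : ℕ} (R : ComplexRealization p q m) :
    Matrix (Fin (2 ^ m)) (Fin (2 ^ m)) ℂ := R.basis.prodOver (fun i => i.val < m)

/-- The product of the last `m` basis matrices. -/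
def ComplexRealization.lastProd {p q m : ℕ} (R : ComplexRealization p q m) :
    Matrix (Fin (2 ^ m)) (Fin (2 ^ m)) ℂ := R.basis.prodOver (fun i => m ≤ i.val)

end CliffordAut

end

noncomputable section

namespace CliffordAut

/-! ### Products of anticommuting elements -/

/-! The classification is sign counting in families of pairwise anticommuting elements with squares
±1 (`IsCliffordFamily`). A product of a elements of square 1 and b elements of square -1 has square
(-1)^(C(a+b,2)+b), which depends only on a - b mod 4 (`prod_sq`, `sign_eq_one`, `sign_eq_neg_one`).
In a spinbasis with p + q even let X and Y be the products of the symmetric and of the skewsymmetric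
matrices, the latter being k in number. If k is even, Y commutes with the symmetric matrices and
anticommutes with the skewsymmetric ones, which is the rule M Y = Y Mᵀ; so E = Y and C = X. If k is
odd, X and Y exchange roles. Moreover W = ±XY, and X, Y commute or anticommute according to the
parity of k.

From W² = a, E² = b and EW = ηWE with η = ±1, the labelled covering is an extension of the Klein
group by ±1 with an explicit cocycle. It depends on (a, b, η) alone, and the eight triples are
matched with the four groups of order eight by finite computation (`CoverModel.exists_equiv`,
`isOfType_typeOf`). The labels keep the order equal to eight even when some of I, W, E, C coincide
up to sign.

Spinbases are built from tensor products of σ_x, σ_z, σ_x σ_z, coded as words over 𝔽₂ whose signs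
are given by a bilinear form. A trace argument shows that a Clifford family with an even number n of
elements in an algebra of dimension 2^n with a suitable trace already gives an isomorphism
(`IsCliffordFamily.lift_bijective`). Real words for types 0 and 2 come from two periodicities
(`hasPauli_of_type`). For types 4 and 6 one word is replaced by its multiples with i, j, k. Plain
transposition ignores the quaternion factor, so symmetry and sign of the square become independent;
this freedom produces all eight quaternionic groups, partly from explicit tables.

For types 1 and 5 the missing unit is represented by the volume element of the summand. Exactness of
the lists comes from rigidity: C⁻¹WE is central, hence a real scalar (`Represents.exists_smul`), so
c = ηab and the type is determined, while W² is the square of the volume element. Only b and η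
remain free, which leaves four groups for each value of W². For types 3 and 7 the central ω has
square -1 and plays the role of ±i; the signs of the complex units can then be chosen at will. -/

/-- Pairwise anticommuting elements of a ring with squares `s i`. -/
structure IsCliffordFamily {R ι : Type*} [Ring R] (s : ι → ℤˣ) (f : ι → R) : Prop where
  sq : ∀ i, f i * f i = s i • (1 : R)
  anticomm : ∀ i j, i ≠ j → f i * f j = -(f j * f i)

theorem neg_one_smul_units {R : Type*} [Ring R] (x : R) : (-1 : ℤˣ) • x = -x := by
  simp [Units.smul_def]

theorem units_smul_smul_self {R : Type*} [Ring R] (e : ℤˣ) (x : R) : e • e • x = x := by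
  rw [smul_smul, Int.units_mul_self, one_smul]

theorem intCast_units {R : Type*} [Ring R] (e : ℤˣ) : ((e : ℤ) : R) = e • (1 : R) := by
  simp [Units.smul_def]

theorem map_units_smul {R S F : Type*} [Ring R] [Ring S] [FunLike F R S]
    [AddMonoidHomClass F R S] (φ : F) (e : ℤˣ) (x : R) : φ (e • x) = e • φ x := by
  rcases Int.units_eq_one_or e with rfl | rfl <;> simp [map_neg]

/-- Whether the number `n` of transpositions is even or odd, `(-1) ^ n = 1` or `-1`. -/
theorem neg_one_pow_choose_two (n : ℕ) :
    (-1 : ℤˣ) ^ (n.choose 2) = if n % 4 < 2 then 1 else -1 := by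
  induction n using Nat.strong_induction_on with
  | _ n ih =>
    rcases lt_or_ge n 4 with h | h
    · interval_cases n <;> decide
    · obtain ⟨k, rfl⟩ := Nat.exists_eq_add_of_le' h
      have h4 : (k + 4).choose 2 = k.choose 2 + 4 * k + 6 := by
        simp only [Nat.choose_succ_succ' _ 1, Nat.choose_one_right]; ring
      have e4 : (-1 : ℤˣ) ^ 4 = 1 := by decide
      have e6 : (-1 : ℤˣ) ^ 6 = 1 := by decide
      rw [h4, pow_add, pow_add, pow_mul, ih k (by omega), Nat.add_mod_right, e4, e6, one_pow,
        mul_one, mul_one]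

/-- The sign of the square of a product of `a` elements of square `1` and `b` elements of
square `-1`. -/
theorem sign_eq_one (a b : ℕ) (h : ResPlus ((a : ℤ) - b)) :
    (-1 : ℤˣ) ^ ((a + b).choose 2) * (-1) ^ b = 1 := by
  rw [neg_one_pow_choose_two]
  simp only [ResPlus, Int.ModEq] at h
  split_ifs with h1
  · rw [Even.neg_one_pow, one_mul]; rw [Nat.even_iff]; omega
  · rw [Odd.neg_one_pow]; · rfl
    rw [Nat.odd_iff]; omega

theorem sign_eq_neg_one (a b : ℕ) (h : ResMinus ((a : ℤ) - b)) :
    (-1 : ℤˣ) ^ ((a + b).choose 2) * (-1) ^ b = -1 := by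
  rw [neg_one_pow_choose_two]
  simp only [ResMinus, Int.ModEq] at h
  split_ifs with h1
  · rw [Odd.neg_one_pow]; · rfl
    rw [Nat.odd_iff]; omega
  · rw [Even.neg_one_pow, mul_one]; rw [Nat.even_iff]; omega

namespace IsCliffordFamily

variable {R ι : Type*} [Ring R] {s : ι → ℤˣ} {f : ι → R}

theorem isUnit (h : IsCliffordFamily s f) (i : ι) : IsUnit (f i) :=
  ⟨⟨f i, s i • f i, by rw [mul_smul_comm, h.sq, units_smul_smul_self],
    by rw [smul_mul_assoc, h.sq, units_smul_smul_self]⟩, rfl⟩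

theorem isUnit_prod (h : IsCliffordFamily s f) (L : List ι) : IsUnit (L.map f).prod := by
  induction L with
  | nil => simp
  | cons j L ih => simpa using (h.isUnit j).mul ih

theorem map {S F : Type*} [Ring S] [FunLike F R S] [RingHomClass F R S] (φ : F)
    (h : IsCliffordFamily s f) : IsCliffordFamily s (fun i => φ (f i)) where
  sq i := by rw [← map_mul, h.sq, map_units_smul, map_one]
  anticomm i j hij := by rw [← map_mul, h.anticomm i j hij, map_neg, map_mul]

variable [DecidableEq ι]

theorem mul_comm_single (h : IsCliffordFamily s f) (i j : ι) :
    f i * f j = (if i = j then (1 : ℤˣ) else -1) • (f j * f i) := by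
  split_ifs with hij
  · subst hij; simp
  · rw [h.anticomm i j hij, neg_one_smul_units]

/-- Every factor different from `f i` contributes -1 and every factor equal to it contributes 1;
`length - count` has the parity of `length + count`. All the later commutation rules are read off
from this sign. -/
theorem mul_prod (h : IsCliffordFamily s f) (i : ι) (L : List ι) :
    f i * (L.map f).prod = (-1 : ℤˣ) ^ (L.length + L.count i) • ((L.map f).prod * f i) := by
  induction L with
  | nil => simp
  | cons j L ih =>
    rw [List.map_cons, List.prod_cons, ← mul_assoc, h.mul_comm_single i j, smul_mul_assoc,
      mul_assoc, ih, mul_smul_comm, smul_smul, mul_assoc, List.length_cons, List.count_cons]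
    congr 1
    by_cases hij : i = j
    · subst hij; simp [pow_add]
    · simp [hij, Ne.symm hij, pow_add]

theorem mul_prod_of_notMem (h : IsCliffordFamily s f) {i : ι} {L : List ι} (hi : i ∉ L) :
    f i * (L.map f).prod = (-1 : ℤˣ) ^ L.length • ((L.map f).prod * f i) := by
  rw [h.mul_prod, List.count_eq_zero_of_not_mem hi, add_zero]

theorem mul_prod_of_mem (h : IsCliffordFamily s f) {i : ι} {L : List ι} (hL : L.Nodup)
    (hi : i ∈ L) :
    f i * (L.map f).prod = (-1 : ℤˣ) ^ (L.length + 1) • ((L.map f).prod * f i) := by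
  rw [h.mul_prod, List.count_eq_one_of_mem hL hi]

theorem prod_mul_prod (h : IsCliffordFamily s f) {L L' : List ι} (hd : L.Disjoint L') :
    (L.map f).prod * (L'.map f).prod =
      (-1 : ℤˣ) ^ (L.length * L'.length) • ((L'.map f).prod * (L.map f).prod) := by
  induction L with
  | nil => simp
  | cons j L ih =>
    rw [List.disjoint_cons_left] at hd
    rw [List.map_cons, List.prod_cons, mul_assoc, ih hd.2, mul_smul_comm, ← mul_assoc,
      h.mul_prod_of_notMem hd.1, smul_mul_assoc, smul_smul, mul_assoc, List.length_cons, ← pow_add]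
    congr 2; ring

/-- Moving the second copy of the leading factor through the remaining ones costs one sign for each
of them, and these numbers add up to the binomial coefficient. -/
theorem prod_sq (h : IsCliffordFamily s f) {L : List ι} (hL : L.Nodup) :
    (L.map f).prod * (L.map f).prod =
      ((-1 : ℤˣ) ^ (L.length.choose 2) * (L.map s).prod) • (1 : R) := by
  induction L with
  | nil => simp
  | cons j L ih =>
    rw [List.nodup_cons] at hL
    have h1 := h.mul_prod_of_notMem hL.1
    have h2 : (L.map f).prod * f j = (-1 : ℤˣ) ^ L.length • (f j * (L.map f).prod) := by
      rw [h1, units_smul_smul_self]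
    rw [List.map_cons, List.prod_cons, mul_assoc, ← mul_assoc _ (f j), h2, smul_mul_assoc,
      mul_smul_comm, mul_assoc, ih hL.2, mul_smul_comm, mul_one, mul_smul_comm, h.sq,
      smul_smul, smul_smul, List.length_cons, Nat.choose_succ_succ' _ 1, Nat.choose_one_right,
      pow_add, List.map_cons, List.prod_cons]
    congr 1
    ac_rfl

/-- The sign itself is never needed: reordered products enter only through their squares, through
commutation rules, or up to a sign that can be absorbed. -/
theorem exists_prod_eq_of_perm (h : IsCliffordFamily s f) {L L' : List ι} (hp : L.Perm L') :
    ∃ e : ℤˣ, (L.map f).prod = e • (L'.map f).prod := by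
  induction hp with
  | nil => exact ⟨1, by simp⟩
  | cons x _ ih =>
    obtain ⟨e, he⟩ := ih
    exact ⟨e, by simp [he, mul_smul_comm]⟩
  | swap x y l =>
    refine ⟨if y = x then 1 else -1, ?_⟩
    simp only [List.map_cons, List.prod_cons]
    rw [← mul_assoc, h.mul_comm_single y x, smul_mul_assoc, mul_assoc]
  | trans _ _ ih1 ih2 =>
    obtain ⟨e, he⟩ := ih1
    obtain ⟨e', he'⟩ := ih2
    exact ⟨e * e', by rw [he, he', smul_smul]⟩

end IsCliffordFamily

theorem prod_map_sign {ι : Type*} (s : ι → ℤˣ) (L : List ι) :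
    (L.map s).prod = (-1) ^ L.countP (fun i => s i = -1) := by
  induction L with
  | nil => simp
  | cons j L ih =>
    rw [List.map_cons, List.prod_cons, ih, List.countP_cons]
    rcases Int.units_eq_one_or (s j) with h | h <;> simp [h, pow_succ]

theorem length_eq_countP_sign {ι : Type*} (s : ι → ℤˣ) (L : List ι) :
    L.length = L.countP (fun i => s i = 1) + L.countP (fun i => s i = -1) := by
  induction L with
  | nil => simp
  | cons j L ih =>
    rw [List.length_cons, List.countP_cons, List.countP_cons, ih]
    rcases Int.units_eq_one_or (s j) with h | h <;> simp [h] <;> omega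

/-! ### The isomorphism type of the group `{±I, ±W, ±E, ±C}` -/

/-- The sign by which the product of two elements `W ^ i * E ^ j` deviates from an element
of the same form, if `W² = a`, `E² = b` and `E W = η W E`. -/
def cocycle (a b η : ℤˣ) (x y : Label) : ℤˣ :=
  (if x.1 ≠ 1 ∧ y.1 ≠ 1 then a else 1) * (if x.2 ≠ 1 ∧ y.2 ≠ 1 then b else 1) *
    (if x.2 ≠ 1 ∧ y.1 ≠ 1 then η else 1)

/-- A group that is an extension of the Klein group by `±1` with the given cocycle. -/
structure CoverModel (a b η : ℤˣ) (G : Type) [Group G] where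
  lab : G → Label
  sign : G → ℤˣ
  lab_mul : ∀ g h, lab (g * h) = lab g * lab h
  sign_mul : ∀ g h, sign (g * h) = sign g * sign h * cocycle a b η (lab g) (lab h)
  inj : ∀ g, lab g = 1 → sign g = 1 → g = 1
  surj : ∀ l e, ∃ g, lab g = l ∧ sign g = e

/-- The sign of a ring unit. -/
def unitSign (R : Type) [Ring R] : ℤˣ →* Rˣ := Units.map (Int.castRingHom R).toMonoidHom

theorem unitSign_comm {R : Type} [Ring R] (e : ℤˣ) (x : Rˣ) :
    x * unitSign R e = unitSign R e * x := by
  ext; simp [unitSign, Int.cast_comm]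

theorem val_unitSign {R : Type} [Ring R] (e : ℤˣ) : ((unitSign R e : Rˣ) : R) = e • (1 : R) := by
  simp [unitSign, Units.smul_def]

theorem unitSign_injective {R : Type} [Ring R] (hR : (-1 : R) ≠ 1) {e : ℤˣ}
    (h : unitSign R e = 1) : e = 1 := by
  rcases Int.units_eq_one_or e with rfl | rfl
  · rfl
  · exact absurd (by simpa [unitSign] using congrArg Units.val h) hR

theorem label_cases (l : Label) : l = 1 ∨ l = star ∨ l = rev ∨ l = star * rev := by
  revert l; decide

/-- Identifies `cocycle` as the multiplication table of the normal forms w^i e^j: in each of the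
sixteen products the central signs move to the front and w moves to the left of e, at the price of
η. -/
theorem monomial_mul {G : Type} [Group G] (σ : ℤˣ →* G) (hσ : ∀ e x, x * σ e = σ e * x)
    (w e : G) (a b η : ℤˣ) (hw : w * w = σ a) (he : e * e = σ b) (hew : e * w = σ η * (w * e))
    (x y : Label) :
    ((if x.1 = 1 then 1 else w) * (if x.2 = 1 then 1 else e)) *
      ((if y.1 = 1 then 1 else w) * (if y.2 = 1 then 1 else e)) =
    σ (cocycle a b η x y) *
      ((if (x * y).1 = 1 then 1 else w) * (if (x * y).2 = 1 then 1 else e)) := by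
  have hwl : ∀ z, w * (w * z) = σ a * z := fun z => by rw [← mul_assoc, hw]
  have hewl : ∀ z, e * (w * z) = σ η * (w * (e * z)) := fun z => by
    rw [← mul_assoc, hew]; simp only [mul_assoc]
  have hwσ : ∀ t z, w * (σ t * z) = σ t * (w * z) := fun t z => by
    rw [← mul_assoc, hσ, mul_assoc]
  have hσσ : ∀ t u, σ t * σ u = σ (t * u) := fun t u => (map_mul σ t u).symm
  have hσl : ∀ t u z, σ t * (σ u * z) = σ (t * u) * z := fun t u z => by
    rw [← mul_assoc, hσσ]
  have hwσ' : ∀ t, w * σ t = σ t * w := fun t => hσ t w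
  have d2 : Multiplicative.ofAdd (1 : ZMod 2) * Multiplicative.ofAdd 1 = 1 := by decide
  have d3 : Multiplicative.ofAdd (1 : ZMod 2) ≠ 1 := by decide
  rcases label_cases x with rfl | rfl | rfl | rfl <;>
    rcases label_cases y with rfl | rfl | rfl | rfl <;>
    simp only [star, rev, cocycle, Prod.fst_mul, Prod.snd_mul, Prod.fst_one, Prod.snd_one, d2, d3,
      one_mul, mul_one, if_true, if_false, ne_eq, not_true, not_false_eq_true, and_true, and_false,
      map_one, hw, he, hew, hwl, hewl, hwσ, hwσ', hσσ, hσl, mul_assoc] <;>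
    congr 1 <;> ac_rfl

/-! ### The covering as an extension of the Klein group by signs -/

section model

variable {R : Type} [Ring R] {W E C : R} {a b d η : ℤˣ}

/-- Sending an element of the model to its label and its signed normal form is a homomorphism, and
its image is generated by -1, W and E. Adding C changes nothing, since C = ±WE. The map is injective
because -1 ≠ 1 makes the sign visible. -/
theorem CoverModel.exists_equiv {G : Type} [Group G] (m : CoverModel a b η G)
    (hR : (-1 : R) ≠ 1) (hW : W * W = a • (1 : R)) (hE : E * E = b • (1 : R))
    (hWE : W * E = d • C) (hEW : E * W = η • (W * E)) :
    ∃ e : cover W E C ≃* G, ∀ x, m.lab (e x) = x.1.1 := by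
  let w : Rˣ := ⟨W, a • W, by rw [mul_smul_comm, hW, units_smul_smul_self],
    by rw [smul_mul_assoc, hW, units_smul_smul_self]⟩
  let e : Rˣ := ⟨E, b • E, by rw [mul_smul_comm, hE, units_smul_smul_self],
    by rw [smul_mul_assoc, hE, units_smul_smul_self]⟩
  have hw : w * w = unitSign R a := by ext; simp [w, hW, val_unitSign]
  have he : e * e = unitSign R b := by ext; simp [e, hE, val_unitSign]
  have hew : e * w = unitSign R η * (w * e) := by
    ext; simp [w, e, hEW, val_unitSign]
  let M : Label → Rˣ := fun x => (if x.1 = 1 then 1 else w) * (if x.2 = 1 then 1 else e)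
  have hM : ∀ x y, M x * M y = unitSign R (cocycle a b η x y) * M (x * y) :=
    monomial_mul (unitSign R) unitSign_comm w e a b η hw he hew
  let f : G →* Label × Rˣ := MonoidHom.mk' (fun g => (m.lab g, unitSign R (m.sign g) * M (m.lab g)))
    (fun g h => by
      refine Prod.ext (m.lab_mul g h) ?_
      change _ = (unitSign R (m.sign g) * M (m.lab g)) * (unitSign R (m.sign h) * M (m.lab h))
      rw [mul_assoc, ← mul_assoc (M _), unitSign_comm, mul_assoc, hM, m.sign_mul, m.lab_mul]
      simp only [map_mul, mul_assoc])
  have hf : ∀ g, f g = (m.lab g, unitSign R (m.sign g) * M (m.lab g)) := fun g => rfl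
  have hM1 : M 1 = 1 := by simp [M]
  have hMs : M star = w := by
    change w * 1 = w; rw [mul_one]
  have hMr : M rev = e := by
    change 1 * e = e; rw [one_mul]
  have hMsr : M (star * rev) = w * e := by
    rfl
  have hinj : Function.Injective f := by
    rw [injective_iff_map_eq_one]
    intro g hg
    rw [hf, Prod.mk_eq_one] at hg
    obtain ⟨h1, h2⟩ := hg
    rw [h1, hM1, mul_one] at h2
    exact m.inj g h1 (unitSign_injective hR h2)
  have hsurj : ∀ l t, ∃ g, f g = (l, unitSign R t * M l) := fun l t => by
    obtain ⟨g, hg, ht⟩ := m.surj l t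
    exact ⟨g, by rw [hf, hg, ht]⟩
  have hC : ∀ u : Rˣ, (u : R) = C → u = unitSign R d * M (star * rev) := fun u hu => by
    ext
    rw [hMsr, Units.val_mul, val_unitSign, Units.val_mul, smul_mul_assoc, one_mul]
    simp [w, e, hWE, hu, units_smul_smul_self]
  have hrange : f.range = cover W E C := by
    apply le_antisymm
    · have m1 : ((1 : Label), unitSign R (-1)) ∈ cover W E C :=
        Subgroup.subset_closure (Or.inl ⟨rfl, by simp [unitSign]⟩)
      have mW : (star, w) ∈ cover W E C :=
        Subgroup.subset_closure (Or.inr (Or.inl ⟨rfl, rfl⟩))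
      have mE : (rev, e) ∈ cover W E C :=
        Subgroup.subset_closure (Or.inr (Or.inr (Or.inl ⟨rfl, rfl⟩)))
      have mM : ∀ l, (l, M l) ∈ cover W E C := by
        intro l
        rcases label_cases l with rfl | rfl | rfl | rfl
        · rw [hM1]; exact one_mem _
        · rw [hMs]; exact mW
        · rw [hMr]; exact mE
        · rw [hMsr]; exact mul_mem mW mE
      rintro _ ⟨g, rfl⟩
      rw [hf]
      rcases Int.units_eq_one_or (m.sign g) with h | h <;> rw [h]
      · simpa using mM (m.lab g)
      · simpa using mul_mem m1 (mM (m.lab g))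
    · rw [cover, Subgroup.closure_le]
      rintro ⟨l, u⟩ (⟨h1, h2⟩ | ⟨h1, h2⟩ | ⟨h1, h2⟩ | ⟨h1, h2⟩) <;> dsimp only at h1 h2 <;> subst h1
      · obtain ⟨g, hg⟩ := hsurj 1 (-1)
        refine ⟨g, hg.trans (Prod.ext rfl ?_)⟩
        ext; simp [hM1, h2, unitSign]
      · obtain ⟨g, hg⟩ := hsurj star 1
        refine ⟨g, hg.trans (Prod.ext rfl ?_)⟩
        ext; simp [hMs, h2, w]
      · obtain ⟨g, hg⟩ := hsurj rev 1
        refine ⟨g, hg.trans (Prod.ext rfl ?_)⟩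
        ext; simp [hMr, h2, e]
      · obtain ⟨g, hg⟩ := hsurj (star * rev) d
        exact ⟨g, hg.trans (Prod.ext rfl (hC u h2).symm)⟩
  let F : G ≃* cover W E C := (MonoidHom.ofInjective hinj).trans (MulEquiv.subgroupCongr hrange)
  refine ⟨F.symm, fun x => ?_⟩
  obtain ⟨g, rfl⟩ := F.surjective x
  rw [MulEquiv.symm_apply_apply]
  rfl

end model

/-! ### Finite models for the eight sign patterns -/

/-- The model of `±I, ±W, ±E, ±C` in the elementary Abelian case. -/
def kleinModel : CoverModel 1 1 1
    (Multiplicative (ZMod 2) × Multiplicative (ZMod 2) × Multiplicative (ZMod 2)) where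
  lab g := g.2
  sign g := if g.1 = 1 then 1 else -1
  lab_mul := by decide
  sign_mul := by decide
  inj := by decide
  surj := by decide

/-- The label of `x ^ i * y ^ j`, where `y` is the label of an element of order four. -/
def wordLabel (x y : Label) (i j : ℕ) : Label := x ^ i * y ^ j

/-- The sign of `x ^ i * y ^ j`, where `y` is the label of an element of order four. -/
def wordSign (a b η : ℤˣ) (x y : Label) (i j : ℕ) : ℤˣ :=
  (if j < 2 then 1 else -1) * cocycle a b η (x ^ i) (y ^ j)

/-- The label on `ℤ₂ × ℤ₄`. -/
def cyclicLabel (x y : Label) (g : Multiplicative (ZMod 2) × Multiplicative (ZMod 4)) : Label :=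
  wordLabel x y (Multiplicative.toAdd g.1).val (Multiplicative.toAdd g.2).val

/-- The sign on `ℤ₂ × ℤ₄`. -/
def cyclicSign (a b : ℤˣ) (x y : Label) (g : Multiplicative (ZMod 2) × Multiplicative (ZMod 4)) :
    ℤˣ :=
  wordSign a b 1 x y (Multiplicative.toAdd g.1).val (Multiplicative.toAdd g.2).val

/-- The label on the dihedral group. -/
def dihedralLabel (x y : Label) : DihedralGroup 4 → Label
  | .r i => wordLabel x y 0 i.val
  | .sr i => wordLabel x y 1 i.val

/-- The sign on the dihedral group. -/
def dihedralSign (a b : ℤˣ) (x y : Label) : DihedralGroup 4 → ℤˣ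
  | .r i => wordSign a b (-1) x y 0 i.val
  | .sr i => wordSign a b (-1) x y 1 i.val

/-- The label on the quaternion group. -/
def quaternionLabel (x y : Label) : QuaternionGroup 2 → Label
  | .a i => wordLabel x y 0 i.val
  | .xa i => wordLabel x y 1 i.val

/-- The sign on the quaternion group. -/
def quaternionSign (a b : ℤˣ) (x y : Label) : QuaternionGroup 2 → ℤˣ
  | .a i => wordSign a b (-1) x y 0 i.val
  | .xa i => wordSign a b (-1) x y 1 i.val

/-- The model on `ℤ₂ × ℤ₄` for `W² = 1`, `E² = C² = -1`. -/
def cyclicModelE : CoverModel 1 (-1) 1 (Multiplicative (ZMod 2) × Multiplicative (ZMod 4)) where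
  lab := cyclicLabel star rev
  sign := cyclicSign 1 (-1) star rev
  lab_mul := by decide
  sign_mul := by decide
  inj := by decide
  surj := by decide

/-- The model on `ℤ₂ × ℤ₄` for `E² = 1`, `W² = C² = -1`. -/
def cyclicModelW : CoverModel (-1) 1 1 (Multiplicative (ZMod 2) × Multiplicative (ZMod 4)) where
  lab := cyclicLabel rev star
  sign := cyclicSign (-1) 1 rev star
  lab_mul := by decide
  sign_mul := by decide
  inj := by decide
  surj := by decide

/-- The model on `ℤ₂ × ℤ₄` for `C² = 1`, `W² = E² = -1`. -/
def cyclicModelC : CoverModel (-1) (-1) 1 (Multiplicative (ZMod 2) × Multiplicative (ZMod 4)) where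
  lab := cyclicLabel (star * rev) star
  sign := cyclicSign (-1) (-1) (star * rev) star
  lab_mul := by decide
  sign_mul := by decide
  inj := by decide
  surj := by decide

/-- The model on the dihedral group for `W² = E² = 1`, `C² = -1`. -/
def dihedralModelC : CoverModel 1 1 (-1) (DihedralGroup 4) where
  lab := dihedralLabel star (star * rev)
  sign := dihedralSign 1 1 star (star * rev)
  lab_mul := by decide
  sign_mul := by decide
  inj := by decide
  surj := by decide

/-- The model on the dihedral group for `W² = C² = 1`, `E² = -1`. -/
def dihedralModelE : CoverModel 1 (-1) (-1) (DihedralGroup 4) where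
  lab := dihedralLabel star rev
  sign := dihedralSign 1 (-1) star rev
  lab_mul := by decide
  sign_mul := by decide
  inj := by decide
  surj := by decide

/-- The model on the dihedral group for `E² = C² = 1`, `W² = -1`. -/
def dihedralModelW : CoverModel (-1) 1 (-1) (DihedralGroup 4) where
  lab := dihedralLabel rev star
  sign := dihedralSign (-1) 1 rev star
  lab_mul := by decide
  sign_mul := by decide
  inj := by decide
  surj := by decide

/-- The model on the quaternion group. -/
def quaternionModel : CoverModel (-1) (-1) (-1) (QuaternionGroup 2) where
  lab := quaternionLabel star rev
  sign := quaternionSign (-1) (-1) star rev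
  lab_mul := by decide
  sign_mul := by decide
  inj := by decide
  surj := by decide

/-! ### From the models to the isomorphism types -/

section ofModel

variable {R : Type} [Ring R] {W E C : R}

theorem mem_signs (x : cover W E C) : x ∈ signs W E C ↔ x.1.1 = 1 := Iff.rfl

theorem isOfType_klein {lab : Multiplicative (ZMod 2) × Multiplicative (ZMod 2) ×
    Multiplicative (ZMod 2) → Label} (hl : ∀ g, lab g = 1 ↔ g.2 = 1)
    (h : ∃ e : cover W E C ≃* _, ∀ x, lab (e x) = x.1.1) : IsOfType W E C .klein := by
  obtain ⟨e, he⟩ := h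
  refine ⟨⟨e⟩, (MonoidHom.snd _ _).comp e.toMonoidHom, ?_, ?_⟩
  · exact Prod.snd_surjective.comp e.surjective
  · ext x
    rw [MonoidHom.mem_ker, mem_signs, ← he, hl]
    rfl

/-- The projection to ℤ₄ has a kernel of order two, and `hl` says that this kernel meets the
elements over the identity automorphism only in 1; so what is divided out is not {±I}. -/
theorem isOfType_cyclic {lab : Multiplicative (ZMod 2) × Multiplicative (ZMod 4) → Label}
    (hl : ∀ g, g.2 = 1 → lab g = 1 → g = 1)
    (h : ∃ e : cover W E C ≃* _, ∀ x, lab (e x) = x.1.1) : IsOfType W E C .cyclic := by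
  obtain ⟨e, he⟩ := h
  refine ⟨⟨e⟩, (MonoidHom.snd _ _).comp e.toMonoidHom, ?_, ?_, ?_⟩
  · exact Prod.snd_surjective.comp e.surjective
  · have h1 : Nat.card {g : Multiplicative (ZMod 2) × Multiplicative (ZMod 4) // g.2 = 1} = 2 := by
      rw [Nat.card_eq_fintype_card]; decide
    exact (Nat.card_congr (e.toEquiv.subtypeEquiv fun x => Iff.rfl)).trans h1
  · rw [Subgroup.disjoint_def]
    intro x hx hs
    rw [mem_signs, ← he] at hs
    exact e.map_eq_one_iff.1 (hl _ hx hs)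

/-- The elements with trivial label are exactly the central ones, so dividing by the signs is
dividing by the center. -/
theorem isOfType_dihedral {lab : DihedralGroup 4 → Label}
    (hl : ∀ g, lab g = 1 ↔ ∀ h, h * g = g * h)
    (h : ∃ e : cover W E C ≃* _, ∀ x, lab (e x) = x.1.1) : IsOfType W E C .dihedral := by
  obtain ⟨e, he⟩ := h
  refine ⟨⟨e⟩, (QuotientGroup.mk' _).comp e.toMonoidHom, ?_, ?_⟩
  · exact (QuotientGroup.mk'_surjective _).comp e.surjective
  · ext x
    rw [mem_signs, ← he, hl, ← Subgroup.mem_center_iff, MonoidHom.mem_ker]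
    exact QuotientGroup.eq_one_iff _

theorem isOfType_quaternion {lab : QuaternionGroup 2 → Label}
    (hl : ∀ g, lab g = 1 ↔ ∀ h, h * g = g * h)
    (h : ∃ e : cover W E C ≃* _, ∀ x, lab (e x) = x.1.1) : IsOfType W E C .quaternion := by
  obtain ⟨e, he⟩ := h
  refine ⟨⟨e⟩, (QuotientGroup.mk' _).comp e.toMonoidHom, ?_, ?_⟩
  · exact (QuotientGroup.mk'_surjective _).comp e.surjective
  · ext x
    rw [mem_signs, ← he, hl, ← Subgroup.mem_center_iff, MonoidHom.mem_ker]
    exact QuotientGroup.eq_one_iff _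

/-- The isomorphism type belonging to a signature. -/
def typeOf : Bool → ℤˣ → ℤˣ → AutType
  | true, a, b => if a = 1 ∧ b = 1 then .klein else .cyclic
  | false, a, b => if a = -1 ∧ b = -1 then .quaternion else .dihedral

/-- The sign of the commutation rule. -/
def commSign (ab : Bool) : ℤˣ := if ab then 1 else -1

theorem isOfType_typeOf {ab : Bool} {a b d : ℤˣ} (hR : (-1 : R) ≠ 1) (hW : W * W = a • (1 : R))
    (hE : E * E = b • (1 : R)) (hWE : W * E = d • C) (hEW : E * W = commSign ab • (W * E)) :
    IsOfType W E C (typeOf ab a b) := by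
  cases ab <;> rcases Int.units_eq_one_or a with rfl | rfl <;>
    rcases Int.units_eq_one_or b with rfl | rfl
  · exact isOfType_dihedral (by decide) (dihedralModelC.exists_equiv hR hW hE hWE hEW)
  · exact isOfType_dihedral (by decide) (dihedralModelE.exists_equiv hR hW hE hWE hEW)
  · exact isOfType_dihedral (by decide) (dihedralModelW.exists_equiv hR hW hE hWE hEW)
  · exact isOfType_quaternion (by decide) (quaternionModel.exists_equiv hR hW hE hWE hEW)
  · exact isOfType_klein (by decide) (kleinModel.exists_equiv hR hW hE hWE hEW)
  · exact isOfType_cyclic (by decide) (cyclicModelE.exists_equiv hR hW hE hWE hEW)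
  · exact isOfType_cyclic (by decide) (cyclicModelW.exists_equiv hR hW hE hWE hEW)
  · exact isOfType_cyclic (by decide) (cyclicModelC.exists_equiv hR hW hE hWE hEW)

/-- The number of solutions of `x * x = 1` in the double covering. -/
def involutionCount : AutType → ℕ
  | .klein => 8
  | .cyclic => 4
  | .dihedral => 6
  | .quaternion => 2

theorem IsOfType.card_sq_eq_one {τ : AutType} (h : IsOfType W E C τ) :
    Nat.card {x : cover W E C // x * x = 1} = involutionCount τ := by
  have key : ∀ {G : Type} [Group G], Nonempty (cover W E C ≃* G) →
      Nat.card {x : cover W E C // x * x = 1} = Nat.card {x : G // x * x = 1} := by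
    rintro G _ ⟨e⟩
    refine Nat.card_congr (e.toEquiv.subtypeEquiv fun x => ?_)
    change _ ↔ e x * e x = 1
    rw [← map_mul, e.map_eq_one_iff]
  cases τ <;> rw [key h.1, Nat.card_eq_fintype_card] <;> decide

/-- The number of solutions of x² = 1 in the covering, namely 8, 4, 6 or 2, tells the four types
apart. This is what turns the lists of occurring groups into exact lists. -/
theorem IsOfType.unique {τ τ' : AutType} (h : IsOfType W E C τ) (h' : IsOfType W E C τ') :
    τ = τ' := by
  have := h.card_sq_eq_one.symm.trans h'.card_sq_eq_one
  revert this
  cases τ <;> cases τ' <;> simp [involutionCount]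

end ofModel

/-! ### Automorphism groups from abstract sign relations -/

section abstractAut

variable {R : Type} [Ring R] {W E C : R} {a b c d : ℤˣ}

theorem isAutMinus_of (hR : (-1 : R) ≠ 1) (hW : W * W = a • (1 : R)) (hE : E * E = b • (1 : R))
    (hC : C * C = c • (1 : R)) (hWE : W * E = d • C) (hEW : E * W = W * E) :
    IsAutMinus W E C (typeOf true a b) a b c := by
  have hC' : C = d • (W * E) := by rw [hWE, units_smul_smul_self]
  refine ⟨⟨hEW.symm, ?_, ?_⟩, ?_, ?_, ?_, ?_⟩
  · rw [hC', mul_smul_comm, smul_mul_assoc, mul_assoc, hEW]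
  · rw [hC', mul_smul_comm, smul_mul_assoc, ← mul_assoc, hEW]
  · rw [hW, intCast_units]
  · rw [hE, intCast_units]
  · rw [hC, intCast_units]
  · exact isOfType_typeOf (ab := true) hR hW hE hWE (by rw [hEW]; simp [commSign])

theorem isAutPlus_of (hR : (-1 : R) ≠ 1) (hW : W * W = a • (1 : R)) (hE : E * E = b • (1 : R))
    (hC : C * C = c • (1 : R)) (hWE : W * E = d • C) (hEW : E * W = -(W * E)) :
    IsAutPlus W E C (typeOf false a b) a b c := by
  have hC' : C = d • (W * E) := by rw [hWE, units_smul_smul_self]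
  refine ⟨⟨by rw [hEW, neg_neg], ?_, ?_⟩, ?_, ?_, ?_, ?_⟩
  · rw [hC', mul_smul_comm, smul_mul_assoc, mul_assoc W E, hEW, mul_neg, smul_neg, neg_neg]
  · rw [hC', mul_smul_comm, smul_mul_assoc, ← mul_assoc, hEW, neg_mul, smul_neg]
  · rw [hW, intCast_units]
  · rw [hE, intCast_units]
  · rw [hC, intCast_units]
  · exact isOfType_typeOf (ab := false) hR hW hE hWE (by
      rw [hEW]; simp [commSign])

end abstractAut

/-! ### The units of a Clifford algebra -/

section units

variable {F : Type} [Field F] {n : ℕ} (s : Fin n → ℤˣ)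

theorem diagForm_apply (v : Fin n → F) :
    diagForm F s v = ∑ i, ((s i : ℤ) : F) * (v i * v i) := by
  simp only [diagForm, QuadraticMap.weightedSumSquares_apply, smul_eq_mul]

theorem isCliffordFamily_unit : IsCliffordFamily s (unit F s) where
  sq i := by
    rw [unit, CliffordAlgebra.ι_sq_scalar, diagForm_apply, Finset.sum_eq_single i]
    · simp [Units.smul_def]
    · intro j _ hj; simp [hj]
    · simp
  anticomm i j hij := by
    rw [unit, unit]
    apply CliffordAlgebra.ι_mul_ι_comm_of_isOrtho
    rw [QuadraticMap.isOrtho_def]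
    simp only [diagForm_apply, ← Finset.sum_add_distrib]
    refine Finset.sum_congr rfl fun k _ => ?_
    by_cases hi : k = i
    · subst hi; simp [hij]
    · simp [hi]

/-- `e i` anticommutes with the n - 1 other factors and commutes with itself, and n - 1 is odd. -/
theorem unit_mul_volume (hn : Even n) (i : Fin n) :
    unit F s i * volume F s = -(volume F s * unit F s i) := by
  rw [volume, (isCliffordFamily_unit s).mul_prod_of_mem (List.nodup_finRange n)
    (List.mem_finRange i), List.length_finRange, pow_succ, hn.neg_one_pow, one_mul,
    neg_one_smul_units]

theorem ι_eq_sum (v : Fin n → F) :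
    CliffordAlgebra.ι (diagForm F s) v = ∑ i, v i • unit F s i := by
  conv_lhs => rw [pi_eq_sum_univ' v]
  simp only [map_sum, map_smul]
  rfl

variable {s} in
/-- Induction over the Clifford algebra, starting from its units. -/
theorem cliffAlg_induction {p : CliffAlg F s → Prop} (hF : ∀ r, p (algebraMap F _ r))
    (hu : ∀ i, p (unit F s i)) (hmul : ∀ a b, p a → p b → p (a * b))
    (hadd : ∀ a b, p a → p b → p (a + b)) (a : CliffAlg F s) : p a := by
  induction a using CliffordAlgebra.induction with
  | algebraMap r => exact hF r
  | ι v =>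
    rw [ι_eq_sum]
    refine Finset.sum_induction _ p hadd (by simpa using hF 0) fun i _ => ?_
    rw [Algebra.smul_def]
    exact hmul _ _ (hF _) (hu i)
  | mul a b ha hb => exact hmul a b ha hb
  | add a b ha hb => exact hadd a b ha hb

theorem involute_unit (i : Fin n) : CliffordAlgebra.involute (unit F s i) = -unit F s i :=
  CliffordAlgebra.involute_ι _

theorem reverse_unit (i : Fin n) : CliffordAlgebra.reverse (unit F s i) = unit F s i :=
  CliffordAlgebra.reverse_ι _

/-- Both sides are compatible with sums and products, so the units decide. Evenness of n is
essential: for odd n the volume element is central. -/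
theorem involute_mul_volume (hn : Even n) (a : CliffAlg F s) :
    CliffordAlgebra.involute a * volume F s = volume F s * a := by
  induction a using cliffAlg_induction with
  | hF r => rw [AlgHom.commutes, Algebra.commutes]
  | hu i => rw [involute_unit, neg_mul, unit_mul_volume s hn, neg_neg]
  | hmul a b ha hb => rw [map_mul, mul_assoc, hb, ← mul_assoc, ha, mul_assoc]
  | hadd a b ha hb => rw [map_add, add_mul, ha, hb, mul_add]

end units

/-! ### Fundamental automorphisms in a spinbasis -/

theorem length_filter_finRange {n : ℕ} (Q : Fin n → Prop) {_ : DecidablePred Q} :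
    ((List.finRange n).filter (fun i => decide (Q i))).length = {i | Q i}.ncard := by
  rw [← List.toFinset_card_of_nodup ((List.nodup_finRange n).filter _), ← Set.ncard_coe_finset]
  congr 1; ext i; simp

namespace SpinBasis

variable {F : Type} [Field F] [CharZero F] {n : ℕ} {s : Fin n → ℤˣ} {K : Type} [Ring K]
  [Algebra F K] {N : ℕ} (B : SpinBasis F s K N)

-- Excludes the zero ring, in particular `N = 0`: the Clifford algebra is nontrivial because 2 is
-- invertible.
include B in
theorem nontrivial : Nontrivial (Matrix (Fin N) (Fin N) K) := by
  let _ : Invertible (2 : F) := invertibleOfNonzero two_ne_zero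
  exact B.γ.injective.nontrivial

include B in
theorem neg_one_ne_one : (-1 : Matrix (Fin N) (Fin N) K) ≠ 1 := by
  have := B.nontrivial
  intro h
  have h2 : algebraMap F (Matrix (Fin N) (Fin N) K) 2 = 0 := by
    rw [map_ofNat, ← one_add_one_eq_two]; nth_rw 1 [← h]; exact neg_add_cancel 1
  have : (1 : Matrix (Fin N) (Fin N) K) = algebraMap F _ (2⁻¹ * 2) := by
    rw [inv_mul_cancel₀ two_ne_zero, map_one]
  rw [map_mul, h2, mul_zero] at this
  exact one_ne_zero this

omit [CharZero F] in
theorem isCliffordFamily_mat : IsCliffordFamily s B.mat :=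
  (isCliffordFamily_unit s).map B.γ

omit [CharZero F] in
theorem volMat_eq : B.volMat = ((List.finRange n).map B.mat).prod := by
  rw [volMat, volume, map_list_prod, List.map_map]; rfl

omit [CharZero F] in
theorem prodOver_congr {P Q : Fin n → Prop} (h : ∀ i, P i ↔ Q i) : B.prodOver P = B.prodOver Q := by
  rw [funext fun i => propext (h i)]

omit [CharZero F] in
theorem volMat_eq_prodOver : B.volMat = B.prodOver (fun _ => True) := by
  rw [volMat_eq, prodOver]; simp

omit [CharZero F] in
theorem isUnit_prodOver (P : Fin n → Prop) : IsUnit (B.prodOver P) :=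
  B.isCliffordFamily_mat.isUnit_prod _

open Classical in
omit [CharZero F] in
theorem prodOver_sq (P : Fin n → Prop) :
    B.prodOver P * B.prodOver P =
      ((-1 : ℤˣ) ^ (({i | P i ∧ s i = 1}.ncard + {i | P i ∧ s i = -1}.ncard).choose 2) *
        (-1) ^ {i | P i ∧ s i = -1}.ncard) • 1 := by
  rw [prodOver, B.isCliffordFamily_mat.prod_sq ((List.nodup_finRange n).filter _), prod_map_sign,
    length_eq_countP_sign s, List.countP_filter, List.countP_filter, List.countP_eq_length_filter,
    List.countP_eq_length_filter, ← length_filter_finRange, ← length_filter_finRange]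
  have h : ∀ e : ℤˣ, (fun i => decide (s i = e) && decide (P i)) =
      fun i => decide (P i ∧ s i = e) := fun e => by
    ext i; rw [Bool.and_comm]; simp
  rw [h, h]

open Classical in
omit [CharZero F] in
theorem mat_mul_prodOver (P : Fin n → Prop) (i : Fin n) :
    B.mat i * B.prodOver P = (-1 : ℤˣ) ^ ({j | P j}.ncard + if P i then 1 else 0) •
      (B.prodOver P * B.mat i) := by
  rw [prodOver]
  split_ifs with h
  · rw [B.isCliffordFamily_mat.mul_prod_of_mem ((List.nodup_finRange n).filter _) (by simpa),
      length_filter_finRange]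
  · rw [B.isCliffordFamily_mat.mul_prod_of_notMem (by simpa),
      length_filter_finRange, add_zero]

open Classical in
omit [CharZero F] in
theorem prodOver_mul_prodOver {P Q : Fin n → Prop} (hPQ : ∀ i, P i → ¬ Q i) :
    B.prodOver P * B.prodOver Q =
      (-1 : ℤˣ) ^ ({j | P j}.ncard * {j | Q j}.ncard) • (B.prodOver Q * B.prodOver P) := by
  rw [prodOver, prodOver, B.isCliffordFamily_mat.prod_mul_prod, length_filter_finRange,
    length_filter_finRange]
  intro i h1 h2
  simp at h1 h2
  exact hPQ i h1 h2

-- The increasing product over all indices is a permutation of the product over P followed by the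
-- product over its complement.
open Classical in
omit [CharZero F] in
theorem exists_volMat_eq (P : Fin n → Prop) :
    ∃ e : ℤˣ, B.volMat = e • (B.prodOver P * B.prodOver (fun i => ¬ P i)) := by
  have hp := (List.filter_append_perm (fun i => decide (P i)) (List.finRange n)).symm
  obtain ⟨e, he⟩ := B.isCliffordFamily_mat.exists_prod_eq_of_perm hp
  refine ⟨e, ?_⟩
  rw [volMat_eq, he, List.map_append, List.prod_append, prodOver, prodOver]
  simp

theorem ncard_add_ncard_not {n : ℕ} (P : Fin n → Prop) :
    {j | P j}.ncard + {j | ¬ P j}.ncard = n := by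
  have := Set.ncard_add_ncard_compl {j | P j}
  simpa [Set.compl_ofPred] using this

/-- `P` separates symmetric from skewsymmetric basis matrices. -/
def Separates (P : Fin n → Prop) : Prop := ∀ i, (P i → B.IsSymm i) ∧ (¬ P i → B.IsSkew i)

variable {B} {P : Fin n → Prop} (hP : B.Separates P)

include hP

omit [CharZero F]

theorem Separates.transpose [DecidablePred P] (i : Fin n) :
    (B.mat i).transpose = (if P i then (1 : ℤˣ) else -1) • B.mat i := by
  split_ifs with h
  · rw [one_smul]; exact (hP i).1 h
  · rw [neg_one_smul_units]; exact (hP i).2 h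

/-- A skewsymmetric matrix passes k - 1 other factors of Y, a symmetric one passes k; for even k the
signs are -1 and 1, the same as under transposition. Since n is even, X has evenly many factors too,
and there the two signs are reversed, as conjugation demands. -/
theorem Separates.represents_even (hn : Even n) (hk : Even {j | ¬ P j}.ncard) :
    B.Represents B.volMat (B.prodOver fun i => ¬ P i) (B.prodOver P) where
  W_eq := rfl
  isUnit_W := by rw [volMat_eq_prodOver]; exact B.isUnit_prodOver _
  isUnit_E := B.isUnit_prodOver _
  isUnit_C := B.isUnit_prodOver _
  involution a := by rw [volMat, ← map_mul, ← map_mul, involute_mul_volume s hn]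
  reversion i := by
    classical
    rw [hP.transpose, mat_mul_prodOver, mul_smul_comm]
    congr 1
    by_cases h : P i <;> simp [h, hk.neg_one_pow, pow_add]
  conjugation i := by
    classical
    have hk' : Even {j | P j}.ncard := by
      have := ncard_add_ncard_not P; rw [← this, Nat.even_add] at hn; exact hn.2 hk
    rw [hP.transpose, neg_mul, mat_mul_prodOver, mul_smul_comm, ← neg_one_smul_units, smul_smul]
    congr 1
    by_cases h : P i <;> simp [h, hk'.neg_one_pow, pow_add]

/-- With an odd number of factors in both products the parities of the even case are shifted by one,
so X and Y exchange their roles. -/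
theorem Separates.represents_odd (hn : Even n) (hk : Odd {j | ¬ P j}.ncard) :
    B.Represents B.volMat (B.prodOver P) (B.prodOver fun i => ¬ P i) where
  W_eq := rfl
  isUnit_W := by rw [volMat_eq_prodOver]; exact B.isUnit_prodOver _
  isUnit_E := B.isUnit_prodOver _
  isUnit_C := B.isUnit_prodOver _
  involution a := by rw [volMat, ← map_mul, ← map_mul, involute_mul_volume s hn]
  reversion i := by
    classical
    have hk' : Odd {j | P j}.ncard := by
      have := ncard_add_ncard_not P; rw [← this, Nat.even_add'] at hn; exact hn.2 hk
    rw [hP.transpose, mat_mul_prodOver, mul_smul_comm]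
    congr 1
    by_cases h : P i <;> simp [h, hk'.neg_one_pow, pow_add]
  conjugation i := by
    classical
    rw [hP.transpose, neg_mul, mat_mul_prodOver, mul_smul_comm, ← neg_one_smul_units, smul_smul]
    congr 1
    by_cases h : P i <;> simp [h, hk.neg_one_pow, pow_add]

omit hP

theorem prodOver_comm_of_even (hk : Even {j | ¬ P j}.ncard) :
    B.prodOver P * B.prodOver (fun i => ¬ P i) = B.prodOver (fun i => ¬ P i) * B.prodOver P := by
  rw [prodOver_mul_prodOver _ (fun _ h => not_not_intro h), (hk.mul_left _).neg_one_pow, one_smul]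

theorem prodOver_anticomm_of_odd (hn : Even n) (hk : Odd {j | ¬ P j}.ncard) :
    B.prodOver P * B.prodOver (fun i => ¬ P i) =
      -(B.prodOver (fun i => ¬ P i) * B.prodOver P) := by
  have hk' : Odd {j | P j}.ncard := by
    have := ncard_add_ncard_not P; rw [← this, Nat.even_add'] at hn; exact hn.2 hk
  rw [prodOver_mul_prodOver _ (fun _ h => not_not_intro h), (hk'.mul hk).neg_one_pow, neg_one_smul_units]

variable [CharZero F]

theorem isAutMinus_prodOver (hk : Even {j | ¬ P j}.ncard) {a b c : ℤˣ}
    (hW : B.volMat * B.volMat = a • 1)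
    (hY : B.prodOver (fun i => ¬ P i) * B.prodOver (fun i => ¬ P i) = b • 1)
    (hX : B.prodOver P * B.prodOver P = c • 1) :
    IsAutMinus B.volMat (B.prodOver fun i => ¬ P i) (B.prodOver P) (typeOf true a b) a b c := by
  obtain ⟨e, he⟩ := B.exists_volMat_eq P
  -- With W = e X Y and Y² = b one gets W Y = e b X.
  refine isAutMinus_of (d := e * b) B.neg_one_ne_one hW hY hX ?_ ?_
  · rw [he, smul_mul_assoc, mul_assoc, hY, mul_smul_comm, mul_one, smul_smul]
  · rw [he, smul_mul_assoc, mul_smul_comm, ← mul_assoc, prodOver_comm_of_even hk]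

theorem isAutPlus_prodOver (hn : Even n) (hk : Odd {j | ¬ P j}.ncard) {a b c : ℤˣ}
    (hW : B.volMat * B.volMat = a • 1)
    (hX : B.prodOver P * B.prodOver P = b • 1)
    (hY : B.prodOver (fun i => ¬ P i) * B.prodOver (fun i => ¬ P i) = c • 1) :
    IsAutPlus B.volMat (B.prodOver P) (B.prodOver fun i => ¬ P i) (typeOf false a b) a b c := by
  obtain ⟨e, he⟩ := B.exists_volMat_eq P
  have h := prodOver_anticomm_of_odd (B := B) hn hk
  have h' : B.prodOver (fun i => ¬ P i) * B.prodOver P =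
      -(B.prodOver P * B.prodOver (fun i => ¬ P i)) := by rw [h, neg_neg]
  -- Here E = X, and Y X = -X Y gives W X = -e X² Y = -e b Y.
  refine isAutPlus_of (d := -(e * b)) B.neg_one_ne_one hW hX hY ?_ ?_
  · rw [he, smul_mul_assoc, mul_assoc, h', mul_neg, ← mul_assoc, hX, smul_mul_assoc, one_mul,
      smul_neg, smul_smul, ← neg_one_smul_units, smul_smul, neg_one_mul]
  · rw [he, smul_mul_assoc, mul_smul_comm, mul_assoc (B.prodOver P), h', mul_neg, smul_neg,
      neg_neg]

end SpinBasis

/-- Over a commutative ring, `E` and `C` represent the antiautomorphisms on the whole algebra. -/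
theorem SpinBasis.Represents.onAlgebra {F : Type} [Field F] {n : ℕ} {s : Fin n → ℤˣ} {K : Type}
    [CommRing K] [Algebra F K] {N : ℕ} {B : SpinBasis F s K N} {W E C : Matrix (Fin N) (Fin N) K}
    (h : B.Represents W E C) : B.RepresentsOnAlgebra E C := by
  intro a
  induction a using cliffAlg_induction with
  | hF r =>
    simp only [CliffordAlgebra.reverse.commutes, AlgHom.commutes, AlgEquiv.commutes,
      Matrix.algebraMap_eq_diagonal, Matrix.diagonal_transpose]
    simp only [← Matrix.algebraMap_eq_diagonal, Algebra.commutes, and_self]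
  | hu i =>
    rw [involute_unit, map_neg, reverse_unit, map_neg]
    exact ⟨h.reversion i, h.conjugation i⟩
  -- This is where `K` must be commutative: transposition has to reverse products.
  | hmul a b ha hb =>
    simp only [map_mul, CliffordAlgebra.reverse.map_mul, Matrix.transpose_mul]
    constructor
    · rw [mul_assoc, ha.1, ← mul_assoc, hb.1, mul_assoc]
    · rw [mul_assoc, ha.2, ← mul_assoc, hb.2, mul_assoc]
  | hadd a b ha hb =>
    simp only [map_add, add_mul, Matrix.transpose_add, mul_add, ha.1, ha.2, hb.1, hb.2, and_self]

/-! ### Homomorphisms from Clifford algebras -/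

section lift

variable {F : Type} [Field F] [CharZero F] {n : ℕ} {s : Fin n → ℤˣ}

variable (F s) in
theorem finrank_cliffAlg : Module.finrank F (CliffAlg F s) = 2 ^ n := by
  let _ : Invertible (2 : F) := invertibleOfNonzero two_ne_zero
  rw [(CliffordAlgebra.equivExterior (diagForm F s)).finrank_eq,
    Module.finrank_eq_card_basis (Pi.basisFun F (Fin n)).ExteriorAlgebra, Fintype.card_finset,
    Fintype.card_fin]

instance finiteDimensional_cliffAlg : FiniteDimensional F (CliffAlg F s) :=
  .of_finrank_pos (by rw [finrank_cliffAlg]; positivity)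

variable {A : Type*} [Ring A] [Algebra F A] {f : Fin n → A}

/-- As 2 is invertible, the quadratic identity may be polarized and tested on pairs of basis
vectors: equal ones use the squares, distinct ones the anticommutation. -/
theorem IsCliffordFamily.sum_sq (h : IsCliffordFamily s f) (v : Fin n → F) :
    Fintype.linearCombination F f v * Fintype.linearCombination F f v =
      algebraMap F A (diagForm F s v) := by
  have h2 : IsUnit (2 : A) := by
    rw [← map_ofNat (algebraMap F A)]; exact (isUnit_iff_ne_zero.2 two_ne_zero).map _
  revert v
  rw [CliffordAlgebra.forall_mul_self_eq_iff h2]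
  ext i j
  simp only [LinearMap.add_apply, LinearMap.comp_apply, LinearMap.compl₂_apply,
    LinearMap.flip_apply, LinearMap.mul_apply', LinearMap.compr₂_apply, LinearMap.coe_single,
    Fintype.linearCombination_apply_single, one_smul, QuadraticMap.polarBilin_apply_apply,
    Algebra.linearMap_apply, QuadraticMap.polar]
  rw [diagForm_apply, diagForm_apply, diagForm_apply, ← Finset.sum_sub_distrib,
    ← Finset.sum_sub_distrib, Finset.sum_eq_single i]
  · by_cases hij : i = j
    · subst hij
      -- The polar form at two equal basis vectors is Q(2e) - 2Q(e) = 2Q(e).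
      have h3 : ((s i : ℤ) : F) * (2 * 2) - ((s i : ℤ) : F) - ((s i : ℤ) : F) =
          (s i : ℤ) + (s i : ℤ) := by ring
      simp only [Pi.add_apply, Pi.single_eq_same, one_add_one_eq_two, mul_one]
      rw [h3, h.sq, map_add, map_intCast, Units.smul_def, zsmul_eq_mul, mul_one]
    · rw [h.anticomm i j hij]
      simp [hij]
  · intro k _ hk
    simp [hk]
  · simp

/-- The homomorphism from the Clifford algebra that is given by a Clifford family. -/
def IsCliffordFamily.lift (h : IsCliffordFamily s f) : CliffAlg F s →ₐ[F] A :=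
  CliffordAlgebra.lift _ ⟨Fintype.linearCombination F f, h.sum_sq⟩

theorem IsCliffordFamily.lift_unit (h : IsCliffordFamily s f) (i : Fin n) :
    h.lift (F := F) (unit F s i) = f i := by
  rw [IsCliffordFamily.lift, unit, CliffordAlgebra.lift_ι_apply,
    Fintype.linearCombination_apply_single, one_smul]

theorem IsCliffordFamily.lift_volume (h : IsCliffordFamily s f) :
    h.lift (F := F) (volume F s) = ((List.finRange n).map f).prod := by
  rw [volume, map_list_prod, List.map_map]
  congr 2
  ext i; exact h.lift_unit i

-- Up to sign x is f i (f i x). Moving f i past x changes the sign, while moving it around the trace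
-- does not, so the trace equals its own negative.
omit [CharZero F] in
theorem trace_eq_zero_of_anticomm [CharZero F] (h : IsCliffordFamily s f) (τ : A →ₗ[F] F)
    (hτ : ∀ x y, τ (x * y) = τ (y * x)) {x : A} {i : Fin n} (hx : f i * x = -(x * f i)) :
    τ x = 0 := by
  have h1 : τ (f i * (f i * x)) = -τ (f i * (f i * x)) := by
    conv_lhs => rw [hx, mul_neg, map_neg, ← mul_assoc, hτ]
  rw [← mul_assoc, h.sq, smul_mul_assoc, one_mul, map_units_smul] at h1
  have h2 := self_eq_neg.1 h1
  rw [← units_smul_smul_self (s i) (τ x), h2, smul_zero]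

-- Distinct words are orthogonal for the trace form: some generator anticommutes with the product of
-- the two words, by the parity of length plus multiplicity.
open Classical in
theorem IsCliffordFamily.trace_mul_eq_zero (h : IsCliffordFamily s f) (hn : Even n)
    (τ : A →ₗ[F] F) (hτ : ∀ x y, τ (x * y) = τ (y * x)) {S T : Finset (Fin n)} (hST : S ≠ T) :
    τ ((T.toList.map f).prod * (S.toList.map f).prod) = 0 := by
  have hc : ∀ (U : Finset (Fin n)) i, U.toList.count i = if i ∈ U then 1 else 0 := by
    intro U i
    split_ifs with hi
    · exact List.count_eq_one_of_mem U.nodup_toList (by simpa)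
    · exact List.count_eq_zero_of_not_mem (by simpa)
  have key : ∃ i, Odd ((T.toList ++ S.toList).length + (T.toList ++ S.toList).count i) := by
    simp only [List.length_append, Finset.length_toList, List.count_append, hc]
    rcases Nat.even_or_odd (T.card + S.card) with he | ho
    -- Even total length: a generator that belongs to exactly one of the two words occurs once.
    · obtain ⟨i, hi⟩ : ∃ i, ¬ (i ∈ S ↔ i ∈ T) := by
        by_contra! hcon
        exact hST (Finset.ext hcon)
      refine ⟨i, he.add_odd ?_⟩
      by_cases h1 : i ∈ S <;> by_cases h2 : i ∈ T <;> simp_all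
    -- Odd total length: a generator in both words or in neither is needed. It is missing only if T
    -- is the complement of S, but then the total length is n, which is even.
    · obtain ⟨i, hi⟩ : ∃ i, (i ∈ S ↔ i ∈ T) := by
        by_contra! hcon
        have hTS : T = Sᶜ := by
          ext i
          have := hcon i
          rw [Finset.mem_compl]; tauto
        rw [hTS, Finset.card_compl, Fintype.card_fin, Nat.sub_add_cancel
          (by simpa using Finset.card_le_univ S)] at ho
        exact (Nat.not_even_iff_odd.2 ho) hn
      refine ⟨i, ho.add_even ?_⟩
      by_cases h1 : i ∈ S <;> by_cases h2 : i ∈ T <;> simp_all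
  obtain ⟨i, hi⟩ := key
  refine trace_eq_zero_of_anticomm h τ hτ (i := i) ?_
  rw [← List.prod_append, ← List.map_append, h.mul_prod, hi.neg_one_pow, neg_one_smul_units]

/-- A Clifford family with an even number of elements in an algebra of dimension `2 ^ n`
with a trace. -/
theorem IsCliffordFamily.lift_bijective (h : IsCliffordFamily s f) (hn : Even n)
    (τ : A →ₗ[F] F) (hτ : ∀ x y, τ (x * y) = τ (y * x)) (hτ1 : τ 1 ≠ 0)
    (hdim : Module.finrank F A = 2 ^ n) : Function.Bijective (h.lift (F := F)) := by
  have : FiniteDimensional F A := .of_finrank_pos (by rw [hdim]; positivity)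
  have li : LinearIndependent F (fun S : Finset (Fin n) => (S.toList.map f).prod) := by
    rw [Fintype.linearIndependent_iff]
    intro g hg T
    -- Pairing a linear relation with the word T leaves only the coefficient of T, multiplied by ±τ
    -- 1.
    have h1 := congrArg (fun x => τ ((T.toList.map f).prod * x)) hg
    simp only [Finset.mul_sum, map_sum, mul_zero, map_zero, mul_smul_comm, map_smul] at h1
    rw [Finset.sum_eq_single T, h.prod_sq T.nodup_toList, map_units_smul] at h1
    · rw [smul_eq_mul, mul_eq_zero] at h1
      refine h1.resolve_right fun h2 => hτ1 ?_
      simpa [units_smul_smul_self] using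
        congrArg (((-1 : ℤˣ) ^ (T.toList.length.choose 2) * (T.toList.map s).prod) • ·) h2
    · intro S _ hST
      rw [h.trace_mul_eq_zero hn τ hτ hST, smul_zero]
    · simp
  -- The 2^n independent words span A by dimension, and each is the image of the corresponding
  -- product of units.
  have hsurj : Function.Surjective (h.lift (F := F)).toLinearMap := by
    rw [← LinearMap.range_eq_top, ← top_le_iff,
      ← li.span_eq_top_of_card_eq_finrank' (by simp [hdim]), Submodule.span_le]
    rintro _ ⟨S, rfl⟩
    refine ⟨(S.toList.map (unit F s)).prod, ?_⟩
    rw [AlgHom.toLinearMap_apply, map_list_prod, List.map_map]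
    dsimp only
    congr 2
    ext i; exact h.lift_unit i
  exact ⟨(LinearMap.injective_iff_surjective_of_finrank_eq_finrank
    (by rw [hdim, finrank_cliffAlg])).2 hsurj, hsurj⟩

end lift

/-! ### Uniqueness of the matrices of the fundamental automorphisms -/

/-- Commuting with the matrix units forces a scalar matrix, and commuting with the scalar matrices
puts its entry into the center of `K`, which `hK` identifies with `F`. -/
theorem matrix_eq_algebraMap_of_commute {F K : Type} [Field F] [Ring K] [Algebra F K] {N : ℕ}
    (hK : ∀ z : K, (∀ x, z * x = x * z) → ∃ r : F, z = algebraMap F K r)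
    (Z : Matrix (Fin N) (Fin N) K) (hZ : ∀ M, Z * M = M * Z) :
    ∃ r : F, Z = algebraMap F _ r := by
  obtain ⟨z, rfl⟩ := Matrix.mem_range_scalar_iff_commute_single'.2
    fun i j => (hZ (Matrix.single i j 1)).symm
  rcases isEmpty_or_nonempty (Fin N) with hN | ⟨⟨i⟩⟩
  · exact ⟨0, Subsingleton.elim _ _⟩
  · obtain ⟨r, rfl⟩ := hK z fun x => by
      have := congrFun (congrFun (hZ (Matrix.scalar _ x)) i) i
      simpa [Matrix.scalar_apply] using this
    exact ⟨r, by rw [Matrix.algebraMap_eq_diagonal]; rfl⟩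

/-- The quaternion unit `i`. -/
def quatI : ℍ[ℝ] := ⟨0, 1, 0, 0⟩

/-- The quaternion unit `j`. -/
def quatJ : ℍ[ℝ] := ⟨0, 0, 1, 0⟩

theorem quatI_re : quatI.re = 0 := rfl
theorem quatI_imI : quatI.imI = 1 := rfl
theorem quatI_imJ : quatI.imJ = 0 := rfl
theorem quatI_imK : quatI.imK = 0 := rfl
theorem quatJ_re : quatJ.re = 0 := rfl
theorem quatJ_imI : quatJ.imI = 0 := rfl
theorem quatJ_imJ : quatJ.imJ = 1 := rfl
theorem quatJ_imK : quatJ.imK = 0 := rfl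

theorem quatI_mul_quatI : quatI * quatI = -1 := by
  ext <;> simp [quatI_re, quatI_imI, quatI_imJ, quatI_imK]

theorem quatJ_mul_quatJ : quatJ * quatJ = -1 := by
  ext <;> simp [quatJ_re, quatJ_imI, quatJ_imJ, quatJ_imK]

theorem quatJ_mul_quatI : quatJ * quatI = -(quatI * quatJ) := by
  ext <;> simp [quatI_re, quatI_imI, quatI_imJ, quatI_imK, quatJ_re, quatJ_imI, quatJ_imJ,
    quatJ_imK]

theorem quaternion_center (z : ℍ[ℝ]) (hz : ∀ x, z * x = x * z) :
    ∃ r : ℝ, z = algebraMap ℝ ℍ[ℝ] r := by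
  have h1 := Quaternion.ext_iff.1 (hz quatI)
  have h2 := Quaternion.ext_iff.1 (hz quatJ)
  simp only [Quaternion.re_mul, Quaternion.imI_mul, Quaternion.imJ_mul, Quaternion.imK_mul,
    quatI_re, quatI_imI, quatI_imJ, quatI_imK, quatJ_re, quatJ_imI, quatJ_imJ, quatJ_imK]
    at h1 h2
  refine ⟨z.re, ?_⟩
  ext <;> simp <;> linarith [h1.2.2.1, h1.2.2.2, h2.2.2.2, h2.2.1]

namespace SpinBasis

variable {n : ℕ} {s : Fin n → ℤˣ} {K : Type} [Ring K] [Algebra ℝ K] {N : ℕ}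
  {B : SpinBasis ℝ s K N} {W E C : Matrix (Fin N) (Fin N) K}

/-- Both WE and C carry each transposed basis matrix to the negative of that matrix, so C⁻¹WE
commutes with all transposed basis matrices. It is therefore central and, by `hK`, a real scalar. -/
theorem Represents.exists_smul (h : B.Represents W E C)
    (hK : ∀ z : K, (∀ x, z * x = x * z) → ∃ r : ℝ, z = algebraMap ℝ K r) :
    ∃ r : ℝ, W * E = r • C := by
  obtain ⟨⟨C', D, hCD, hDC⟩, rfl⟩ := h.isUnit_C
  have h1 : ∀ i, B.mat i * (W * E) = -(W * E * (B.mat i).transpose) := fun i => by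
    have := h.involution (unit ℝ s i)
    rw [involute_unit, map_neg, neg_mul] at this
    rw [← mul_assoc, ← neg_eq_iff_eq_neg, ← neg_mul]
    change -(B.γ (unit ℝ s i) * W) * E = _
    rw [this, mul_assoc]
    change W * (B.mat i * E) = _
    rw [h.reversion, mul_assoc]
  have h2 : ∀ i, (B.mat i).transpose * D = -(D * B.mat i) := fun i => by
    have := h.conjugation i
    dsimp only at this
    calc (B.mat i).transpose * D = D * (C' * (B.mat i).transpose) * D := by
          rw [← mul_assoc, hDC, one_mul]
      _ = -(D * B.mat i) := by
          rw [← this, mul_assoc, mul_assoc, hCD, mul_one, mul_neg]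
  have h3 : ∀ i, (D * (W * E)) * (B.mat i).transpose = (B.mat i).transpose * (D * (W * E)) :=
    fun i => by
      rw [← mul_assoc (B.mat i).transpose, h2, neg_mul, mul_assoc D (B.mat i), h1, mul_neg,
        neg_neg, mul_assoc]
  -- The transpose is ± the matrix itself, and the sign cancels on the two sides.
  have h4 : ∀ i, (D * (W * E)) * B.mat i = B.mat i * (D * (W * E)) := fun i => by
    have := h3 i
    rcases B.symm_or_skew i with h' | h'
    · rwa [show (B.mat i).transpose = B.mat i from h'] at this
    · rw [show (B.mat i).transpose = -B.mat i from h', mul_neg, neg_mul] at this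
      exact neg_injective this
  have h5 : ∀ M, (D * (W * E)) * M = M * (D * (W * E)) := fun M => by
    obtain ⟨a, rfl⟩ := B.γ.surjective M
    induction a using cliffAlg_induction with
    | hF r => rw [AlgEquiv.commutes, Algebra.commutes]
    | hu i => exact h4 i
    | hmul a b ha hb => rw [map_mul, ← mul_assoc, ha, mul_assoc, hb, mul_assoc]
    | hadd a b ha hb => rw [map_add, mul_add, ha, hb, add_mul]
  obtain ⟨r, hr⟩ := matrix_eq_algebraMap_of_commute hK _ h5
  refine ⟨r, ?_⟩
  calc W * E = C' * (D * (W * E)) := by rw [← mul_assoc, hCD, one_mul]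
    _ = r • C' := by rw [hr, ← Algebra.commutes, Algebra.smul_def]

/-- A real square is nonnegative and cannot turn one sign into the other; comparing absolute values
then gives r² = 1. -/
theorem smul_one_eq {a b : ℤˣ} (B : SpinBasis ℝ s K N) {r : ℝ}
    (h : (a • 1 : Matrix (Fin N) (Fin N) K) = (r * r) • b • 1) : a = b ∧ (r = 1 ∨ r = -1) := by
  have := B.nontrivial
  have h1 : algebraMap ℝ (Matrix (Fin N) (Fin N) K) ((a : ℤ) : ℝ) =
      algebraMap ℝ _ (r * r * ((b : ℤ) : ℝ)) := by
    simpa [map_mul, Algebra.smul_def, Units.smul_def] using h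
  have h2 : ((a : ℤ) : ℝ) = r * r * ((b : ℤ) : ℝ) := (algebraMap ℝ _).injective h1
  rcases Int.units_eq_one_or a with rfl | rfl <;> rcases Int.units_eq_one_or b with rfl | rfl <;>
    simp at h2 ⊢
  · exact mul_self_eq_one_iff.1 h2.symm
  · nlinarith [mul_self_nonneg r]
  · nlinarith [mul_self_nonneg r]
  · exact mul_self_eq_one_iff.1 h2.symm

theorem smul_eq_units_smul {r : ℝ} (hr : r = 1 ∨ r = -1) :
    ∃ d : ℤˣ, ∀ M : Matrix (Fin N) (Fin N) K, r • M = d • M := by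
  rcases hr with rfl | rfl
  · exact ⟨1, fun M => by simp⟩
  · exact ⟨-1, fun M => by rw [neg_smul, one_smul, neg_one_smul_units]⟩

/-- The isomorphism type and the square of `C` are determined by the squares of `W` and `E`. -/
theorem Represents.signature (h : B.Represents W E C)
    (hK : ∀ z : K, (∀ x, z * x = x * z) → ∃ r : ℝ, z = algebraMap ℝ K r) {ab : Bool}
    {τ : AutType} {a b c : ℤˣ}
    (haut : if ab then IsAutMinus W E C τ a b c else IsAutPlus W E C τ a b c) :
    B.volMat * B.volMat = a • 1 ∧ c = commSign ab * a * b ∧ τ = typeOf ab a b := by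
  obtain ⟨r, hr⟩ := h.exists_smul hK
  have key : ∀ {a b c : ℤˣ}, W * W = ((a : ℤ) : Matrix (Fin N) (Fin N) K) →
      E * E = ((b : ℤ) : Matrix (Fin N) (Fin N) K) →
      C * C = ((c : ℤ) : Matrix (Fin N) (Fin N) K) → E * W = commSign ab • (W * E) →
      IsOfType W E C τ →
      B.volMat * B.volMat = a • 1 ∧ c = commSign ab * a * b ∧ τ = typeOf ab a b := by
    intro a b c ha hb hc hEW hτ
    rw [intCast_units] at ha hb hc
    -- (WE)² = ηab is compared below with (rC)² = r²c.
    have h1 : W * E * (W * E) = (commSign ab * a * b) • 1 := by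
      rw [mul_assoc, ← mul_assoc E, hEW, smul_mul_assoc, mul_smul_comm, mul_assoc W E, hb,
        mul_smul_comm, mul_smul_comm, mul_one, ha, smul_smul, smul_smul]
      congr 1; rw [mul_right_comm]
    rw [hr, smul_mul_assoc, mul_smul_comm, smul_smul, hc] at h1
    obtain ⟨h2, h3⟩ := smul_one_eq B h1.symm
    obtain ⟨d, hd⟩ := smul_eq_units_smul (K := K) (N := N) h3
    refine ⟨by rw [← h.W_eq, ha], h2.symm, ?_⟩
    exact hτ.unique (isOfType_typeOf B.neg_one_ne_one ha hb (hr.trans (hd C)) hEW)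
  cases ab
  · obtain ⟨⟨h1, -, -⟩, ha, hb, hc, hτ⟩ := haut
    exact key ha hb hc (by rw [h1]; simp [commSign]) hτ
  · obtain ⟨⟨h1, -, -⟩, ha, hb, hc, hτ⟩ := haut
    exact key ha hb hc (by rw [h1]; simp [commSign]) hτ

end SpinBasis

theorem ncard_sgn_pos (p q : ℕ) : {i | sgn p q i = 1}.ncard = p := by
  have h : {i | sgn p q i = 1} = Set.range (Fin.castAdd q : Fin p → Fin (p + q)) := by
    ext i
    simp only [sgn, Set.mem_ofPred_eq, Set.mem_range]
    constructor
    · intro h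
      have hi : i.val < p := by by_contra hi; simp [hi] at h
      exact ⟨⟨i, hi⟩, rfl⟩
    · rintro ⟨j, rfl⟩; simp
  rw [h, Set.ncard_range_of_injective (Fin.castAdd_injective p q), Nat.card_fin]

theorem ncard_sgn_neg (p q : ℕ) : {i | sgn p q i = -1}.ncard = q := by
  have h : {i | sgn p q i = -1} = {i | sgn p q i = 1}ᶜ := by
    ext i
    simp only [Set.mem_ofPred_eq, Set.mem_compl_iff]
    rcases Int.units_eq_one_or (sgn p q i) with h | h <;> simp [h]
  rw [h, Set.ncard_compl, ncard_sgn_pos, Nat.card_fin]; omega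

theorem SpinBasis.volMat_sq {p q : ℕ} {K : Type} [Ring K] [Algebra ℝ K] {N : ℕ}
    (B : SpinBasis ℝ (sgn p q) K N) :
    B.volMat * B.volMat = ((-1 : ℤˣ) ^ ((p + q).choose 2) * (-1) ^ q) • 1 := by
  rw [volMat_eq_prodOver, prodOver_sq]
  simp only [true_and, ncard_sgn_pos, ncard_sgn_neg]

/-! ### Tensor products of the real `2 × 2` matrices `σ_x`, `σ_z` and `σ_x σ_z` -/

/-- The sign character of `ℤ₂`. -/
def zsign (t : ZMod 2) : ℤˣ := if t = 0 then 1 else -1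

theorem zsign_add (a b : ZMod 2) : zsign (a + b) = zsign a * zsign b := by
  revert a b; decide

/-- A word in the Pauli matrices: `(x, z)` stands for `σ_x ^ x * σ_z ^ z`. -/
abbrev PauliWord (m : ℕ) : Type := Fin m → ZMod 2 × ZMod 2

/-- The exponent of the sign in the multiplication of Pauli words. -/
def pauliForm {m : ℕ} (w w' : PauliWord m) : ZMod 2 := ∑ a, (w a).2 * (w' a).1

/-- The matrix of a Pauli word, multiplied by `u`. -/
def pauliMatrix {m : ℕ} {K : Type} [Ring K] (w : PauliWord m) (u : K) :
    Matrix (Fin m → ZMod 2) (Fin m → ZMod 2) K :=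
  Matrix.of fun r c =>
    if r = c + (fun a => (w a).1) then zsign (∑ a, (w a).2 * c a) • u else 0

/-- In each factor the σ_z of the left word has to pass the σ_x of the right word; `pauliForm`
counts these exchanges modulo 2. The coefficients stay in order because `K` need not be commutative.
-/
theorem pauliMatrix_mul {m : ℕ} {K : Type} [Ring K] (w w' : PauliWord m) (u u' : K) :
    pauliMatrix w u * pauliMatrix w' u' =
      zsign (pauliForm w w') • pauliMatrix (w + w') (u * u') := by
  ext r c
  rw [Matrix.mul_apply, Finset.sum_eq_single (c + fun a => (w' a).1)]
  · simp only [pauliMatrix, Matrix.of_apply, if_true, Matrix.smul_apply, Pi.add_apply,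
      Prod.fst_add, Prod.snd_add]
    have h1 : (c + fun a => (w' a).1) + (fun a => (w a).1) = c + fun a => (w a).1 + (w' a).1 := by
      ext a; simp only [Pi.add_apply]; ring
    rw [h1]
    split_ifs
    · rw [smul_mul_smul_comm, smul_smul, pauliForm, ← zsign_add, ← zsign_add,
        ← Finset.sum_add_distrib, ← Finset.sum_add_distrib]
      congr 2
      refine Finset.sum_congr rfl fun a _ => ?_
      ring
    · simp
  · intro d _ hd
    simp only [pauliMatrix, Matrix.of_apply]
    rw [if_neg hd, mul_zero]
  · simp

/-- Transposition reverses σ_x^x σ_z^z in each tensor factor, at the cost of (-1)^(xz), and leaves u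
untouched. For u = 1 this is also the sign of the square; for other u the two signs can differ. -/
theorem pauliMatrix_transpose {m : ℕ} {K : Type} [Ring K] (w : PauliWord m) (u : K) :
    (pauliMatrix w u).transpose = zsign (pauliForm w w) • pauliMatrix w u := by
  ext r c
  simp only [pauliMatrix, Matrix.of_apply, Matrix.transpose_apply, Matrix.smul_apply]
  have h2 : ∀ x y : ZMod 2, x + y + y = x := by decide
  have h1 : c = r + (fun a => (w a).1) ↔ r = c + (fun a => (w a).1) := by
    constructor <;> rintro rfl <;> ext a <;> simp [h2]
  by_cases h : r = c + fun a => (w a).1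
  · rw [if_pos (h1.2 h), if_pos h, smul_smul, ← zsign_add, pauliForm, ← Finset.sum_add_distrib, h]
    congr 2
    refine Finset.sum_congr rfl fun a _ => ?_
    simp only [Pi.add_apply]; ring
  · rw [if_neg (mt h1.1 h), if_neg h, smul_zero]

theorem pauliMatrix_zero {m : ℕ} {K : Type} [Ring K] :
    pauliMatrix (0 : PauliWord m) (1 : K) = 1 := by
  ext r c
  have h0 : (c + fun _ => (0 : ZMod 2)) = c := by ext; simp
  simp [pauliMatrix, Matrix.one_apply, zsign, h0]

theorem pauliMatrix_smul {m : ℕ} {K : Type} [Ring K] (w : PauliWord m) (e : ℤˣ) (u : K) :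
    pauliMatrix w (e • u) = e • pauliMatrix w u := by
  ext r c
  simp only [pauliMatrix, Matrix.of_apply, Matrix.smul_apply]
  split_ifs
  · rw [smul_comm]
  · simp

theorem word_add_self {m : ℕ} (w : PauliWord m) : w + w = 0 := by
  have h : ∀ x : ZMod 2 × ZMod 2, x + x = 0 := by decide
  ext1 a; exact h _

/-- Reduces the construction of spinbases to finding words and coefficients with prescribed signs.
The trace required for bijectivity is `τ` applied to the matrix trace. -/
theorem exists_spinBasis {F K : Type} [Field F] [CharZero F] [Ring K] [Algebra F K] {n m : ℕ}
    {s : Fin n → ℤˣ} (hn : Even n) (τ : K →ₗ[F] F) (hτ : ∀ x y, τ (x * y) = τ (y * x))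
    (hτ1 : τ 1 ≠ 0) (hdim : 2 ^ m * 2 ^ m * Module.finrank F K = 2 ^ n) (w : Fin n → PauliWord m)
    (u : Fin n → K) (hsq : ∀ i, zsign (pauliForm (w i) (w i)) • (u i * u i) = s i • 1)
    (hanti : ∀ i j, i ≠ j → zsign (pauliForm (w i) (w j)) • (u i * u j) =
      -(zsign (pauliForm (w j) (w i)) • (u j * u i))) :
    ∃ B : SpinBasis F s K (2 ^ m),
      ∀ i, (B.mat i).transpose = zsign (pauliForm (w i) (w i)) • B.mat i := by
  have hfam : IsCliffordFamily s (fun i => pauliMatrix (w i) (u i)) :=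
    { sq := fun i => by
        rw [pauliMatrix_mul, word_add_self, ← pauliMatrix_smul, hsq, pauliMatrix_smul,
          pauliMatrix_zero]
      anticomm := fun i j hij => by
        rw [pauliMatrix_mul, pauliMatrix_mul, ← pauliMatrix_smul, hanti i j hij,
          ← neg_one_smul_units, pauliMatrix_smul, pauliMatrix_smul, neg_one_smul_units, add_comm] }
  have hbij := hfam.lift_bijective (F := F) hn (τ ∘ₗ Matrix.traceLinearMap _ F K)
    (fun x y => by
      simp only [LinearMap.comp_apply, Matrix.traceLinearMap_apply, Matrix.trace,
        Matrix.diag_apply, Matrix.mul_apply, map_sum]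
      rw [Finset.sum_comm]
      simp only [hτ])
    (by
      simp only [LinearMap.comp_apply, Matrix.traceLinearMap_apply, Matrix.trace_one]
      rw [← nsmul_one, map_nsmul, nsmul_eq_mul]
      exact mul_ne_zero (Nat.cast_ne_zero.2 Fintype.card_ne_zero) hτ1)
    (by
      rw [Module.finrank_matrix, ← hdim]; simp)
  let e : (Fin m → ZMod 2) ≃ Fin (2 ^ m) := Fintype.equivFinOfCardEq (by simp)
  let γ := (AlgEquiv.ofBijective hfam.lift hbij).trans (Matrix.reindexAlgEquiv F K e)
  have hγ : ∀ i, γ (unit F s i) = Matrix.reindex e e (pauliMatrix (w i) (u i)) := fun i =>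
    congrArg (Matrix.reindex e e) (hfam.lift_unit i)
  have htr : ∀ i, (γ (unit F s i)).transpose =
      zsign (pauliForm (w i) (w i)) • γ (unit F s i) := fun i => by
    rw [hγ, Matrix.transpose_reindex, pauliMatrix_transpose]; rfl
  refine ⟨⟨γ, fun i => ?_⟩, htr⟩
  rw [htr]
  rcases Int.units_eq_one_or (zsign (pauliForm (w i) (w i))) with h | h <;> rw [h]
  · left; rw [one_smul]
  · right; rw [neg_one_smul_units]

/-! ### Anticommuting Pauli words -/

/-- Pairwise anticommuting Pauli words with squares `(-1) ^ t i`. -/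
structure IsPauliSystem {m : ℕ} {ι : Type} (t : ι → ZMod 2) (w : ι → PauliWord m) : Prop where
  self : ∀ i, pauliForm (w i) (w i) = t i
  anticomm : ∀ i j, i ≠ j → pauliForm (w i) (w j) + pauliForm (w j) (w i) = 1

theorem IsPauliSystem.comp {m : ℕ} {ι κ : Type} {t : ι → ZMod 2} {w : ι → PauliWord m}
    (h : IsPauliSystem t w) (e : κ ≃ ι) : IsPauliSystem (t ∘ e) (w ∘ e) where
  self _ := h.self _
  anticomm _ _ hij := h.anticomm _ _ (e.injective.ne hij)

theorem pauliForm_append {m k : ℕ} (w w' : PauliWord m) (v v' : PauliWord k) :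
    pauliForm (Fin.append w v : PauliWord (m + k)) (Fin.append w' v') =
      pauliForm w w' + pauliForm v v' := by
  simp [pauliForm, Fin.sum_univ_add]

theorem pauliForm_zero_left {m : ℕ} (w : PauliWord m) : pauliForm 0 w = 0 := by
  simp [pauliForm]

theorem pauliForm_zero_right {m : ℕ} (w : PauliWord m) : pauliForm w 0 = 0 := by
  simp [pauliForm]

theorem zmod_two_add_self (x : ZMod 2) : x + x = 0 := by revert x; decide

/-- The old words receive the factor σ_z, whose square is 1, so their mutual relations survive. In
the new factor σ_x and σ_x σ_z anticommute with σ_z and with each other, and have squares 1 and -1.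
-/
theorem IsPauliSystem.double {m : ℕ} {ι : Type} {t : ι → ZMod 2} {w : ι → PauliWord m}
    (h : IsPauliSystem t w) :
    IsPauliSystem (m := m + 1) (Sum.elim t (Sum.elim (fun _ : Fin 1 => 0) (fun _ : Fin 1 => 1)))
      (Sum.elim (fun i => Fin.append (w i) fun _ => (0, 1))
        (Sum.elim (fun _ => Fin.append (0 : PauliWord m) fun _ => (1, 0))
          (fun _ => Fin.append (0 : PauliWord m) fun _ => (1, 1)))) where
  self := by
    rintro (i | i | i) <;>
      simp [pauliForm_append, h.self, pauliForm_zero_left] <;> simp [pauliForm]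
  anticomm := by
    rintro (i | i | i) (j | j | j) hij <;>
      simp only [Sum.elim_inl, Sum.elim_inr, pauliForm_append, pauliForm_zero_left,
        pauliForm_zero_right]
    · have hij' : i ≠ j := fun e => hij (congrArg _ e)
      rw [add_add_add_comm, h.anticomm i j hij', zmod_two_add_self, add_zero]
    all_goals first
      | (obtain rfl := Subsingleton.elim i j; exact absurd rfl hij)
      | simp [pauliForm]

/-- Two commuting triples of anticommuting skewsymmetric `4 × 4` matrices. -/
def skewTriples : Fin 2 × Fin 3 → PauliWord 2
  | (0, b) => ![![(1, 1), (0, 0)], ![(1, 0), (1, 1)], ![(0, 1), (1, 1)]] b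
  | (1, b) => ![![(0, 0), (1, 1)], ![(1, 1), (1, 0)], ![(1, 1), (0, 1)]] b

/-- Two anticommuting words are tensored with the two triples. Within a triple the skewsymmetric
factors supply the anticommutation; across the triples these factors commute and the words supply
it. Squares change sign because each skewsymmetric factor has square -1. -/
theorem IsPauliSystem.triple {m : ℕ} {ι : Type} {t : ι ⊕ Fin 2 → ZMod 2}
    {w : ι ⊕ Fin 2 → PauliWord m} (h : IsPauliSystem t w) :
    IsPauliSystem (m := m + 2)
      (Sum.elim (fun i => t (.inl i)) (fun a : Fin 2 × Fin 3 => t (.inr a.1) + 1))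
      (Sum.elim (fun i => Fin.append (w (.inl i)) 0)
        (fun a => Fin.append (w (.inr a.1)) (skewTriples a))) where
  self := by
    have hs : ∀ a, pauliForm (skewTriples a) (skewTriples a) = 1 := by decide
    rintro (i | a) <;>
      simp only [Sum.elim_inl, Sum.elim_inr, pauliForm_append, h.self, pauliForm_zero_left,
        add_zero, hs]
  anticomm := by
    have hs : ∀ a b, pauliForm (skewTriples a) (skewTriples b) +
        pauliForm (skewTriples b) (skewTriples a) = if a.1 = b.1 ∧ a ≠ b then 1 else 0 := by
      decide
    rintro (i | a) (j | b) hij <;>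
      simp only [Sum.elim_inl, Sum.elim_inr, pauliForm_append, pauliForm_zero_left,
        pauliForm_zero_right, add_zero]
    · exact h.anticomm _ _ (fun e => hij (by rw [Sum.inl_injective e]))
    · exact h.anticomm _ _ Sum.inl_ne_inr
    · exact h.anticomm _ _ Sum.inr_ne_inl
    · have hab : a ≠ b := fun e => hij (by rw [e])
      rw [add_add_add_comm, hs]
      by_cases h1 : a.1 = b.1
      · rw [if_pos ⟨h1, hab⟩, h1, zmod_two_add_self, zero_add]
      · rw [if_neg (fun h2 => h1 h2.1), add_zero]
        exact h.anticomm _ _ (fun e => h1 (Sum.inr_injective e))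

/-- There are `p` symmetric and `q` skewsymmetric anticommuting Pauli words of minimal length. -/
def HasPauli (p q : ℕ) : Prop :=
  ∃ m, 2 * m = p + q ∧ ∃ w : Fin p ⊕ Fin q → PauliWord m,
    IsPauliSystem (Sum.elim (fun _ => 0) (fun _ => 1)) w

theorem HasPauli.of_system {ι : Type} {p q m : ℕ} (hm : 2 * m = p + q) (t : ι → ZMod 2)
    (w : ι → PauliWord m) (h : IsPauliSystem t w) (e : Fin p ⊕ Fin q ≃ ι)
    (he : ∀ i, t (e i) = Sum.elim (fun _ => 0) (fun _ => 1) i) : HasPauli p q :=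
  ⟨m, hm, w ∘ e, by rw [← funext he]; exact h.comp e⟩

theorem HasPauli.double {p q : ℕ} (h : HasPauli p q) : HasPauli (p + 1) (q + 1) := by
  obtain ⟨m, hm, w, hw⟩ := h
  refine .of_system (m := m + 1) (by omega) _ _ hw.double
    ((Equiv.sumCongr finSumFinEquiv.symm finSumFinEquiv.symm).trans
      (Equiv.sumSumSumComm _ _ _ _)) ?_
  rintro (i | i) <;> obtain ⟨i, rfl⟩ := finSumFinEquiv.surjective i <;> rcases i with i | i <;>
    simp

/-- The six elements of `skewTriples`. -/
def finSixEquiv : Fin 6 ≃ Fin 2 × Fin 3 := (finProdFinEquiv (m := 2) (n := 3)).symm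

/-- Two symmetric words are traded for six skewsymmetric ones: p - q drops by 8, and p + q grows by
4 to match the two additional tensor factors. -/
theorem HasPauli.triple_pos {p q : ℕ} (h : HasPauli (p + 2) q) : HasPauli p (q + 6) := by
  obtain ⟨m, hm, w, hw⟩ := h
  let e : (Fin p ⊕ Fin q) ⊕ Fin 2 ≃ Fin (p + 2) ⊕ Fin q :=
    ((Equiv.sumAssoc _ _ _).trans ((Equiv.refl _).sumCongr (Equiv.sumComm _ _))).trans
      ((Equiv.sumAssoc _ _ _).symm.trans (finSumFinEquiv.sumCongr (Equiv.refl _)))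
  let e' : Fin p ⊕ Fin (q + 6) ≃ (Fin p ⊕ Fin q) ⊕ (Fin 2 × Fin 3) :=
    ((Equiv.refl _).sumCongr (finSumFinEquiv.symm.trans
      ((Equiv.refl _).sumCongr finSixEquiv))).trans (Equiv.sumAssoc _ _ _).symm
  refine .of_system (m := m + 2) (by omega) _ _ (hw.comp e).triple e' ?_
  rintro (i | i)
  · simp [e, e']
  · obtain ⟨i, rfl⟩ := finSumFinEquiv.surjective i
    rcases i with i | i <;> simp [e, e']

theorem HasPauli.triple_neg {p q : ℕ} (h : HasPauli p (q + 2)) : HasPauli (p + 6) q := by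
  obtain ⟨m, hm, w, hw⟩ := h
  let e : (Fin p ⊕ Fin q) ⊕ Fin 2 ≃ Fin p ⊕ Fin (q + 2) :=
    (Equiv.sumAssoc _ _ _).trans ((Equiv.refl _).sumCongr finSumFinEquiv)
  let e' : Fin (p + 6) ⊕ Fin q ≃ (Fin p ⊕ Fin q) ⊕ (Fin 2 × Fin 3) :=
    ((finSumFinEquiv.symm.trans ((Equiv.refl _).sumCongr finSixEquiv)).sumCongr
      (Equiv.refl _)).trans ((Equiv.sumAssoc _ _ _).trans
        (((Equiv.refl _).sumCongr (Equiv.sumComm _ _)).trans (Equiv.sumAssoc _ _ _).symm))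
  have h11 : (1 : ZMod 2) + 1 = 0 := by decide
  refine .of_system (m := m + 2) (by omega) _ _ (hw.comp e).triple e' ?_
  rintro (i | i)
  · obtain ⟨i, rfl⟩ := finSumFinEquiv.surjective i
    rcases i with i | i <;> simp [e, e', h11]
  · simp [e, e']

theorem hasPauli_zero : HasPauli 0 0 :=
  ⟨0, rfl, fun _ => 0, ⟨fun i => by rcases i with i | i <;> exact i.elim0,
    fun i => by rcases i with i | i <;> exact i.elim0⟩⟩

theorem hasPauli_two : HasPauli 2 0 :=
  ⟨1, rfl, Sum.elim (![fun _ => (1, 0), fun _ => (0, 1)]) (fun i => i.elim0), by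
    constructor
    · decide
    · decide⟩

/-- Descent preserving p - q mod 8: while p and q are both positive, one unit of each sign is
removed; once one of them vanishes, six units of the other sign are traded for two of the opposite
sign. It ends at (0,0) or (2,0). -/
theorem hasPauli_of_type (p q : ℕ) (h : HasType p q 0 ∨ HasType p q 2) : HasPauli p q := by
  induction hk : p + q using Nat.strong_induction_on generalizing p q with
  | _ k ih =>
    simp only [HasType, Int.ModEq] at h ih
    rcases p with _ | p
    · rcases le_or_gt q 5 with hq | hq
      -- With p = 0 the type forces q ≡ 0 or 6 mod 8.
      · obtain rfl : q = 0 := by omega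
        exact hasPauli_zero
      · obtain ⟨q, rfl⟩ := Nat.exists_eq_add_of_le' hq
        exact (ih (0 + 2 + q) (by omega) (0 + 2) q (by push_cast at *; omega) rfl).triple_pos
    · rcases q with _ | q
      · rcases le_or_gt p 4 with hp | hp
        · obtain rfl : p = 1 := by omega
          exact hasPauli_two
        · obtain ⟨p, rfl⟩ := Nat.exists_eq_add_of_le' hp
          exact (ih (p + (0 + 2)) (by omega) p (0 + 2) (by push_cast at *; omega) rfl).triple_neg
      · exact (ih (p + q) (by omega) p q (by push_cast at *; omega) rfl).double

/-! ### Spinbases over `ℝ` and `ℍ` -/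

/-- The sign of a generator of `Cl p q` as an exponent. -/
theorem sgn_eq_zsign {p q : ℕ} (i : Fin (p + q)) :
    sgn p q i = zsign (Sum.elim (fun _ => 0) (fun _ => 1) (finSumFinEquiv.symm i)) := by
  obtain ⟨x, rfl⟩ := finSumFinEquiv.surjective i
  rw [Equiv.symm_apply_apply]
  rcases x with x | x <;> simp [sgn, zsign]

theorem zsign_eq_neg_of_add_eq_one {a b : ZMod 2} (h : a + b = 1) : zsign a = -zsign b := by
  revert a b; decide

theorem exists_real_spinBasis (p q : ℕ) (h : HasType p q 0 ∨ HasType p q 2) :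
    Nonempty (SpinBasis ℝ (sgn p q) ℝ (2 ^ ((p + q) / 2))) := by
  obtain ⟨m, hm, w, hw⟩ := hasPauli_of_type p q h
  obtain rfl : m = (p + q) / 2 := by omega
  have hn : Even (p + q) := ⟨(p + q) / 2, by omega⟩
  obtain ⟨B, -⟩ := exists_spinBasis (F := ℝ) (K := ℝ) (s := sgn p q) hn LinearMap.id mul_comm
    one_ne_zero (by rw [Module.finrank_self, mul_one, ← pow_add]; congr 1; omega)
    (w ∘ finSumFinEquiv.symm) (fun _ => 1)
    (fun i => by rw [mul_one, sgn_eq_zsign]; congr 2; exact hw.self _)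
    (fun i j hij => by
      rw [mul_one]
      change zsign (pauliForm (w _) (w _)) • (1 : ℝ) = -(zsign (pauliForm (w _) (w _)) • 1)
      rw [zsign_eq_neg_of_add_eq_one
        (hw.anticomm _ _ (finSumFinEquiv.symm.injective.ne hij)), ← neg_one_smul_units, smul_smul,
        neg_one_mul])
  exact ⟨B⟩

/-- The quaternion `i ^ a * j ^ b`. -/
def quatUnit (v : ZMod 2 × ZMod 2) : ℍ[ℝ] :=
  (if v.1 = 0 then 1 else quatI) * (if v.2 = 0 then 1 else quatJ)

/-- The exponent of the sign in the multiplication of quaternion units. -/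
def quatForm (v v' : ZMod 2 × ZMod 2) : ZMod 2 := v.2 * v'.1 + v.1 * v'.1 + v.2 * v'.2

theorem quatUnit_mul (v v' : ZMod 2 × ZMod 2) :
    quatUnit v * quatUnit v' = zsign (quatForm v v') • quatUnit (v + v') := by
  have hI : ∀ x, quatI * (quatI * x) = -x := fun x => by
    rw [← mul_assoc, quatI_mul_quatI, neg_one_mul]
  have hJI : ∀ x, quatJ * (quatI * x) = -(quatI * (quatJ * x)) := fun x => by
    rw [← mul_assoc, quatJ_mul_quatI, neg_mul, mul_assoc]
  have h2 : (1 : ZMod 2) + 1 = 0 := by decide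
  have h3 : (1 : ZMod 2) + 1 + 1 = 1 := by decide
  have hz : ∀ x : ZMod 2, x = 0 ∨ x = 1 := by decide
  obtain ⟨a, b⟩ := v
  obtain ⟨c, d⟩ := v'
  rcases hz a with rfl | rfl <;> rcases hz b with rfl | rfl <;> rcases hz c with rfl | rfl <;>
    rcases hz d with rfl | rfl <;>
    simp [quatUnit, quatForm, zsign, h2, mul_assoc, quatI_mul_quatI,
      quatJ_mul_quatJ, quatJ_mul_quatI, hI, hJI]

/-- Pairwise anticommuting Pauli words with quaternion factors and with squares `(-1) ^ t i`. -/
structure IsQuatSystem {m : ℕ} {ι : Type} (t : ι → ZMod 2) (w : ι → PauliWord m)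
    (v : ι → ZMod 2 × ZMod 2) : Prop where
  self : ∀ i, pauliForm (w i) (w i) + quatForm (v i) (v i) = t i
  anticomm : ∀ i j, i ≠ j → pauliForm (w i) (w j) + quatForm (v i) (v j) +
    (pauliForm (w j) (w i) + quatForm (v j) (v i)) = 1

theorem IsQuatSystem.comp {m : ℕ} {ι κ : Type} {t : ι → ZMod 2} {w : ι → PauliWord m}
    {v : ι → ZMod 2 × ZMod 2} (h : IsQuatSystem t w v) (e : κ ≃ ι) :
    IsQuatSystem (t ∘ e) (w ∘ e) (v ∘ e) where
  self _ := h.self _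
  anticomm _ _ hij := h.anticomm _ _ (e.injective.ne hij)

theorem finrank_quaternion : Module.finrank ℝ ℍ[ℝ] = 4 := Quaternion.finrank_eq_four

/-- The real part of a quaternion. -/
def quatRe : ℍ[ℝ] →ₗ[ℝ] ℝ where
  toFun x := x.re
  map_add' _ _ := rfl
  map_smul' _ _ := rfl

/-- The real part is a trace form on ℍ, and 2m + 2 = n is the dimension count 4^m · 4 = 2^n. -/
theorem IsQuatSystem.exists_spinBasis {n m : ℕ} {s : Fin n → ℤˣ} {t : Fin n → ZMod 2}
    (hm : 2 * m + 2 = n) (hs : ∀ i, s i = zsign (t i)) {w : Fin n → PauliWord m}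
    {v : Fin n → ZMod 2 × ZMod 2} (h : IsQuatSystem t w v) :
    ∃ B : SpinBasis ℝ s ℍ[ℝ] (2 ^ m),
      ∀ i, (B.mat i).transpose = zsign (pauliForm (w i) (w i)) • B.mat i := by
  have h0 : ∀ x : ZMod 2 × ZMod 2, x + x = 0 := by decide
  have h1 : quatUnit 0 = 1 := by simp [quatUnit]
  refine CliffordAut.exists_spinBasis (F := ℝ) (K := ℍ[ℝ]) ⟨m + 1, by omega⟩ quatRe
    (fun x y => ?_) ?_ ?_ w (fun i => quatUnit (v i)) (fun i => ?_) fun i j hij => ?_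
  · change (x * y).re = (y * x).re
    rw [Quaternion.re_mul, Quaternion.re_mul]; ring
  · change (1 : ℍ[ℝ]).re ≠ 0
    simp
  · rw [finrank_quaternion, ← hm, pow_add, two_mul, pow_add]; norm_num
  · rw [quatUnit_mul, smul_smul, ← zsign_add, h.self, hs, h0, h1]
  · rw [quatUnit_mul, quatUnit_mul, smul_smul, smul_smul, ← zsign_add, ← zsign_add,
      zsign_eq_neg_of_add_eq_one (h.anticomm i j hij), ← neg_one_smul_units, smul_smul,
      neg_one_mul, add_comm (v j)]

/-- The labels of the quaternion units `i`, `j`, `k`. -/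
def imagUnit : Fin 3 → ZMod 2 × ZMod 2 := ![(1, 0), (0, 1), (1, 1)]

/-- One element of a real system is multiplied by the three quaternion units. -/
theorem IsPauliSystem.quat {m : ℕ} {ι : Type} {t : ι ⊕ Fin 1 → ZMod 2}
    {w : ι ⊕ Fin 1 → PauliWord m} (h : IsPauliSystem t w) :
    IsQuatSystem (Sum.elim (fun i => t (.inl i)) (fun _ : Fin 3 => t (.inr 0) + 1))
      (Sum.elim (fun i => w (.inl i)) (fun _ => w (.inr 0)))
      (Sum.elim (fun _ => 0) imagUnit) where
  self := by
    have hs : ∀ a, quatForm (imagUnit a) (imagUnit a) = 1 := by decide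
    have h0 : quatForm 0 0 = 0 := by decide
    rintro (i | a) <;> simp only [Sum.elim_inl, Sum.elim_inr, h.self, hs, h0, add_zero]
  anticomm := by
    have h0 : ∀ x, quatForm 0 x = 0 := by decide
    have h0' : ∀ x, quatForm x 0 = 0 := by decide
    have hs : ∀ a b, a ≠ b → quatForm (imagUnit a) (imagUnit b) +
        quatForm (imagUnit b) (imagUnit a) = 1 := by decide
    rintro (i | a) (j | b) hij <;> simp only [Sum.elim_inl, Sum.elim_inr, h0, h0', add_zero]
    · exact h.anticomm _ _ (fun e => hij (by rw [Sum.inl_injective e]))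
    · exact h.anticomm _ _ Sum.inl_ne_inr
    · exact h.anticomm _ _ Sum.inr_ne_inl
    · rw [add_add_add_comm, zmod_two_add_self, zero_add]
      exact hs _ _ (fun e => hij (by rw [e]))

/-- A quaternionic system for `Cl p q` with given quaternion factors. -/
def HasQuat (p q : ℕ) (v : Fin p ⊕ Fin q → ZMod 2 × ZMod 2) : Prop :=
  ∃ m, 2 * m + 2 = p + q ∧ ∃ w : Fin p ⊕ Fin q → PauliWord m,
    IsQuatSystem (Sum.elim (fun _ => 0) (fun _ => 1)) w v

theorem HasQuat.of_system {ι : Type} {p q m : ℕ} (hm : 2 * m + 2 = p + q) (t : ι → ZMod 2)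
    (w : ι → PauliWord m) (v : ι → ZMod 2 × ZMod 2) (h : IsQuatSystem t w v)
    (e : Fin p ⊕ Fin q ≃ ι) (v' : Fin p ⊕ Fin q → ZMod 2 × ZMod 2)
    (he : ∀ i, t (e i) = Sum.elim (fun _ => 0) (fun _ => 1) i ∧ v (e i) = v' i) :
    HasQuat p q v' :=
  ⟨m, hm, w ∘ e, by
    rw [← funext fun i => (he i).1, ← funext fun i => (he i).2]; exact h.comp e⟩

/-- An imaginary unit reverses the sign of the square: one symmetric word gives three elements of
square -1, which anticommute because i, j, k do. The factors are recorded since they decide which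
matrices are symmetric. -/
theorem HasPauli.quat_pos {p q : ℕ} (h : HasPauli (p + 1) q) :
    HasQuat p (q + 3) (Sum.elim (fun _ => 0)
      (fun i => Sum.elim (fun _ => 0) imagUnit (finSumFinEquiv.symm i))) := by
  obtain ⟨m, hm, w, hw⟩ := h
  let e : (Fin p ⊕ Fin q) ⊕ Fin 1 ≃ Fin (p + 1) ⊕ Fin q :=
    ((Equiv.sumAssoc _ _ _).trans ((Equiv.refl _).sumCongr (Equiv.sumComm _ _))).trans
      ((Equiv.sumAssoc _ _ _).symm.trans (finSumFinEquiv.sumCongr (Equiv.refl _)))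
  let e' : Fin p ⊕ Fin (q + 3) ≃ (Fin p ⊕ Fin q) ⊕ Fin 3 :=
    ((Equiv.refl _).sumCongr finSumFinEquiv.symm).trans (Equiv.sumAssoc _ _ _).symm
  refine .of_system (m := m) (by omega) _ _ _ (hw.comp e).quat e' _ ?_
  rintro (i | i)
  · simp [e, e']
  · obtain ⟨i, rfl⟩ := finSumFinEquiv.surjective i
    rcases i with i | i <;> simp [e, e']

theorem HasPauli.quat_neg {p q : ℕ} (h : HasPauli p (q + 1)) :
    HasQuat (p + 3) q (Sum.elim
      (fun i => Sum.elim (fun _ => 0) imagUnit (finSumFinEquiv.symm i)) (fun _ => 0)) := by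
  obtain ⟨m, hm, w, hw⟩ := h
  let e : (Fin p ⊕ Fin q) ⊕ Fin 1 ≃ Fin p ⊕ Fin (q + 1) :=
    (Equiv.sumAssoc _ _ _).trans ((Equiv.refl _).sumCongr finSumFinEquiv)
  let e' : Fin (p + 3) ⊕ Fin q ≃ (Fin p ⊕ Fin q) ⊕ Fin 3 :=
    (finSumFinEquiv.symm.sumCongr (Equiv.refl _)).trans ((Equiv.sumAssoc _ _ _).trans
        (((Equiv.refl _).sumCongr (Equiv.sumComm _ _)).trans (Equiv.sumAssoc _ _ _).symm))
  have h11 : (1 : ZMod 2) + 1 = 0 := by decide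
  refine .of_system (m := m) (by omega) _ _ _ (hw.comp e).quat e' _ ?_
  rintro (i | i)
  · obtain ⟨i, rfl⟩ := finSumFinEquiv.surjective i
    rcases i with i | i <;> simp [e, e', h11]
  · simp [e, e']

/-- The sign of the square is the transposition sign of the word times the square of its quaternion
factor, and the latter is -1 exactly for an imaginary factor. -/
theorem HasQuat.exists_spinBasis {p q : ℕ} {v : Fin p ⊕ Fin q → ZMod 2 × ZMod 2}
    (h : HasQuat p q v) : ∃ B : SpinBasis ℝ (sgn p q) ℍ[ℝ] (2 ^ ((p + q) / 2 - 1)),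
      ∀ i, (B.mat i).transpose = (sgn p q i * if v (finSumFinEquiv.symm i) = 0 then 1 else -1) •
        B.mat i := by
  obtain ⟨m, hm, w, hw⟩ := h
  obtain rfl : m = (p + q) / 2 - 1 := by omega
  obtain ⟨B, hB⟩ := (hw.comp finSumFinEquiv.symm).exists_spinBasis (s := sgn p q) hm sgn_eq_zsign
  refine ⟨B, fun i => ?_⟩
  have h1 : ∀ x : ZMod 2 × ZMod 2, zsign (quatForm x x) = if x = 0 then 1 else -1 := by decide
  have h2 := congrArg zsign (hw.self (finSumFinEquiv.symm i))
  rw [zsign_add, h1, ← sgn_eq_zsign] at h2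
  rw [hB, ← h2, mul_assoc, ← pow_two, Int.units_sq, mul_one]
  rfl

/-- This is ℍ itself, with no tensor factor at all. It has to be given separately, since `quat_pos`
and `quat_neg` always yield three units of one sign. -/
theorem hasQuat_zero_two : HasQuat 0 2 (Sum.elim (fun i => i.elim0) ![(1, 0), (0, 1)]) :=
  ⟨0, rfl, fun _ => 0, by
    constructor
    · decide
    · decide⟩

theorem exists_quat_spinBasis (p q : ℕ) (h : HasType p q 4 ∨ HasType p q 6) :
    Nonempty (SpinBasis ℝ (sgn p q) ℍ[ℝ] (2 ^ ((p + q) / 2 - 1))) := by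
  suffices ∃ v, HasQuat p q v by
    obtain ⟨v, hv⟩ := this
    obtain ⟨B, -⟩ := hv.exists_spinBasis
    exact ⟨B⟩
  simp only [HasType, Int.ModEq] at h
  rcases le_or_gt q 2 with hq | hq
  · rcases le_or_gt p 2 with hp | hp
    · obtain ⟨rfl, rfl⟩ : p = 0 ∧ q = 2 := by omega
      exact ⟨_, hasQuat_zero_two⟩
    · obtain ⟨p, rfl⟩ := Nat.exists_eq_add_of_le' hp
      exact ⟨_, (hasPauli_of_type p (q + 1) (by
        simp only [HasType, Int.ModEq]; push_cast at *; omega)).quat_neg⟩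
  · obtain ⟨q, rfl⟩ := Nat.exists_eq_add_of_le' hq
    exact ⟨_, (hasPauli_of_type (p + 1) q (by
      simp only [HasType, Int.ModEq]; push_cast at *; omega)).quat_pos⟩

/-! ### The groups of a given spinbasis -/

/-- The sign of the square of a product of `a` elements of square `1` and `b` elements of
square `-1`. -/
def sqSign (a b : ℕ) : ℤˣ := (-1) ^ ((a + b).choose 2) * (-1) ^ b

theorem sqSign_of_resPlus {a b : ℕ} (h : ResPlus ((a : ℤ) - b)) : sqSign a b = 1 :=
  sign_eq_one a b h

theorem sqSign_of_resMinus {a b : ℕ} (h : ResMinus ((a : ℤ) - b)) : sqSign a b = -1 :=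
  sign_eq_neg_one a b h

theorem HasType.even {p q : ℕ} {r : ℤ} (h : HasType p q r) (hr : r % 2 = 0) : Even (p + q) := by
  simp only [HasType, Int.ModEq] at h
  rw [Nat.even_iff]; omega

theorem sgn_eq_one_iff {p q : ℕ} (i : Fin (p + q)) : sgn p q i = 1 ↔ i.val < p := by
  simp only [sgn]; split_ifs with h <;> simp [h]

theorem sgn_eq_neg_one_iff {p q : ℕ} (i : Fin (p + q)) : sgn p q i = -1 ↔ ¬ i.val < p := by
  simp only [sgn]; split_ifs with h <;> simp [h]

namespace SpinBasis

section counts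

variable {p q : ℕ} {K : Type} [Ring K] [Algebra ℝ K] {N : ℕ} (B : SpinBasis ℝ (sgn p q) K N)
  (P : Fin (p + q) → Prop) {a b c : ℤˣ}

theorem isAutMinus_of_counts (hk : Even {j | ¬ P j}.ncard) (hW : sqSign p q = a)
    (hY : sqSign {i | ¬ P i ∧ sgn p q i = 1}.ncard {i | ¬ P i ∧ sgn p q i = -1}.ncard = b)
    (hX : sqSign {i | P i ∧ sgn p q i = 1}.ncard {i | P i ∧ sgn p q i = -1}.ncard = c) :
    IsAutMinus B.volMat (B.prodOver fun i => ¬ P i) (B.prodOver P) (typeOf true a b) a b c := by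
  subst hW hY hX
  exact isAutMinus_prodOver hk B.volMat_sq (B.prodOver_sq _) (B.prodOver_sq _)

theorem isAutPlus_of_counts (hn : Even (p + q)) (hk : Odd {j | ¬ P j}.ncard)
    (hW : sqSign p q = a)
    (hX : sqSign {i | P i ∧ sgn p q i = 1}.ncard {i | P i ∧ sgn p q i = -1}.ncard = b)
    (hY : sqSign {i | ¬ P i ∧ sgn p q i = 1}.ncard {i | ¬ P i ∧ sgn p q i = -1}.ncard = c) :
    IsAutPlus B.volMat (B.prodOver P) (B.prodOver fun i => ¬ P i) (typeOf false a b) a b c := by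
  subst hW hY hX
  exact isAutPlus_prodOver hn hk B.volMat_sq (B.prodOver_sq _) (B.prodOver_sq _)

end counts

/-! ### Spinbases over ℝ: symmetry is determined by the sign of the square -/

section real

variable {p q N : ℕ} (B : SpinBasis ℝ (sgn p q) ℝ N)

/-- MᵀM has nonnegative diagonal entries. A skewsymmetric M with M² = 1, or a symmetric one with M²
= -1, would give MᵀM = -1. -/
theorem real_separates : B.Separates (fun i => i.val < p) := by
  have hN : 0 < N := by
    rcases Nat.eq_zero_or_pos N with rfl | h
    · have := B.nontrivial
      exact absurd (Subsingleton.elim (0 : Matrix (Fin 0) (Fin 0) ℝ) 1) zero_ne_one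
    · exact h
  have hnonneg : ∀ i, 0 ≤ ((B.mat i).transpose * B.mat i) ⟨0, hN⟩ ⟨0, hN⟩ := fun i => by
    rw [Matrix.mul_apply]
    exact Finset.sum_nonneg fun j _ => mul_self_nonneg _
  intro i
  have hsq := B.isCliffordFamily_mat.sq i
  constructor
  · intro hi
    refine (B.symm_or_skew i).resolve_right fun h => ?_
    have h1 := hnonneg i
    rw [show (B.mat i).transpose = -B.mat i from h, neg_mul, hsq, (sgn_eq_one_iff i).2 hi,
      one_smul] at h1
    norm_num at h1
  · intro hi
    refine (B.symm_or_skew i).resolve_left fun h => ?_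
    have h1 := hnonneg i
    rw [show (B.mat i).transpose = B.mat i from h, hsq, (sgn_eq_neg_one_iff i).2 hi,
      neg_one_smul_units] at h1
    norm_num at h1

theorem ncard_pos_part : {i : Fin (p + q) | i.val < p}.ncard = p := by
  simp only [← sgn_eq_one_iff, ncard_sgn_pos]

theorem ncard_neg_part : {i : Fin (p + q) | ¬ i.val < p}.ncard = q := by
  simp only [← sgn_eq_neg_one_iff, ncard_sgn_neg]

theorem real_counts :
    {i : Fin (p + q) | i.val < p ∧ sgn p q i = 1}.ncard = p ∧
    {i : Fin (p + q) | i.val < p ∧ sgn p q i = -1}.ncard = 0 ∧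
    {i : Fin (p + q) | ¬ i.val < p ∧ sgn p q i = 1}.ncard = 0 ∧
    {i : Fin (p + q) | ¬ i.val < p ∧ sgn p q i = -1}.ncard = q := by
  simp only [sgn_eq_one_iff, sgn_eq_neg_one_iff, and_self, and_not_self, not_and_self,
    ncard_pos_part, ncard_neg_part, true_and, and_true]
  exact Set.ncard_empty _

theorem real_isAutMinus (hq : Even q) {a b c : ℤˣ} (hW : sqSign p q = a) (hY : sqSign 0 q = b)
    (hX : sqSign p 0 = c) :
    IsAutMinus B.volMat (B.prodOver fun i => ¬ i.val < p) (B.prodOver fun i => i.val < p)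
      (typeOf true a b) a b c := by
  obtain ⟨h1, h2, h3, h4⟩ := real_counts (p := p) (q := q)
  exact B.isAutMinus_of_counts _ (by rwa [ncard_neg_part]) hW (by rwa [h3, h4]) (by rwa [h1, h2])

theorem real_isAutPlus (hn : Even (p + q)) (hq : Odd q) {a b c : ℤˣ} (hW : sqSign p q = a)
    (hX : sqSign p 0 = b) (hY : sqSign 0 q = c) :
    IsAutPlus B.volMat (B.prodOver fun i => i.val < p) (B.prodOver fun i => ¬ i.val < p)
      (typeOf false a b) a b c := by
  obtain ⟨h1, h2, h3, h4⟩ := real_counts (p := p) (q := q)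
  exact B.isAutPlus_of_counts _ hn (by rwa [ncard_neg_part]) hW (by rwa [h1, h2]) (by rwa [h3, h4])

end real

end SpinBasis

open SpinBasis in
theorem real_case (p q : ℕ) (h : HasType p q 0 ∨ HasType p q 2) (N : ℕ)
    (B : SpinBasis ℝ (sgn p q) ℝ N) (X Y : Matrix (Fin N) (Fin N) ℝ)
    (hX : X = B.prodOver (fun i => i.val < p)) (hY : Y = B.prodOver (fun i => p ≤ i.val)) :
    (∀ i : Fin (p + q), (i.val < p → B.IsSymm i) ∧ (p ≤ i.val → B.IsSkew i)) ∧
    (Even p → Even q → B.Represents B.volMat Y X ∧ B.RepresentsOnAlgebra Y X) ∧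
    (HasType p q 0 → p ≡ 0 [MOD 4] → q ≡ 0 [MOD 4] → IsAutMinus B.volMat Y X .klein 1 1 1) ∧
    (HasType p q 0 → p ≡ 2 [MOD 4] → q ≡ 2 [MOD 4] →
      IsAutMinus B.volMat Y X .cyclic 1 (-1) (-1)) ∧
    (HasType p q 2 → p ≡ 0 [MOD 4] → q ≡ 2 [MOD 4] →
      IsAutMinus B.volMat Y X .cyclic (-1) (-1) 1) ∧
    (HasType p q 2 → p ≡ 2 [MOD 4] → q ≡ 0 [MOD 4] →
      IsAutMinus B.volMat Y X .cyclic (-1) 1 (-1)) ∧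
    (Odd p → Odd q → B.Represents B.volMat X Y ∧ B.RepresentsOnAlgebra X Y) ∧
    (HasType p q 0 → p ≡ 3 [MOD 4] → q ≡ 3 [MOD 4] →
      IsAutPlus B.volMat X Y .dihedral 1 (-1) 1) ∧
    (HasType p q 0 → p ≡ 1 [MOD 4] → q ≡ 1 [MOD 4] →
      IsAutPlus B.volMat X Y .dihedral 1 1 (-1)) ∧
    (HasType p q 2 → p ≡ 3 [MOD 4] → q ≡ 1 [MOD 4] →
      IsAutPlus B.volMat X Y .quaternion (-1) (-1) (-1)) ∧
    (HasType p q 2 → p ≡ 1 [MOD 4] → q ≡ 3 [MOD 4] →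
      IsAutPlus B.volMat X Y .dihedral (-1) 1 1) := by
  have hn : Even (p + q) := h.elim (·.even rfl) (·.even rfl)
  have hsep := B.real_separates
  have hY' : Y = B.prodOver (fun i => ¬ i.val < p) := by
    rw [hY]; exact B.prodOver_congr fun i => not_lt.symm
  subst hX hY'
  have plus : ∀ {a b : ℕ}, ((a : ℤ) - b) % 4 = 0 ∨ ((a : ℤ) - b) % 4 = 1 → sqSign a b = 1 :=
    fun h => sqSign_of_resPlus (by simp only [ResPlus, Int.ModEq]; omega)
  have minus : ∀ {a b : ℕ}, ((a : ℤ) - b) % 4 = 2 ∨ ((a : ℤ) - b) % 4 = 3 → sqSign a b = -1 :=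
    fun h => sqSign_of_resMinus (by simp only [ResMinus, Int.ModEq]; omega)
  clear h hY
  simp only [HasType, Int.ModEq, Nat.ModEq]
  refine ⟨fun i => ⟨(hsep i).1, fun hi => (hsep i).2 (not_lt.2 hi)⟩, fun _ hq => ?_,
    fun h hp hq => ?_, fun h hp hq => ?_, fun h hp hq => ?_, fun h hp hq => ?_, fun _ hq => ?_,
    fun h hp hq => ?_, fun h hp hq => ?_, fun h hp hq => ?_, fun h hp hq => ?_⟩
  · have hr := hsep.represents_even hn (by rwa [ncard_neg_part])
    exact ⟨hr, hr.onAlgebra⟩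
  · exact B.real_isAutMinus (by rw [Nat.even_iff]; omega) (plus (by omega)) (plus (by omega))
      (plus (by omega))
  · exact B.real_isAutMinus (by rw [Nat.even_iff]; omega) (plus (by omega)) (minus (by omega))
      (minus (by omega))
  · exact B.real_isAutMinus (by rw [Nat.even_iff]; omega) (minus (by omega)) (minus (by omega))
      (plus (by omega))
  · exact B.real_isAutMinus (by rw [Nat.even_iff]; omega) (minus (by omega)) (plus (by omega))
      (minus (by omega))
  · have hr := hsep.represents_odd hn (by rwa [ncard_neg_part])
    exact ⟨hr, hr.onAlgebra⟩
  · exact B.real_isAutPlus hn (by rw [Nat.odd_iff]; omega) (plus (by omega)) (minus (by omega))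
      (plus (by omega))
  · exact B.real_isAutPlus hn (by rw [Nat.odd_iff]; omega) (plus (by omega)) (plus (by omega))
      (minus (by omega))
  · exact B.real_isAutPlus hn (by rw [Nat.odd_iff]; omega) (minus (by omega)) (minus (by omega))
      (minus (by omega))
  · exact B.real_isAutPlus hn (by rw [Nat.odd_iff]; omega) (minus (by omega)) (plus (by omega))
      (plus (by omega))

/-! ### Symmetric and skewsymmetric matrices in a general spinbasis, and the quaternionic groups -/

namespace SpinBasis

section quat

variable {p q N : ℕ} {K : Type} [Ring K] [Algebra ℝ K] (B : SpinBasis ℝ (sgn p q) K N)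

theorem isSkew_iff (i : Fin (p + q)) : B.IsSkew i ↔ ¬ B.IsSymm i := by
  constructor
  · intro h1 h2
    have h3 : B.mat i = -B.mat i := h2.symm.trans h1
    have h4 : B.mat i * B.mat i = -(B.mat i * B.mat i) := by
      conv_lhs => rw [h3]
      rw [neg_mul_neg, ← neg_mul, ← h3]
    rw [B.isCliffordFamily_mat.sq, ← smul_neg] at h4
    have h5 := congrArg (sgn p q i • ·) h4
    simp only [units_smul_smul_self] at h5
    exact B.neg_one_ne_one h5.symm
  · exact (B.symm_or_skew i).resolve_left

theorem mat_sq_eq_one_iff (i : Fin (p + q)) : B.mat i * B.mat i = 1 ↔ sgn p q i = 1 := by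
  rw [B.isCliffordFamily_mat.sq]
  rcases Int.units_eq_one_or (sgn p q i) with h | h <;>
    simp [h, B.neg_one_ne_one]

theorem mat_sq_eq_neg_one_iff (i : Fin (p + q)) : B.mat i * B.mat i = -1 ↔ sgn p q i = -1 := by
  rw [B.isCliffordFamily_mat.sq]
  rcases Int.units_eq_one_or (sgn p q i) with h | h <;>
    simp [h, B.neg_one_ne_one.symm]

theorem separates_isSymm : B.Separates B.IsSymm := fun i => ⟨id, (B.isSkew_iff i).2⟩

end quat

end SpinBasis

open SpinBasis in
theorem quat_case (p q : ℕ) (hpq : HasType p q 4 ∨ HasType p q 6) (N : ℕ)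
    (B : SpinBasis ℝ (sgn p q) ℍ[ℝ] N) (X Y : Matrix (Fin N) (Fin N) ℍ[ℝ])
    (k : ℕ) (l t h g : ℤ)
    (hX : X = B.prodOver B.IsSymm) (hY : Y = B.prodOver B.IsSkew) (hk : k = B.numSkew)
    (hl : l = B.numSkewPos) (ht : t = B.numSkewNeg) (hh : h = B.numSymmPos)
    (hg : g = B.numSymmNeg) :
    (Even k → B.Represents B.volMat Y X) ∧
    (Even k → HasType p q 4 → ResPlus (l - t) → ResPlus (h - g) →
      IsAutMinus B.volMat Y X .klein 1 1 1) ∧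
    (Even k → HasType p q 4 → ResMinus (l - t) → ResMinus (h - g) →
      IsAutMinus B.volMat Y X .cyclic 1 (-1) (-1)) ∧
    (Even k → HasType p q 6 → ResPlus (l - t) → ResMinus (h - g) →
      IsAutMinus B.volMat Y X .cyclic (-1) 1 (-1)) ∧
    (Even k → HasType p q 6 → ResMinus (l - t) → ResPlus (h - g) →
      IsAutMinus B.volMat Y X .cyclic (-1) (-1) 1) ∧
    (Odd k → B.Represents B.volMat X Y) ∧
    (Odd k → HasType p q 4 → ResMinus (h - g) → ResPlus (l - t) →
      IsAutPlus B.volMat X Y .dihedral 1 (-1) 1) ∧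
    (Odd k → HasType p q 4 → ResPlus (h - g) → ResMinus (l - t) →
      IsAutPlus B.volMat X Y .dihedral 1 1 (-1)) ∧
    (Odd k → HasType p q 6 → ResMinus (h - g) → ResMinus (l - t) →
      IsAutPlus B.volMat X Y .quaternion (-1) (-1) (-1)) ∧
    (Odd k → HasType p q 6 → ResPlus (h - g) → ResPlus (l - t) →
      IsAutPlus B.volMat X Y .dihedral (-1) 1 1) := by
  have hn : Even (p + q) := hpq.elim (·.even rfl) (·.even rfl)
  have hsep := B.separates_isSymm
  have hY' : Y = B.prodOver (fun i => ¬ B.IsSymm i) := by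
    rw [hY]; exact B.prodOver_congr B.isSkew_iff
  have hk' : k = {i | ¬ B.IsSymm i}.ncard := by
    simp only [hk, numSkew, isSkew_iff]
  subst hX hY'
  simp only [numSkewPos, numSkewNeg, numSymmPos, numSymmNeg, isSkew_iff, mat_sq_eq_one_iff,
    mat_sq_eq_neg_one_iff] at hl ht hh hg
  have w4 : HasType p q 4 → sqSign p q = 1 := fun h => sqSign_of_resPlus (Or.inr (Or.inr (Or.inl h)))
  have w6 : HasType p q 6 → sqSign p q = -1 :=
    fun h => sqSign_of_resMinus (Or.inr (Or.inr (Or.inl h)))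
  subst hk' hl ht hh hg
  clear hk hY hpq
  exact ⟨hsep.represents_even hn,
    fun hk h hl hh => B.isAutMinus_of_counts _ hk (w4 h) (sqSign_of_resPlus hl)
      (sqSign_of_resPlus hh),
    fun hk h hl hh => B.isAutMinus_of_counts _ hk (w4 h) (sqSign_of_resMinus hl)
      (sqSign_of_resMinus hh),
    fun hk h hl hh => B.isAutMinus_of_counts _ hk (w6 h) (sqSign_of_resPlus hl)
      (sqSign_of_resMinus hh),
    fun hk h hl hh => B.isAutMinus_of_counts _ hk (w6 h) (sqSign_of_resMinus hl)
      (sqSign_of_resPlus hh),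
    hsep.represents_odd hn,
    fun hk h hh hl => B.isAutPlus_of_counts _ hn hk (w4 h) (sqSign_of_resMinus hh)
      (sqSign_of_resPlus hl),
    fun hk h hh hl => B.isAutPlus_of_counts _ hn hk (w4 h) (sqSign_of_resPlus hh)
      (sqSign_of_resMinus hl),
    fun hk h hh hl => B.isAutPlus_of_counts _ hn hk (w6 h) (sqSign_of_resMinus hh)
      (sqSign_of_resMinus hl),
    fun hk h hh hl => B.isAutPlus_of_counts _ hn hk (w6 h) (sqSign_of_resPlus hh)
      (sqSign_of_resPlus hl)⟩

/-! ### Quaternionic spinbases of the algebras `Cl 0 n` -/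

/-- The exponents of `1`, `σ_x`, `σ_z`, `σ_x σ_z` (or of `1`, `i`, `j`, `i j`). -/
def pauliLetter : Fin 4 → ZMod 2 × ZMod 2 := ![(0, 0), (1, 0), (0, 1), (1, 1)]

/-- Makes the existence of a system a finite computation: the rows of `w` are the units and its
columns the tensor factors. All squares being -1, a letter 0 in `v`, that is a real quaternion
factor, marks a skewsymmetric matrix. -/
theorem hasQuat_of_table {n m : ℕ} (hm : 2 * m + 2 = n) (w : Fin n → Fin m → Fin 4)
    (v : Fin n → Fin 4)
    (h1 : ∀ i, pauliForm (fun a => pauliLetter (w i a)) (fun a => pauliLetter (w i a)) +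
      quatForm (pauliLetter (v i)) (pauliLetter (v i)) = 1)
    (h2 : ∀ i j, i ≠ j →
      pauliForm (fun a => pauliLetter (w i a)) (fun a => pauliLetter (w j a)) +
        quatForm (pauliLetter (v i)) (pauliLetter (v j)) +
        (pauliForm (fun a => pauliLetter (w j a)) (fun a => pauliLetter (w i a)) +
          quatForm (pauliLetter (v j)) (pauliLetter (v i))) = 1) :
    HasQuat 0 n (Sum.elim (fun i => i.elim0) (fun i => pauliLetter (v i))) := by
  refine ⟨m, by omega, Sum.elim (fun i => i.elim0) (fun i a => pauliLetter (w i a)), ?_, ?_⟩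
  · rintro (i | i)
    · exact i.elim0
    · exact h1 i
  · rintro (i | i) (j | j) hij
    · exact i.elim0
    · exact i.elim0
    · exact j.elim0
    · exact h2 i j fun e => hij (by rw [e])

theorem hasQuat_four : HasQuat 0 4 (Sum.elim (fun i => i.elim0)
    (fun i => pauliLetter (![1, 2, 3, 3] i))) :=
  hasQuat_of_table (m := 1) rfl
    ![![0], ![0], ![1], ![2]]
    _ (by decide) (by decide)

/-- Together with the next three tables this provides k = 1, 2 skewsymmetric matrices for `Cl 0 10`
and k = 2, 3 for `Cl 0 12`; k is the number of letters 0 in the quaternion row. -/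
theorem hasQuat_ten_one : HasQuat 0 10 (Sum.elim (fun i => i.elim0)
    (fun i => pauliLetter (![1, 1, 1, 2, 2, 2, 3, 3, 3, 0] i))) :=
  hasQuat_of_table (m := 4) rfl
    ![![0, 0, 0, 1], ![0, 0, 0, 2], ![0, 0, 3, 3], ![0, 1, 0, 0], ![0, 2, 0, 0], ![0, 3, 3, 0],
      ![1, 0, 0, 0], ![2, 0, 0, 0], ![3, 0, 3, 0], ![3, 3, 1, 3]]
    _ (by decide) (by decide)

theorem hasQuat_ten_two : HasQuat 0 10 (Sum.elim (fun i => i.elim0)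
    (fun i => pauliLetter (![0, 0, 1, 1, 1, 2, 2, 2, 3, 3] i))) :=
  hasQuat_of_table (m := 4) rfl
    ![![0, 0, 0, 3], ![0, 0, 3, 1], ![0, 0, 0, 2], ![0, 0, 1, 1], ![0, 0, 2, 1], ![0, 3, 3, 2],
      ![3, 1, 3, 2], ![3, 2, 3, 2], ![1, 3, 3, 2], ![2, 3, 3, 2]]
    _ (by decide) (by decide)

theorem hasQuat_twelve_two : HasQuat 0 12 (Sum.elim (fun i => i.elim0)
    (fun i => pauliLetter (![0, 0, 1, 1, 1, 2, 2, 2, 3, 3, 3, 3] i))) :=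
  hasQuat_of_table (m := 5) rfl
    ![![0, 0, 0, 0, 3], ![0, 0, 0, 3, 1], ![0, 0, 0, 0, 2], ![0, 0, 0, 1, 1], ![0, 0, 0, 2, 1],
      ![0, 0, 3, 3, 2], ![0, 3, 1, 3, 2], ![0, 3, 2, 3, 2], ![0, 1, 3, 3, 2], ![0, 2, 3, 3, 2],
      ![1, 3, 0, 3, 2], ![2, 3, 0, 3, 2]]
    _ (by decide) (by decide)

theorem hasQuat_twelve_three : HasQuat 0 12 (Sum.elim (fun i => i.elim0)
    (fun i => pauliLetter (![1, 1, 1, 2, 2, 2, 3, 3, 3, 0, 0, 0] i))) :=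
  hasQuat_of_table (m := 5) rfl
    ![![0, 0, 0, 0, 1], ![0, 0, 0, 0, 2], ![0, 0, 0, 3, 3], ![0, 0, 1, 0, 0], ![0, 0, 2, 0, 0],
      ![0, 0, 3, 3, 0], ![0, 1, 0, 0, 0], ![0, 2, 0, 0, 0], ![0, 3, 0, 3, 0], ![0, 3, 3, 1, 3],
      ![1, 3, 3, 2, 3], ![2, 3, 3, 2, 3]]
    _ (by decide) (by decide)


/-- Since every square is -1, a matrix is skewsymmetric exactly when its quaternion factor is real.
Hence l = h = 0, t = k and g = n - k. -/
theorem HasQuat.exists_counts {n : ℕ} {v : Fin 0 ⊕ Fin n → ZMod 2 × ZMod 2} (h : HasQuat 0 n v)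
    {k : ℕ} (hk : (Finset.univ.filter fun i => v (.inr i) = 0).card = k) :
    ∃ (N : ℕ) (B : SpinBasis ℝ (sgn 0 n) ℍ[ℝ] N), B.numSkew = k ∧ B.numSkewPos = 0 ∧
      B.numSkewNeg = k ∧ B.numSymmPos = 0 ∧ k + B.numSymmNeg = n := by
  obtain ⟨B, hB⟩ := h.exists_spinBasis
  have hs : ∀ i, sgn 0 n i = -1 := fun i => (sgn_eq_neg_one_iff i).2 (Nat.not_lt_zero _)
  have hs' : ∀ i, sgn 0 n i = 1 ↔ False := fun i => by simp [hs]
  have hs'' : ∀ i, sgn 0 n i = -1 ↔ True := fun i => by simp [hs]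
  have hsymm : ∀ i, B.IsSymm i ↔ v (finSumFinEquiv.symm i) ≠ 0 := fun i => by
    have h1 := hB i
    by_cases hv : v (finSumFinEquiv.symm i) = 0
    · rw [hs, if_pos hv, mul_one, neg_one_smul_units] at h1
      exact iff_of_false ((B.isSkew_iff i).1 h1) (not_not_intro hv)
    · rw [hs, if_neg hv, neg_one_mul, neg_neg, one_smul] at h1
      exact iff_of_true h1 hv
  have hcard : {i | v (finSumFinEquiv.symm i) = 0}.ncard = k := by
    have himg : {i | v (finSumFinEquiv.symm i) = 0} =
        (fun i : Fin n => finSumFinEquiv (Sum.inr i : Fin 0 ⊕ Fin n)) ''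
          (Finset.univ.filter fun i => v (.inr i) = 0 : Finset (Fin n)) := by
      ext i
      obtain ⟨x | x, rfl⟩ := finSumFinEquiv.surjective i
      · exact x.elim0
      · constructor
        · intro hx
          rw [Set.mem_ofPred_eq, Equiv.symm_apply_apply] at hx
          exact ⟨x, by simpa using hx, rfl⟩
        · rintro ⟨y, hy, he⟩
          obtain rfl := Sum.inr_injective (finSumFinEquiv.injective he)
          rw [Set.mem_ofPred_eq, Equiv.symm_apply_apply]
          simpa using hy
    rw [himg, Set.ncard_image_of_injective _
      (fun _ _ h => Sum.inr_injective (finSumFinEquiv.injective h)), Set.ncard_coe_finset, hk]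
  refine ⟨_, B, ?_⟩
  simp only [SpinBasis.numSkew, SpinBasis.numSkewPos, SpinBasis.numSkewNeg, SpinBasis.numSymmPos,
    SpinBasis.numSymmNeg, SpinBasis.isSkew_iff, SpinBasis.mat_sq_eq_one_iff,
    SpinBasis.mat_sq_eq_neg_one_iff, hs', hs'', hsymm, and_false, and_true, not_not]
  refine ⟨hcard, Set.ncard_empty _, hcard, Set.ncard_empty _, ?_⟩
  have := SpinBasis.ncard_add_ncard_not fun i => v (finSumFinEquiv.symm i) = 0
  rw [hcard] at this
  exact this.trans (zero_add n)

/-- The automorphism group of a quaternionic spinbasis. -/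
def QuatAdmits {p q N : ℕ} (B : SpinBasis ℝ (sgn p q) ℍ[ℝ] N) (ab : Bool) (τ : AutType)
    (a b c : ℤˣ) : Prop :=
  if ab then Even B.numSkew ∧
    IsAutMinus B.volMat (B.prodOver B.IsSkew) (B.prodOver B.IsSymm) τ a b c
  else Odd B.numSkew ∧
    IsAutPlus B.volMat (B.prodOver B.IsSymm) (B.prodOver B.IsSkew) τ a b c

/-- In `Cl 0 n` the residues are those of -k and k - n, so only the pair (n, k) matters. The four
groups are realized by (4,0), (12,2), (12,3) and (4,1). -/
theorem exists_quatAdmits_pos {ab : Bool} {τ : AutType} {a b c : ℤˣ} (h : PosList ab τ a b c) :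
    ∃ n, HasType 0 n 4 ∧ ∃ (N : ℕ) (B : SpinBasis ℝ (sgn 0 n) ℍ[ℝ] N),
      QuatAdmits B ab τ a b c := by
  simp only [PosList, Set.mem_insert_iff, Set.mem_singleton_iff, Prod.mk.injEq] at h
  rcases h with ⟨rfl, rfl, rfl, rfl, rfl⟩ | ⟨rfl, rfl, rfl, rfl, rfl⟩ |
    ⟨rfl, rfl, rfl, rfl, rfl⟩ | ⟨rfl, rfl, rfl, rfl, rfl⟩
  · have ht : HasType 0 4 4 := by unfold HasType; decide
    obtain ⟨N, B, h1, h2, h3, h4, h5⟩ := hasQuat_four.exists_counts (k := 0) (by decide)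
    have h6 : B.numSymmNeg = 4 := by omega
    have hk : Even B.numSkew := by rw [h1]; decide
    exact ⟨4, ht, N, B, hk, (quat_case 0 4 (.inl ht) N B _ _ _ _ _ _ _ rfl rfl rfl rfl rfl rfl
      rfl).2.1 hk ht (by rw [h2, h3]; simp [ResPlus, Int.ModEq])
      (by rw [h4, h6]; simp [ResPlus, Int.ModEq])⟩
  · have ht : HasType 0 12 4 := by unfold HasType; decide
    obtain ⟨N, B, h1, h2, h3, h4, h5⟩ := hasQuat_twelve_two.exists_counts (k := 2) (by decide)
    have h6 : B.numSymmNeg = 10 := by omega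
    have hk : Even B.numSkew := by rw [h1]; decide
    exact ⟨12, ht, N, B, hk, (quat_case 0 12 (.inl ht) N B _ _ _ _ _ _ _ rfl rfl rfl rfl rfl rfl
      rfl).2.2.1 hk ht (by rw [h2, h3]; simp [ResMinus, Int.ModEq])
      (by rw [h4, h6]; simp [ResMinus, Int.ModEq])⟩
  · have ht : HasType 0 12 4 := by unfold HasType; decide
    obtain ⟨N, B, h1, h2, h3, h4, h5⟩ := hasQuat_twelve_three.exists_counts (k := 3) (by decide)
    have h6 : B.numSymmNeg = 9 := by omega
    have hk : Odd B.numSkew := by rw [h1]; decide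
    exact ⟨12, ht, N, B, hk, (quat_case 0 12 (.inl ht) N B _ _ _ _ _ _ _ rfl rfl rfl rfl rfl rfl
      rfl).2.2.2.2.2.2.1 hk ht (by rw [h4, h6]; simp [ResMinus, Int.ModEq])
      (by rw [h2, h3]; simp [ResPlus, Int.ModEq])⟩
  · have ht : HasType 0 4 4 := by unfold HasType; decide
    have hq : HasPauli 1 1 := hasPauli_of_type 1 1 (.inl (by unfold HasType; decide))
    obtain ⟨N, B, h1, h2, h3, h4, h5⟩ := hq.quat_pos.exists_counts (k := 1) (by decide)
    have h6 : B.numSymmNeg = 3 := by omega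
    have hk : Odd B.numSkew := by rw [h1]; decide
    exact ⟨4, ht, N, B, hk, (quat_case 0 4 (.inl ht) N B _ _ _ _ _ _ _ rfl rfl rfl rfl rfl rfl
      rfl).2.2.2.2.2.2.2.1 hk ht (by rw [h4, h6]; simp [ResPlus, Int.ModEq])
      (by rw [h2, h3]; simp [ResMinus, Int.ModEq])⟩

/-- The pairs (n, k) used are (10,2), (2,0), (10,1) and (10,7), the last one from a real system for
`Cl 1 7`. -/
theorem exists_quatAdmits_neg {ab : Bool} {τ : AutType} {a b c : ℤˣ} (h : NegList ab τ a b c) :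
    ∃ n, HasType 0 n 6 ∧ ∃ (N : ℕ) (B : SpinBasis ℝ (sgn 0 n) ℍ[ℝ] N),
      QuatAdmits B ab τ a b c := by
  simp only [NegList, Set.mem_insert_iff, Set.mem_singleton_iff, Prod.mk.injEq] at h
  rcases h with ⟨rfl, rfl, rfl, rfl, rfl⟩ | ⟨rfl, rfl, rfl, rfl, rfl⟩ |
    ⟨rfl, rfl, rfl, rfl, rfl⟩ | ⟨rfl, rfl, rfl, rfl, rfl⟩
  · have ht : HasType 0 10 6 := by unfold HasType; decide
    obtain ⟨N, B, h1, h2, h3, h4, h5⟩ := hasQuat_ten_two.exists_counts (k := 2) (by decide)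
    have h6 : B.numSymmNeg = 8 := by omega
    have hk : Even B.numSkew := by rw [h1]; decide
    exact ⟨10, ht, N, B, hk, (quat_case 0 10 (.inr ht) N B _ _ _ _ _ _ _ rfl rfl rfl rfl rfl rfl
      rfl).2.2.2.2.1 hk ht (by rw [h2, h3]; simp [ResMinus, Int.ModEq])
      (by rw [h4, h6]; simp [ResPlus, Int.ModEq])⟩
  · have ht : HasType 0 2 6 := by unfold HasType; decide
    obtain ⟨N, B, h1, h2, h3, h4, h5⟩ := hasQuat_zero_two.exists_counts (k := 0) (by decide)
    have h6 : B.numSymmNeg = 2 := by omega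
    have hk : Even B.numSkew := by rw [h1]; decide
    exact ⟨2, ht, N, B, hk, (quat_case 0 2 (.inr ht) N B _ _ _ _ _ _ _ rfl rfl rfl rfl rfl rfl
      rfl).2.2.2.1 hk ht (by rw [h2, h3]; simp [ResPlus, Int.ModEq])
      (by rw [h4, h6]; simp [ResMinus, Int.ModEq])⟩
  · have ht : HasType 0 10 6 := by unfold HasType; decide
    obtain ⟨N, B, h1, h2, h3, h4, h5⟩ := hasQuat_ten_one.exists_counts (k := 1) (by decide)
    have h6 : B.numSymmNeg = 9 := by omega
    have hk : Odd B.numSkew := by rw [h1]; decide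
    exact ⟨10, ht, N, B, hk, (quat_case 0 10 (.inr ht) N B _ _ _ _ _ _ _ rfl rfl rfl rfl rfl rfl
      rfl).2.2.2.2.2.2.2.2.1 hk ht (by rw [h4, h6]; simp [ResMinus, Int.ModEq])
      (by rw [h2, h3]; simp [ResMinus, Int.ModEq])⟩
  · have ht : HasType 0 10 6 := by unfold HasType; decide
    have hq : HasPauli 1 7 := hasPauli_of_type 1 7 (.inr (by unfold HasType; decide))
    obtain ⟨N, B, h1, h2, h3, h4, h5⟩ := hq.quat_pos.exists_counts (k := 7) (by decide)
    have h6 : B.numSymmNeg = 3 := by omega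
    have hk : Odd B.numSkew := by rw [h1]; decide
    exact ⟨10, ht, N, B, hk, (quat_case 0 10 (.inr ht) N B _ _ _ _ _ _ _ rfl rfl rfl rfl rfl rfl
      rfl).2.2.2.2.2.2.2.2.2 hk ht (by rw [h4, h6]; simp [ResPlus, Int.ModEq])
      (by rw [h2, h3]; simp [ResPlus, Int.ModEq])⟩

/-! ### The decomposition of the semisimple algebras -/

theorem volume_sq (p q : ℕ) :
    volume ℝ (sgn p q) * volume ℝ (sgn p q) = sqSign p q • 1 := by
  rw [volume, (isCliffordFamily_unit _).prod_sq (List.nodup_finRange _), List.length_finRange,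
    prod_map_sign, List.countP_eq_length_filter, length_filter_finRange, ncard_sgn_neg]
  rfl

theorem prod_map_neg {R ι : Type*} [Ring R] (f : ι → R) (L : List ι) :
    (L.map fun i => -f i).prod = (-1 : ℤˣ) ^ L.length • (L.map f).prod := by
  induction L with
  | nil => simp
  | cons j L ih =>
    rw [List.map_cons, List.prod_cons, ih, List.map_cons, List.prod_cons, List.length_cons,
      pow_succ, mul_smul, mul_smul_comm, neg_mul, neg_one_smul_units]

theorem involute_volume {F : Type} [Field F] {n : ℕ} (s : Fin n → ℤˣ) :
    CliffordAlgebra.involute (volume F s) = (-1 : ℤˣ) ^ n • volume F s := by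
  have h : (CliffordAlgebra.involute : CliffAlg F s →ₐ[F] _) ∘ unit F s = fun i => -unit F s i :=
    funext (involute_unit s)
  rw [volume, map_list_prod, List.map_map, h, prod_map_neg, List.length_finRange]

theorem exists_prod_map_mul_left {R ι : Type*} [Ring R] {f : ι → R} {T : R}
    (hTf : ∀ i, f i * T = -(T * f i)) (L : List ι) :
    ∃ e : ℤˣ, (L.map fun i => T * f i).prod = e • (T ^ L.length * (L.map f).prod) := by
  have hpow : ∀ i n, f i * T ^ n = (-1 : ℤˣ) ^ n • (T ^ n * f i) := fun i n => by
    induction n with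
    | zero => simp
    | succ n ih =>
      rw [pow_succ, ← mul_assoc, ih, smul_mul_assoc, mul_assoc, hTf, mul_neg,
        ← neg_one_smul_units, smul_smul, ← pow_succ, mul_assoc]
  induction L with
  | nil => exact ⟨1, by simp⟩
  | cons j L ih =>
    obtain ⟨e, he⟩ := ih
    refine ⟨e * (-1) ^ L.length, ?_⟩
    rw [List.map_cons, List.prod_cons, he, mul_smul_comm, mul_assoc, ← mul_assoc (f j), hpow,
      smul_mul_assoc, mul_smul_comm, smul_smul, List.length_cons, List.map_cons, List.prod_cons,
      pow_succ', mul_assoc, mul_assoc]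

/-- The products of a Clifford family in two different orders agree up to sign. -/
theorem IsCliffordFamily.exists_prod_option {R : Type*} [Ring R] {n k : ℕ} {s : Fin n → ℤˣ}
    {f : Fin n → R} (hf : IsCliffordFamily s f) (τ : Option (Fin k) ≃ Fin n) :
    ∃ e : ℤˣ, ((List.finRange n).map f).prod =
      e • (f (τ none) * ((List.finRange k).map fun j => f (τ (some j))).prod) := by
  have hp : (List.finRange n).Perm (τ none :: (List.finRange k).map fun j => τ (some j)) := by
    refine List.perm_of_nodup_nodup_toFinset_eq (List.nodup_finRange n) ?_ ?_
    · rw [List.nodup_cons]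
      refine ⟨fun h => ?_, (List.nodup_finRange k).map fun a b h =>
        Option.some_injective _ (τ.injective h)⟩
      obtain ⟨j, -, hj⟩ := List.mem_map.1 h
      exact Option.some_ne_none _ (τ.injective hj)
    · ext i
      obtain ⟨o, rfl⟩ := τ.surjective i
      cases o <;> simp
  obtain ⟨e, he⟩ := hf.exists_prod_eq_of_perm hp
  exact ⟨e, by rw [he, List.map_cons, List.prod_cons, List.map_map]; rfl⟩

theorem surjective_of_units_mem {F A : Type} [Field F] [Ring A] [Algebra F A] {n : ℕ}
    {s : Fin n → ℤˣ} (φ : A →ₐ[F] CliffAlg F s) (h : ∀ i, unit F s i ∈ φ.range) :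
    Function.Surjective φ := by
  intro a
  change a ∈ φ.range
  induction a using cliffAlg_induction with
  | hF r => exact φ.range.algebraMap_mem r
  | hu i => exact h i
  | hmul a b ha hb => exact mul_mem ha hb
  | hadd a b ha hb => exact add_mem ha hb

/-- The second component is φ composed with the involution, which sends ω to -ω because p + q is
odd. The idempotents (1 ± ω)/2 separate the two components, and dimensions agree. -/
theorem decomposes_of_hom {p q p' q' : ℕ} (hn : Odd (p + q)) (hdim : p' + q' + 1 = p + q)
    (φ : Cl p q →ₐ[ℝ] Cl p' q') (hφ : Function.Surjective φ)
    (hvol : φ (volume ℝ (sgn p q)) = 1) : Decomposes p q p' q' := by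
  let Φ : Cl p q →ₐ[ℝ] Cl p' q' × Cl p' q' := φ.prod (φ.comp CliffordAlgebra.involute)
  have hω : Φ (volume ℝ (sgn p q)) = (1, -1) := by
    refine Prod.ext hvol ?_
    change φ (CliffordAlgebra.involute _) = -1
    rw [involute_volume, hn.neg_one_pow, neg_one_smul_units, map_neg, hvol]
  have hsurj : Function.Surjective Φ.toLinearMap := by
    rintro ⟨a, b⟩
    obtain ⟨x, rfl⟩ := hφ a
    obtain ⟨y, rfl⟩ := hφ b
    -- The two idempotents go to (1,0) and (0,1); the involution on y cancels the one built into the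
    -- second component.
    refine ⟨x * ((1 / 2 : ℝ) • (1 + volume ℝ (sgn p q))) +
      CliffordAlgebra.involute y * ((1 / 2 : ℝ) • (1 - volume ℝ (sgn p q))), ?_⟩
    rw [AlgHom.toLinearMap_apply, map_add, map_mul, map_mul, map_smul, map_smul, map_add, map_sub,
      map_one, hω]
    refine Prod.ext ?_ ?_
    · change φ x * ((1 / 2 : ℝ) • (1 + 1)) + _ * ((1 / 2 : ℝ) • (1 - 1)) = φ x
      rw [sub_self, smul_zero, mul_zero, add_zero, ← two_smul ℝ, smul_smul]
      norm_num
    · change _ * ((1 / 2 : ℝ) • (1 + -1)) +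
        φ (CliffordAlgebra.involute (CliffordAlgebra.involute y)) * ((1 / 2 : ℝ) • (1 - -1)) = φ y
      rw [add_neg_cancel, smul_zero, mul_zero, zero_add, sub_neg_eq_add, ← two_smul ℝ, smul_smul,
        CliffordAlgebra.involute_involute]
      norm_num
  have hfin : Module.finrank ℝ (Cl p q) = Module.finrank ℝ (Cl p' q' × Cl p' q') := by
    rw [Module.finrank_prod, finrank_cliffAlg, finrank_cliffAlg, ← hdim, pow_succ, mul_two]
  exact ⟨AlgEquiv.ofBijective Φ
    ⟨(LinearMap.injective_iff_surjective_of_finrank_eq_finrank hfin).2 hsurj, hsurj⟩, hω⟩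

/-- It suffices to find p + q anticommuting generators of the summand, in any order, with the right
squares and with product ±1; reordering affects only the sign of the image of ω. -/
theorem decomposes_of_family {p q p' q' : ℕ} (hn : Odd (p + q)) (hdim : p' + q' + 1 = p + q)
    (τ : Option (Fin (p' + q')) → Fin (p + q)) (hτ : Function.Injective τ)
    (f : Option (Fin (p' + q')) → Cl p' q')
    (hf : IsCliffordFamily (fun o => sgn p q (τ o)) f)
    (hgen : ∀ S : Subalgebra ℝ (Cl p' q'), (∀ o, f o ∈ S) → ∀ j, unit ℝ (sgn p' q') j ∈ S)
    (hvol : ∃ e : ℤˣ, f none * ((List.finRange (p' + q')).map fun j => f (some j)).prod = e • 1) :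
    Decomposes p q p' q' := by
  let σ : Option (Fin (p' + q')) ≃ Fin (p + q) := Equiv.ofBijective τ
    ((Fintype.bijective_iff_injective_and_card τ).2 ⟨hτ, by simpa using hdim⟩)
  have hσ : ∀ i, sgn p q (τ (σ.symm i)) = sgn p q i := fun i =>
    congrArg (sgn p q) (σ.apply_symm_apply i)
  have hg : IsCliffordFamily (sgn p q) (fun i => f (σ.symm i)) :=
    { sq := fun i => by rw [hf.sq, hσ]
      anticomm := fun i j hij => hf.anticomm _ _ (σ.symm.injective.ne hij) }
  have hsurj : Function.Surjective (hg.lift (F := ℝ)) := by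
    refine surjective_of_units_mem _ (hgen _ fun o => ⟨unit ℝ _ (σ o), ?_⟩)
    refine (hg.lift_unit (F := ℝ) (σ o)).trans ?_
    rw [Equiv.symm_apply_apply]
  obtain ⟨e, he⟩ := hvol
  obtain ⟨e', he'⟩ := hg.exists_prod_option σ
  simp only [Equiv.symm_apply_apply] at he'
  rw [he, smul_smul, ← hg.lift_volume (F := ℝ)] at he'
  rcases Int.units_eq_one_or (e' * e) with h | h <;> rw [h] at he'
  · exact decomposes_of_hom hn hdim hg.lift hsurj (by rw [he', one_smul])
  -- If ω goes to -1, composing with the involution corrects the sign.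
  · refine decomposes_of_hom hn hdim (hg.lift.comp CliffordAlgebra.involute) ?_ ?_
    · exact hsurj.comp CliffordAlgebra.involute_involutive.surjective
    · rw [AlgHom.comp_apply, involute_volume, hn.neg_one_pow, neg_one_smul_units, map_neg, he',
        neg_one_smul_units, neg_neg]

/-- Let T be the volume element of the summand, which anticommutes with its units. For `Cl p (q-1)`
one has T² = -1, and T serves as the missing negative unit. For `Cl q (p-1)` one has T² = 1, and T
together with the T e_j, whose squares are the opposites of e_j², forms the required family. -/
theorem decomposes_of_type {p q p' q' : ℕ} (h : HasType p q 1 ∨ HasType p q 5)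
    (hp : (p' = p ∧ q' + 1 = q) ∨ (p' = q ∧ q' + 1 = p)) : Decomposes p q p' q' := by
  simp only [HasType, Int.ModEq] at h
  have hn : Odd (p + q) := by rw [Nat.odd_iff]; omega
  have hn' : Even (p' + q') := by rw [Nat.even_iff]; omega
  have hcomm : ∀ j, unit ℝ (sgn p' q') j * volume ℝ (sgn p' q') =
      -(volume ℝ (sgn p' q') * unit ℝ (sgn p' q') j) := unit_mul_volume _ hn'
  have hfam := isCliffordFamily_unit (F := ℝ) (sgn p' q')
  rcases hp with ⟨rfl, rfl⟩ | ⟨rfl, rfl⟩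
  · have hsq : volume ℝ (sgn p' q') * volume ℝ (sgn p' q') = (-1 : ℤˣ) • 1 := by
      rw [volume_sq, sqSign_of_resMinus]; simp only [ResMinus, Int.ModEq]; push_cast at h; omega
    refine decomposes_of_family hn (by omega)
      (fun o => o.elim (Fin.last (p' + q')) Fin.castSucc) ?_
      (fun o => o.elim (volume ℝ (sgn p' q')) (unit ℝ (sgn p' q'))) ⟨?_, ?_⟩ ?_ ⟨-1, hsq⟩
    · rintro (_ | i) (_ | j) hij
      · rfl
      · exact absurd hij.symm (Fin.castSucc_ne_last j)
      · exact absurd hij (Fin.castSucc_ne_last i)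
      · exact congrArg some (Fin.castSucc_injective _ hij)
    · rintro (_ | i)
      · refine hsq.trans ?_
        congr 1
        exact ((sgn_eq_neg_one_iff (p := p') (q := q' + 1) (Fin.last (p' + q'))).2
          (by simp)).symm
      · exact hfam.sq i
    · rintro (_ | i) (_ | j) hij
      · exact absurd rfl hij
      · rw [Option.elim_none, Option.elim_some, hcomm j, neg_neg]
      · exact hcomm i
      · exact hfam.anticomm i j fun e => hij (by rw [e])
    · exact fun S hS j => hS (some j)
  · have hsq : volume ℝ (sgn p' q') * volume ℝ (sgn p' q') = 1 := by
      rw [volume_sq, sqSign_of_resPlus, one_smul]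
      simp only [ResPlus, Int.ModEq]; push_cast at h; omega
    set T := volume ℝ (sgn p' q') with hT
    have hTu : ∀ j, T * (T * unit ℝ (sgn p' q') j) = unit ℝ (sgn p' q') j := fun j => by
      rw [← mul_assoc, hsq, one_mul]
    have huT : ∀ x y, T * unit ℝ (sgn p' q') x * (T * unit ℝ (sgn p' q') y) =
        -(unit ℝ (sgn p' q') x * unit ℝ (sgn p' q') y) := fun x y => by
      rw [mul_assoc, ← mul_assoc (unit _ _ x), hcomm, neg_mul, mul_neg, mul_assoc, ← mul_assoc T,
        hsq, one_mul]
    refine decomposes_of_family hn (by omega)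
      -- T takes the first positive place. The p' positive units of the summand become negative and
      -- go to the last places; its negative ones fill the remaining positive places.
      (fun o => o.elim (⟨0, by omega⟩ : Fin (q' + 1 + p')) fun j =>
        if h : j.val < p' then ⟨q' + 1 + j.val, by omega⟩ else ⟨j.val - p' + 1, by omega⟩) ?_
      (fun o => o.elim T fun j => T * unit ℝ (sgn p' q') j) ⟨?_, ?_⟩ ?_ ?_
    · rintro (_ | i) (_ | j) hij
      · rfl
      · simp only [Option.elim_none, Option.elim_some] at hij
        split_ifs at hij <;> simp only [Fin.mk.injEq] at hij <;> omega
      · simp only [Option.elim_none, Option.elim_some] at hij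
        split_ifs at hij <;> simp only [Fin.mk.injEq] at hij <;> omega
      · simp only [Option.elim_some] at hij
        rw [Option.some_inj, Fin.ext_iff]
        split_ifs at hij <;> simp only [Fin.mk.injEq] at hij <;> omega
    · rintro (_ | i)
      · refine hsq.trans ?_
        rw [Option.elim_none, (sgn_eq_one_iff _).2 (Nat.succ_pos q'), one_smul]
      · simp only [Option.elim_some]
        rw [huT, hfam.sq, ← neg_one_smul_units, smul_smul]
        congr 1
        split_ifs with hi
        · rw [(sgn_eq_one_iff i).2 hi, (sgn_eq_neg_one_iff _).2 (by simp; omega)]; rfl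
        · rw [(sgn_eq_neg_one_iff i).2 hi, (sgn_eq_one_iff _).2 (by simp; omega)]; rfl
    · rintro (_ | i) (_ | j) hij
      · exact absurd rfl hij
      · rw [Option.elim_none, Option.elim_some, hTu, mul_assoc, hcomm, mul_neg, neg_neg, hTu]
      · rw [Option.elim_none, Option.elim_some, hTu, mul_assoc, hcomm, mul_neg, hTu]
      · simp only [Option.elim_some]
        rw [huT, huT, hfam.anticomm i j fun e => hij (by rw [e])]
    · intro S hS j
      rw [← hTu j]
      exact mul_mem (hS none) (hS (some j))
    · obtain ⟨e, he⟩ := exists_prod_map_mul_left hcomm (List.finRange (p' + q'))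
      refine ⟨e, ?_⟩
      simp only [Option.elim_none, Option.elim_some]
      have hTn : T ^ (p' + q') = 1 := by
        obtain ⟨k, hk⟩ := hn'
        exact (congrArg (T ^ ·) (hk.trans (two_mul k).symm)).trans (by
          rw [pow_mul, pow_two, hsq, one_pow])
      rw [he, List.length_finRange, hTn, one_mul, mul_smul_comm]
      exact congrArg (e • ·) hsq

/-! ### The groups of the semisimple algebras -/

theorem SpinBasis.Represents.volume_signature {p q : ℕ} {K : Type} [Ring K] [Algebra ℝ K] {N : ℕ}
    {B : SpinBasis ℝ (sgn p q) K N} {W E C : Matrix (Fin N) (Fin N) K}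
    (h : B.Represents W E C) (hK : ∀ z : K, (∀ x, z * x = x * z) → ∃ r : ℝ, z = algebraMap ℝ K r)
    {ab : Bool} {τ : AutType} {a b c : ℤˣ}
    (haut : if ab then IsAutMinus W E C τ a b c else IsAutPlus W E C τ a b c) :
    sqSign p q = a ∧ c = commSign ab * a * b ∧ τ = typeOf ab a b := by
  obtain ⟨h1, h2, h3⟩ := h.signature hK haut
  refine ⟨?_, h2, h3⟩
  rw [B.volMat_sq] at h1
  change sqSign p q • (1 : Matrix (Fin N) (Fin N) K) = a • 1 at h1
  have hne := B.neg_one_ne_one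
  rcases Int.units_eq_one_or (sqSign p q) with e | e <;> rcases Int.units_eq_one_or a with e' | e' <;>
    rw [e, e'] at h1 ⊢ <;> rw [one_smul, neg_one_smul_units] at h1
  · exact absurd h1.symm hne
  · exact absurd h1 hne

theorem SimpleAdmits.signature {p q : ℕ} {ab : Bool} {τ : AutType} {a b c : ℤˣ}
    (h : SimpleAdmits p q ab τ a b c) :
    sqSign p q = a ∧ c = commSign ab * a * b ∧ τ = typeOf ab a b := by
  rcases h with ⟨N, B, W, E, C, h, haut⟩ | ⟨N, B, W, E, C, h, haut⟩
  · exact h.volume_signature (fun z _ => ⟨z, rfl⟩) haut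
  · exact h.volume_signature quaternion_center haut

/-- Once a = 1, the only freedom is b and the commutation sign; c and the type follow, which leaves
four possibilities. -/
theorem SimpleAdmits.posList {p q : ℕ} {ab : Bool} {τ : AutType} {a b c : ℤˣ}
    (h : SimpleAdmits p q ab τ a b c) (hs : sqSign p q = 1) : PosList ab τ a b c := by
  obtain ⟨ha, rfl, rfl⟩ := h.signature
  obtain rfl : a = 1 := ha.symm.trans hs
  clear h ha
  rcases Int.units_eq_one_or b with rfl | rfl <;> cases ab <;>
    simp [PosList, typeOf, commSign]

theorem SimpleAdmits.negList {p q : ℕ} {ab : Bool} {τ : AutType} {a b c : ℤˣ}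
    (h : SimpleAdmits p q ab τ a b c) (hs : sqSign p q = -1) : NegList ab τ a b c := by
  obtain ⟨ha, rfl, rfl⟩ := h.signature
  obtain rfl : a = -1 := ha.symm.trans hs
  clear h ha
  rcases Int.units_eq_one_or b with rfl | rfl <;> cases ab <;>
    simp [NegList, typeOf, commSign]

theorem QuatAdmits.simpleAdmits {p q N : ℕ} {B : SpinBasis ℝ (sgn p q) ℍ[ℝ] N} {ab : Bool}
    {τ : AutType} {a b c : ℤˣ} (h : QuatAdmits B ab τ a b c)
    (ht : HasType p q 4 ∨ HasType p q 6) : SimpleAdmits p q ab τ a b c := by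
  have hr := quat_case p q ht N B _ _ _ _ _ _ _ rfl rfl rfl rfl rfl rfl rfl
  cases ab
  · exact Or.inr ⟨N, B, _, _, _, hr.2.2.2.2.2.1 h.1, h.2⟩
  · exact Or.inr ⟨N, B, _, _, _, hr.1 h.1, h.2⟩

theorem simpleAdmits_of_posList {ab : Bool} {τ : AutType} {a b c : ℤˣ} (h : PosList ab τ a b c) :
    ∃ p q, HasType p q 0 ∧ SimpleAdmits p q ab τ a b c := by
  simp only [PosList, Set.mem_insert_iff, Set.mem_singleton_iff, Prod.mk.injEq] at h
  rcases h with ⟨rfl, rfl, rfl, rfl, rfl⟩ | ⟨rfl, rfl, rfl, rfl, rfl⟩ |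
    ⟨rfl, rfl, rfl, rfl, rfl⟩ | ⟨rfl, rfl, rfl, rfl, rfl⟩
  · have ht : HasType 0 0 0 := by unfold HasType; decide
    obtain ⟨B⟩ := exists_real_spinBasis 0 0 (Or.inl ht)
    obtain ⟨-, hr, h1, h2, h3, h4, hr', h5, h6, h7, h8⟩ := real_case 0 0 (Or.inl ht) _ B _ _ rfl rfl
    exact ⟨0, 0, ht, Or.inl ⟨_, B, _, _, _, (hr (by decide) (by decide)).1, h1 ht rfl rfl⟩⟩
  · have ht : HasType 2 2 0 := by unfold HasType; decide
    obtain ⟨B⟩ := exists_real_spinBasis 2 2 (Or.inl ht)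
    obtain ⟨-, hr, h1, h2, h3, h4, hr', h5, h6, h7, h8⟩ := real_case 2 2 (Or.inl ht) _ B _ _ rfl rfl
    exact ⟨2, 2, ht, Or.inl ⟨_, B, _, _, _, (hr (by decide) (by decide)).1, h2 ht rfl rfl⟩⟩
  · have ht : HasType 3 3 0 := by unfold HasType; decide
    obtain ⟨B⟩ := exists_real_spinBasis 3 3 (Or.inl ht)
    obtain ⟨-, hr, h1, h2, h3, h4, hr', h5, h6, h7, h8⟩ := real_case 3 3 (Or.inl ht) _ B _ _ rfl rfl
    exact ⟨3, 3, ht, Or.inl ⟨_, B, _, _, _, (hr' (by decide) (by decide)).1, h5 ht rfl rfl⟩⟩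
  · have ht : HasType 1 1 0 := by unfold HasType; decide
    obtain ⟨B⟩ := exists_real_spinBasis 1 1 (Or.inl ht)
    obtain ⟨-, hr, h1, h2, h3, h4, hr', h5, h6, h7, h8⟩ := real_case 1 1 (Or.inl ht) _ B _ _ rfl rfl
    exact ⟨1, 1, ht, Or.inl ⟨_, B, _, _, _, (hr' (by decide) (by decide)).1, h6 ht rfl rfl⟩⟩

theorem simpleAdmits_of_negList {ab : Bool} {τ : AutType} {a b c : ℤˣ} (h : NegList ab τ a b c) :
    ∃ p q, HasType p q 2 ∧ SimpleAdmits p q ab τ a b c := by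
  simp only [NegList, Set.mem_insert_iff, Set.mem_singleton_iff, Prod.mk.injEq] at h
  rcases h with ⟨rfl, rfl, rfl, rfl, rfl⟩ | ⟨rfl, rfl, rfl, rfl, rfl⟩ |
    ⟨rfl, rfl, rfl, rfl, rfl⟩ | ⟨rfl, rfl, rfl, rfl, rfl⟩
  · have ht : HasType 0 6 2 := by unfold HasType; decide
    obtain ⟨B⟩ := exists_real_spinBasis 0 6 (Or.inr ht)
    obtain ⟨-, hr, h1, h2, h3, h4, hr', h5, h6, h7, h8⟩ := real_case 0 6 (Or.inr ht) _ B _ _ rfl rfl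
    exact ⟨0, 6, ht, Or.inl ⟨_, B, _, _, _, (hr (by decide) (by decide)).1, h3 ht rfl rfl⟩⟩
  · have ht : HasType 2 0 2 := by unfold HasType; decide
    obtain ⟨B⟩ := exists_real_spinBasis 2 0 (Or.inr ht)
    obtain ⟨-, hr, h1, h2, h3, h4, hr', h5, h6, h7, h8⟩ := real_case 2 0 (Or.inr ht) _ B _ _ rfl rfl
    exact ⟨2, 0, ht, Or.inl ⟨_, B, _, _, _, (hr (by decide) (by decide)).1, h4 ht rfl rfl⟩⟩
  · have ht : HasType 3 1 2 := by unfold HasType; decide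
    obtain ⟨B⟩ := exists_real_spinBasis 3 1 (Or.inr ht)
    obtain ⟨-, hr, h1, h2, h3, h4, hr', h5, h6, h7, h8⟩ := real_case 3 1 (Or.inr ht) _ B _ _ rfl rfl
    exact ⟨3, 1, ht, Or.inl ⟨_, B, _, _, _, (hr' (by decide) (by decide)).1, h7 ht rfl rfl⟩⟩
  · have ht : HasType 1 7 2 := by unfold HasType; decide
    obtain ⟨B⟩ := exists_real_spinBasis 1 7 (Or.inr ht)
    obtain ⟨-, hr, h1, h2, h3, h4, hr', h5, h6, h7, h8⟩ := real_case 1 7 (Or.inr ht) _ B _ _ rfl rfl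
    exact ⟨1, 7, ht, Or.inl ⟨_, B, _, _, _, (hr' (by decide) (by decide)).1, h8 ht rfl rfl⟩⟩

theorem SimpleAdmits.semisimple_succ_left {p q : ℕ} {ab : Bool} {τ : AutType} {a b c : ℤˣ}
    (h : SimpleAdmits p q ab τ a b c) (ht : HasType (q + 1) p 1 ∨ HasType (q + 1) p 5) :
    SemisimpleAdmits (q + 1) p ab τ a b c :=
  ⟨p, q, Or.inr ⟨rfl, rfl⟩, decomposes_of_type ht (Or.inr ⟨rfl, rfl⟩), h⟩

theorem SimpleAdmits.semisimple_succ_right {p q : ℕ} {ab : Bool} {τ : AutType} {a b c : ℤˣ}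
    (h : SimpleAdmits p q ab τ a b c) (ht : HasType p (q + 1) 1 ∨ HasType p (q + 1) 5) :
    SemisimpleAdmits p (q + 1) ab τ a b c :=
  ⟨p, q, Or.inl ⟨rfl, rfl⟩, decomposes_of_type ht (Or.inl ⟨rfl, rfl⟩), h⟩

theorem exists_semisimpleAdmits_neg {ab : Bool} {τ : AutType} {a b c : ℤˣ}
    (h : NegList ab τ a b c) : ∃ q, HasType 0 q 5 ∧ SemisimpleAdmits 0 q ab τ a b c := by
  obtain ⟨n, ht, N, B, hB⟩ := exists_quatAdmits_neg h
  have ht' : HasType 0 (n + 1) 5 := by simp only [HasType, Int.ModEq] at ht ⊢; omega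
  exact ⟨n + 1, ht', (hB.simpleAdmits (Or.inr ht)).semisimple_succ_right (Or.inr ht')⟩

theorem exists_semisimpleAdmits_pos {ab : Bool} {τ : AutType} {a b c : ℤˣ}
    (h : PosList ab τ a b c) : ∃ p, HasType p 0 5 ∧ SemisimpleAdmits p 0 ab τ a b c := by
  obtain ⟨n, ht, N, B, hB⟩ := exists_quatAdmits_pos h
  have ht' : HasType (n + 1) 0 5 := by simp only [HasType, Int.ModEq] at ht ⊢; omega
  exact ⟨n + 1, ht', (hB.simpleAdmits (Or.inl ht)).semisimple_succ_left (Or.inr ht')⟩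

theorem SemisimpleAdmits.negList {q : ℕ} (ht : HasType 0 q 1 ∨ HasType 0 q 5) {ab : Bool}
    {τ : AutType} {a b c : ℤˣ} (h : SemisimpleAdmits 0 q ab τ a b c) : NegList ab τ a b c := by
  obtain ⟨p', q', ⟨rfl, rfl⟩ | ⟨-, hq⟩, -, h⟩ := h
  · refine h.negList (sqSign_of_resMinus ?_)
    simp only [HasType, ResMinus, Int.ModEq] at ht ⊢
    omega
  · omega

theorem SemisimpleAdmits.posList {p : ℕ} (ht : HasType p 0 1 ∨ HasType p 0 5) {ab : Bool}
    {τ : AutType} {a b c : ℤˣ} (h : SemisimpleAdmits p 0 ab τ a b c) : PosList ab τ a b c := by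
  obtain ⟨p', q', ⟨-, hq⟩ | ⟨rfl, rfl⟩, -, h⟩ := h
  · omega
  · refine h.posList (sqSign_of_resPlus ?_)
    simp only [HasType, ResPlus, Int.ModEq] at ht ⊢
    omega

/-- The summand of `Cl 0 q` is `Cl 0 (q-1)` with W² = -1, that of `Cl p 0` is `Cl 0 (p-1)` with W² =
1, and W² selects the list. Type 5 uses quaternionic summands of types 4 and 6, type 1 uses real
summands of types 0 and 2. -/
theorem semisimple_case (ab : Bool) (τ : AutType) (a b c : ℤˣ) :
    ((∃ q, (HasType 0 q 1 ∨ HasType 0 q 5) ∧ SemisimpleAdmits 0 q ab τ a b c) ↔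
      NegList ab τ a b c) ∧
    ((∃ p, (HasType p 0 1 ∨ HasType p 0 5) ∧ SemisimpleAdmits p 0 ab τ a b c) ↔
      PosList ab τ a b c) ∧
    (NegList ab τ a b c ∨ PosList ab τ a b c →
      (∃ p q, HasType p q 1 ∧ SemisimpleAdmits p q ab τ a b c) ∧
      (∃ p q, HasType p q 5 ∧ SemisimpleAdmits p q ab τ a b c)) := by
  refine ⟨⟨fun ⟨q, ht, h⟩ => h.negList ht, fun h => ?_⟩,
    ⟨fun ⟨p, ht, h⟩ => h.posList ht, fun h => ?_⟩, ?_⟩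
  · obtain ⟨q, ht, hq⟩ := exists_semisimpleAdmits_neg h
    exact ⟨q, Or.inr ht, hq⟩
  · obtain ⟨p, ht, hp⟩ := exists_semisimpleAdmits_pos h
    exact ⟨p, Or.inr ht, hp⟩
  · rintro (h | h)
    · obtain ⟨p, q, ht, hs⟩ := simpleAdmits_of_negList h
      obtain ⟨n, hn, hn'⟩ := exists_semisimpleAdmits_neg h
      have ht' : HasType p (q + 1) 1 := by simp only [HasType, Int.ModEq] at ht ⊢; omega
      exact ⟨⟨p, q + 1, ht', hs.semisimple_succ_right (Or.inl ht')⟩, 0, n, hn, hn'⟩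
    · obtain ⟨p, q, ht, hs⟩ := simpleAdmits_of_posList h
      obtain ⟨n, hn, hn'⟩ := exists_semisimpleAdmits_pos h
      have ht' : HasType (q + 1) p 1 := by simp only [HasType, Int.ModEq] at ht ⊢; omega
      exact ⟨⟨q + 1, p, ht', hs.semisimple_succ_left (Or.inl ht')⟩, n, 0, hn, hn'⟩

/-! ### Complex realizations -/

theorem ncard_not_lt {n m k : ℕ} (h : n = m + k) : {i : Fin n | ¬ i.val < m}.ncard = k := by
  subst h
  have := ncard_sgn_neg m k
  simpa only [sgn_eq_neg_one_iff] using this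

namespace ComplexRealization

variable {p q m : ℕ} (R : ComplexRealization p q m)

theorem separates : R.basis.Separates (fun i => i.val < m) := fun i =>
  ⟨R.symm_first i, fun h => R.skew_last i (not_lt.1 h)⟩

theorem lastProd_eq : R.lastProd = R.basis.prodOver (fun i => ¬ i.val < m) :=
  R.basis.prodOver_congr fun _ => not_lt.symm

theorem even_case (hm : Even m) :
    R.basis.Represents R.basis.volMat R.lastProd R.firstProd ∧
      R.basis.RepresentsOnAlgebra R.lastProd R.firstProd ∧
      Commuting R.basis.volMat R.lastProd R.firstProd := by
  have hk : Even {i : Fin (2 * m) | ¬ i.val < m}.ncard := by rwa [ncard_not_lt (two_mul m)]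
  have hr := R.separates.represents_even (even_two_mul m) hk
  rw [← lastProd_eq] at hr
  refine ⟨hr, hr.onAlgebra, ?_⟩
  rw [lastProd_eq]
  exact (SpinBasis.isAutMinus_prodOver hk
    (by rw [SpinBasis.volMat_eq_prodOver]; exact R.basis.prodOver_sq _)
    (R.basis.prodOver_sq _) (R.basis.prodOver_sq _)).1

theorem odd_case (hm : Odd m) :
    R.basis.Represents R.basis.volMat R.firstProd R.lastProd ∧
      R.basis.RepresentsOnAlgebra R.firstProd R.lastProd ∧
      Anticommuting R.basis.volMat R.firstProd R.lastProd := by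
  have hk : Odd {i : Fin (2 * m) | ¬ i.val < m}.ncard := by rwa [ncard_not_lt (two_mul m)]
  have hr := R.separates.represents_odd (even_two_mul m) hk
  rw [← lastProd_eq] at hr
  refine ⟨hr, hr.onAlgebra, ?_⟩
  rw [lastProd_eq]
  exact (SpinBasis.isAutPlus_prodOver (even_two_mul m) hk
    (by rw [SpinBasis.volMat_eq_prodOver]; exact R.basis.prodOver_sq _)
    (R.basis.prodOver_sq _) (R.basis.prodOver_sq _)).1

end ComplexRealization

/-! ### Existence of complex realizations with prescribed squares -/

/-- A complex square root of a sign. -/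
def signRoot (e : ℤˣ) : ℂ := if e = 1 then 1 else Complex.I

theorem signRoot_mul_self (e : ℤˣ) : signRoot e * signRoot e = e • 1 := by
  rcases Int.units_eq_one_or e with rfl | rfl
  · simp [signRoot]
  · rw [signRoot, if_neg (by decide), Complex.I_mul_I, neg_one_smul_units]

theorem signRoot_ne_zero (e : ℤˣ) : signRoot e ≠ 0 := by
  rw [signRoot]; split_ifs <;> simp

/-- Multiplying a word by i flips the sign of its square but not its symmetry, so the real words
with m symmetric and m skewsymmetric members can be given arbitrary squares. -/
theorem exists_complex_spinBasis {n m : ℕ} (h : n = m + m) (s : Fin n → ℤˣ) :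
    ∃ B : SpinBasis ℂ s ℂ (2 ^ m), ∀ i, (i.val < m → B.IsSymm i) ∧ (m ≤ i.val → B.IsSkew i) := by
  subst h
  obtain ⟨m', hm, w, hw⟩ := hasPauli_of_type m m (Or.inl (by simp [HasType]))
  obtain rfl : m' = m := by omega
  have hself : ∀ i, zsign (pauliForm (w (finSumFinEquiv.symm i)) (w (finSumFinEquiv.symm i))) =
      sgn m' m' i := fun i => by rw [sgn_eq_zsign]; congr 1; exact hw.self _
  obtain ⟨B, hB⟩ := exists_spinBasis (F := ℂ) (K := ℂ) (s := s) ⟨m', rfl⟩ LinearMap.id mul_comm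
    one_ne_zero (by rw [Module.finrank_self, mul_one, ← pow_add])
    (w ∘ finSumFinEquiv.symm) (fun i => signRoot (sgn m' m' i * s i))
    (fun i => by
      change zsign (pauliForm (w _) (w _)) • _ = _
      rw [hself, signRoot_mul_self, smul_smul, ← mul_assoc, Int.units_mul_self, one_mul])
    (fun i j hij => by
      change zsign (pauliForm (w _) (w _)) • _ = -(zsign (pauliForm (w _) (w _)) • _)
      rw [zsign_eq_neg_of_add_eq_one
        (hw.anticomm _ _ (finSumFinEquiv.symm.injective.ne hij)), ← neg_one_smul_units, smul_smul,
        neg_one_mul, mul_comm])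
  refine ⟨B, fun i => ⟨fun hi => ?_, fun hi => ?_⟩⟩
  · refine (hB i).trans ?_
    rw [Function.comp_apply, hself, (sgn_eq_one_iff i).2 hi, one_smul]
  · refine (hB i).trans ?_
    rw [Function.comp_apply, hself, (sgn_eq_neg_one_iff i).2 (not_lt.2 hi), neg_one_smul_units]

/-- Both half-products have m factors, and the common sign from reordering is ε. One unit in each
half with square δε, all others having square 1, makes both squares equal to δ. -/
theorem exists_complex_signs (m : ℕ) (δ : ℤˣ) (hm : m = 0 → δ = 1) :
    ∃ s : Fin (2 * m) → ℤˣ, ∀ B : SpinBasis ℂ s ℂ (2 ^ m),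
      B.prodOver (fun i => i.val < m) * B.prodOver (fun i => i.val < m) = δ • 1 ∧
      B.prodOver (fun i => ¬ i.val < m) * B.prodOver (fun i => ¬ i.val < m) = δ • 1 := by
  classical
  set ε : ℤˣ := (-1) ^ m.choose 2 with hε
  have hεε : ε * (δ * ε) = δ := by
    rw [mul_comm, mul_assoc, Int.units_mul_self, mul_one]
  let s : Fin (2 * m) → ℤˣ := fun i => if i.val = 0 ∨ i.val = m then δ * ε else 1
  have key : ∀ (P : Fin (2 * m) → Prop) (j : m ≠ 0 → Fin (2 * m)), {i | P i}.ncard = m →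
      (∀ h i, P i → i ≠ j h → s i = 1) → (∀ h, P (j h)) → (∀ h, s (j h) = δ * ε) →
      ∀ B : SpinBasis ℂ s ℂ (2 ^ m), B.prodOver P * B.prodOver P = δ • 1 := by
    intro P j hP h1 h2 h3 B
    rw [SpinBasis.prodOver, B.isCliffordFamily_mat.prod_sq ((List.nodup_finRange _).filter _),
      length_filter_finRange, hP, ← List.prod_toFinset _ ((List.nodup_finRange _).filter _)]
    congr 1
    rcases eq_or_ne m 0 with rfl | h
    -- For m = 0 the products are empty, with square 1; hence the restriction on δ.
    · rw [hm rfl, Finset.prod_eq_one fun i => Fin.elim0 i, mul_one]; rfl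
    · rw [Finset.prod_eq_single (j h) (fun i hi hij => h1 h i (by simpa using hi) hij)
        (fun hj => absurd (by simpa using h2 h) hj), h3, hεε]
  refine ⟨s, fun B => ⟨key _ (fun h => ⟨0, by omega⟩) ?_ ?_ ?_ ?_ B,
    key _ (fun h => ⟨m, by omega⟩) ?_ ?_ ?_ ?_ B⟩⟩
  · have := SpinBasis.ncard_add_ncard_not fun i : Fin (2 * m) => i.val < m
    rw [ncard_not_lt (two_mul m)] at this
    omega
  · intro h i hi hij
    rw [Ne, Fin.ext_iff] at hij
    exact if_neg (by rintro (h | h) <;> [exact hij h; omega])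
  · exact fun h => Nat.pos_of_ne_zero h
  · exact fun h => if_pos (Or.inl rfl)
  · exact ncard_not_lt (two_mul m)
  · intro h i hi hij
    rw [Ne, Fin.ext_iff] at hij
    exact if_neg (by rintro (h | h) <;> [omega; exact hij h])
  · exact fun h => lt_irrefl m
  · exact fun h => if_pos (Or.inr rfl)

theorem prod_map_smul {F A ι : Type*} [CommSemiring F] [Semiring A] [Algebra F A] (c : ι → F)
    (f : ι → A) (L : List ι) : ∃ r : F, (L.map fun i => c i • f i).prod = r • (L.map f).prod := by
  induction L with
  | nil => exact ⟨1, by simp⟩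
  | cons j L ih =>
    obtain ⟨r, hr⟩ := ih
    exact ⟨c j * r, by simp [hr, smul_smul, mul_comm]⟩

theorem units_smul_comm_smul {A : Type*} [Ring A] [Algebra ℂ A] (e : ℤˣ) (a : A) :
    e • a = (e • (1 : ℂ)) • a := by
  rcases Int.units_eq_one_or e with rfl | rfl
  · simp
  · rw [neg_one_smul_units, neg_one_smul_units, neg_smul, one_smul]

theorem finrank_real_cliffAlg {n : ℕ} (s : Fin n → ℤˣ) :
    Module.finrank ℝ (CliffAlg ℂ s) = 2 ^ (n + 1) := by
  rw [← Module.finrank_mul_finrank ℝ ℂ (CliffAlg ℂ s), Complex.finrank_real_complex,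
    finrank_cliffAlg, pow_succ, mul_comm]

theorem surjective_of_complex_units_mem {A : Type} [Ring A] [Algebra ℝ A] {n : ℕ}
    {s : Fin n → ℤˣ} (φ : A →ₐ[ℝ] CliffAlg ℂ s) (c : Fin n → ℂ) (hc : ∀ i, c i ≠ 0)
    (h : ∀ i, c i • unit ℂ s i ∈ φ.range) (hI : Complex.I • 1 ∈ φ.range) :
    Function.Surjective φ := by
  have hF : ∀ z : ℂ, z • (1 : CliffAlg ℂ s) ∈ φ.range := fun z => by
    have hz : z • (1 : CliffAlg ℂ s) =
        algebraMap ℝ ℂ z.re • 1 + algebraMap ℝ ℂ z.im • Complex.I • 1 := by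
      rw [smul_smul, ← add_smul]
      exact congrArg (· • (1 : CliffAlg ℂ s)) (Complex.re_add_im z).symm
    rw [hz]
    exact add_mem (by rw [algebraMap_smul]; exact φ.range.smul_mem (one_mem _) _)
      (by rw [algebraMap_smul]; exact φ.range.smul_mem hI _)
  intro a
  change a ∈ φ.range
  induction a using cliffAlg_induction with
  | hF r => rw [Algebra.algebraMap_eq_smul_one]; exact hF r
  | hu i =>
    have := mul_mem (hF (c i)⁻¹) (h i)
    rwa [smul_mul_smul_comm, inv_mul_cancel₀ (hc i), one_mul, one_smul] at this
  | hmul a b ha hb => exact mul_mem ha hb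
  | hadd a b ha hb => exact add_mem ha hb

/-- Units of the complex algebra, together with its volume element for the last place, are rescaled
by 1 or i to have the squares required in `Cl p q`. The image of ω is then a scalar of square -1, so
the real image contains i and all the units; dimensions agree. -/
theorem exists_complex_iso {p q m : ℕ} (hn : p + q = 2 * m + 1) (hω : sqSign p q = -1)
    (s : Fin (2 * m) → ℤˣ) :
    ∃ (iso : Cl p q ≃ₐ[ℝ] CliffAlg ℂ s) (gen : Fin (2 * m) ↪ Fin (p + q)) (coeff : Fin (2 * m) → ℂ),
      ∀ i, iso (unit ℝ (sgn p q) (gen i)) = coeff i • unit ℂ s i := by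
  have hfam := isCliffordFamily_unit (F := ℂ) s
  have hanti := unit_mul_volume (F := ℂ) s (even_two_mul m)
  obtain ⟨v, hv⟩ : ∃ v : ℤˣ, volume ℂ s * volume ℂ s = v • 1 :=
    ⟨_, hfam.prod_sq (List.nodup_finRange _)⟩
  let τ : Option (Fin (2 * m)) → Fin (p + q) := fun o =>
    o.elim ⟨2 * m, by omega⟩ fun j => ⟨j.val, by omega⟩
  have hτ : Function.Injective τ := by
    rintro (_ | i) (_ | j) hij
    · rfl
    · exact absurd (Fin.ext_iff.1 hij).symm j.isLt.ne
    · exact absurd (Fin.ext_iff.1 hij) i.isLt.ne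
    · exact congrArg some (Fin.ext (Fin.mk.inj_iff.1 hij))
  let σ : Option (Fin (2 * m)) ≃ Fin (p + q) := Equiv.ofBijective τ
    ((Fintype.bijective_iff_injective_and_card τ).2 ⟨hτ, by simp [hn]⟩)
  let c : Option (Fin (2 * m)) → ℂ := fun o =>
    signRoot (o.elim (v * sgn p q (τ none)) fun j => s j * sgn p q (τ (some j)))
  let g : Option (Fin (2 * m)) → CliffAlg ℂ s := fun o => o.elim (volume ℂ s) (unit ℂ s)
  have hg : ∀ o o', o ≠ o' → g o * g o' = -(g o' * g o) := by
    rintro (_ | i) (_ | j) hij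
    · exact absurd rfl hij
    · exact (neg_eq_iff_eq_neg.2 (hanti j)).symm
    · exact hanti i
    · exact hfam.anticomm i j fun e => hij (by rw [e])
  have hsq : ∀ o, (c o • g o) * (c o • g o) = sgn p q (τ o) • 1 := by
    intro o
    rw [smul_mul_smul_comm, signRoot_mul_self]
    rcases o with _ | j
    · change _ • (volume ℂ s * volume ℂ s) = _
      rw [hv, ← units_smul_comm_smul, smul_smul, Option.elim_none, mul_right_comm,
        Int.units_mul_self, one_mul]
    · change _ • (unit ℂ s j * unit ℂ s j) = _
      rw [hfam.sq, ← units_smul_comm_smul, smul_smul, Option.elim_some, mul_right_comm,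
        Int.units_mul_self, one_mul]
  have hσ : ∀ i, sgn p q (τ (σ.symm i)) = sgn p q i := fun i =>
    congrArg (sgn p q) (σ.apply_symm_apply i)
  have hf : IsCliffordFamily (sgn p q) (fun i => c (σ.symm i) • g (σ.symm i)) :=
    { sq := fun i => by rw [hsq, hσ]
      anticomm := fun i j hij => by
        rw [smul_mul_smul_comm, hg _ _ (σ.symm.injective.ne hij), smul_neg, smul_mul_smul_comm,
          mul_comm (c _)] }
  have hlift : ∀ o, hf.lift (F := ℝ) (unit ℝ (sgn p q) (σ o)) = c o • g o := fun o => by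
    refine (hf.lift_unit (F := ℝ) (σ o)).trans ?_
    rw [Equiv.symm_apply_apply]
  obtain ⟨r, hr⟩ : ∃ r : ℂ, hf.lift (F := ℝ) (volume ℝ (sgn p q)) = r • 1 := by
    obtain ⟨e, he⟩ := hf.exists_prod_option σ
    obtain ⟨z, hz⟩ := prod_map_smul (fun j => c (some j)) (unit ℂ s) (List.finRange (2 * m))
    simp only [Equiv.symm_apply_apply] at he
    rw [← hf.lift_volume (F := ℝ)] at he
    refine ⟨e • (c none * z * (v • 1)), ?_⟩
    have h1 : c none • g none * ((List.finRange (2 * m)).map fun j => c (some j) • g (some j)).prod =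
        (c none * z) • (v • 1) := by
      rw [← hv, ← smul_mul_smul_comm]
      exact congrArg (c none • volume ℂ s * ·) hz
    rw [he, h1, units_smul_comm_smul v, smul_smul, units_smul_comm_smul e, smul_smul, smul_one_mul]
  have hr2 : r * r = -1 := by
    have h1 : (r • 1 : CliffAlg ℂ s) * (r • 1) = (-1 : ℂ) • 1 := by
      rw [← hr, ← map_mul, volume_sq, hω, neg_one_smul_units, map_neg, map_one, neg_one_smul]
    rw [smul_mul_smul_comm, one_mul] at h1
    have : Nontrivial (CliffAlg ℂ s) :=
      Module.nontrivial_of_finrank_pos (R := ℂ) (by rw [finrank_cliffAlg]; positivity)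
    exact smul_left_injective ℂ one_ne_zero h1
  have hI : Complex.I • 1 ∈ (hf.lift (F := ℝ)).range := by
    -- r² = -1 leaves r = ±i, and either sign puts i into the image.
    have h0 : (r - Complex.I) * (r + Complex.I) = 0 := by
      linear_combination hr2 - Complex.I_mul_I
    rcases mul_eq_zero.1 h0 with h | h
    · exact ⟨_, hr.trans (by rw [sub_eq_zero.1 h])⟩
    · refine ⟨-volume ℝ (sgn p q), (map_neg (hf.lift (F := ℝ)) _).trans ?_⟩
      rw [hr, eq_neg_of_add_eq_zero_left h, neg_smul, neg_neg]
  have hsurj : Function.Surjective (hf.lift (F := ℝ)) :=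
    surjective_of_complex_units_mem _ (fun j => c (some j)) (fun j => signRoot_ne_zero _)
      (fun j => ⟨_, hlift (some j)⟩) hI
  have hfin : Module.finrank ℝ (Cl p q) = Module.finrank ℝ (CliffAlg ℂ s) := by
    rw [finrank_cliffAlg, finrank_real_cliffAlg, hn]
  have : FiniteDimensional ℝ (CliffAlg ℂ s) :=
    .of_finrank_pos (by rw [finrank_real_cliffAlg]; positivity)
  exact ⟨AlgEquiv.ofBijective hf.lift
    ⟨(LinearMap.injective_iff_surjective_of_finrank_eq_finrank
      (f := (hf.lift (F := ℝ)).toLinearMap) hfin).2 hsurj, hsurj⟩,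
    ⟨fun j => τ (some j), fun i j h => Option.some_injective _ (hτ h)⟩, fun j => c (some j),
    fun j => hlift (some j)⟩

theorem exists_complexRealization {p q m : ℕ} (hn : p + q = 2 * m + 1) (hω : sqSign p q = -1)
    {δ : ℤˣ} (hδ : m = 0 → δ = 1) :
    ∃ R : ComplexRealization p q m,
      R.basis.prodOver (fun i => i.val < m) * R.basis.prodOver (fun i => i.val < m) = δ • 1 ∧
      R.basis.prodOver (fun i => ¬ i.val < m) * R.basis.prodOver (fun i => ¬ i.val < m) =
        δ • 1 := by
  obtain ⟨s, hs⟩ := exists_complex_signs m δ hδ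
  obtain ⟨B, hB⟩ := exists_complex_spinBasis (two_mul m) s
  obtain ⟨iso, gen, coeff, h⟩ := exists_complex_iso hn hω s
  exact ⟨⟨s, iso, gen, coeff, h, B, fun i => (hB i).1, fun i => (hB i).2⟩, hs B⟩

theorem complex_case (p q m : ℕ) (h : HasType p q 3 ∨ HasType p q 7) (hn : p + q = 2 * m + 1) :
    (Even p → Odd q → Even m ∧
      (∀ R : ComplexRealization p q m,
        R.basis.Represents R.basis.volMat R.lastProd R.firstProd ∧
        R.basis.RepresentsOnAlgebra R.lastProd R.firstProd ∧
        Commuting R.basis.volMat R.lastProd R.firstProd) ∧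
      ∃ R : ComplexRealization p q m,
        IsAutMinus R.basis.volMat R.lastProd R.firstProd .klein 1 1 1) ∧
    (Odd p → Even q → Odd m ∧
      (∀ R : ComplexRealization p q m,
        R.basis.Represents R.basis.volMat R.firstProd R.lastProd ∧
        R.basis.RepresentsOnAlgebra R.firstProd R.lastProd ∧
        Anticommuting R.basis.volMat R.firstProd R.lastProd) ∧
      ∃ R : ComplexRealization p q m,
        IsAutPlus R.basis.volMat R.firstProd R.lastProd .quaternion (-1) (-1) (-1)) := by
  simp only [HasType, Int.ModEq] at h
  have hω : sqSign p q = -1 := sqSign_of_resMinus (by simp only [ResMinus, Int.ModEq]; omega)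
  refine ⟨fun hp hq => ?_, fun hp hq => ?_⟩
  · have hm : Even m := by rw [Nat.even_iff] at *; omega
    refine ⟨hm, fun R => R.even_case hm, ?_⟩
    obtain ⟨R, hX, hY⟩ := exists_complexRealization hn hω (δ := 1) fun _ => rfl
    have hk : Even {i : Fin (2 * m) | ¬ i.val < m}.ncard := by rwa [ncard_not_lt (two_mul m)]
    refine ⟨R, ?_⟩
    rw [R.lastProd_eq]
    refine SpinBasis.isAutMinus_prodOver hk ?_ hY hX
    obtain ⟨e, he⟩ := R.basis.exists_volMat_eq fun i => i.val < m
    have hc := SpinBasis.prodOver_comm_of_even (B := R.basis) hk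
    rw [he]
    generalize R.basis.prodOver (fun i => i.val < m) = X at *
    generalize R.basis.prodOver (fun i => ¬ i.val < m) = Y at *
    -- As X and Y commute, W² = (XY)² = X²Y² = 1.
    rw [smul_mul_smul_comm, Int.units_mul_self, one_smul]
    nth_rw 1 [hc]
    rw [mul_assoc, ← mul_assoc X, hX, one_smul, one_mul, hY, one_smul]
  · have hm : Odd m := by rw [Nat.odd_iff] at *; rw [Nat.even_iff] at *; omega
    refine ⟨hm, fun R => R.odd_case hm, ?_⟩
    -- The value -1 is allowed since m is odd, hence nonzero.
    obtain ⟨R, hX, hY⟩ := exists_complexRealization hn hω (δ := -1) fun h => by simp [h] at hm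
    have hk : Odd {i : Fin (2 * m) | ¬ i.val < m}.ncard := by rwa [ncard_not_lt (two_mul m)]
    refine ⟨R, ?_⟩
    rw [R.lastProd_eq]
    refine SpinBasis.isAutPlus_prodOver (even_two_mul m) hk ?_ hX hY
    obtain ⟨e, he⟩ := R.basis.exists_volMat_eq fun i => i.val < m
    have hc := SpinBasis.prodOver_anticomm_of_odd (B := R.basis) (even_two_mul m) hk
    rw [he]
    generalize R.basis.prodOver (fun i => i.val < m) = X at *
    generalize R.basis.prodOver (fun i => ¬ i.val < m) = Y at *
    -- As X and Y anticommute, W² = (XY)² = -X²Y² = -1.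
    rw [smul_mul_smul_comm, Int.units_mul_self, one_smul]
    nth_rw 1 [hc]
    rw [neg_mul, mul_assoc, ← mul_assoc X, hX, neg_one_smul_units, neg_one_mul, mul_neg, neg_neg,
      hY, neg_one_smul_units]

end CliffordAut

end

/-! ### The theorem -/

open CliffordAut in
theorem theorem4 :
    -- division ring ℝ, types 0 and 2
    (∀ p q : ℕ, HasType p q 0 ∨ HasType p q 2 →
      Nonempty (SpinBasis ℝ (sgn p q) ℝ (2 ^ ((p + q) / 2))) ∧
      ∀ (N : ℕ) (B : SpinBasis ℝ (sgn p q) ℝ N) (X Y : Matrix (Fin N) (Fin N) ℝ),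
        X = B.prodOver (fun i => i.val < p) → Y = B.prodOver (fun i => p ≤ i.val) →
        (∀ i : Fin (p + q), (i.val < p → B.IsSymm i) ∧ (p ≤ i.val → B.IsSkew i)) ∧
        -- Abelian groups: E = Y, C = X
        (Even p → Even q → B.Represents B.volMat Y X ∧ B.RepresentsOnAlgebra Y X) ∧
        (HasType p q 0 → p ≡ 0 [MOD 4] → q ≡ 0 [MOD 4] →
          IsAutMinus B.volMat Y X .klein 1 1 1) ∧
        (HasType p q 0 → p ≡ 2 [MOD 4] → q ≡ 2 [MOD 4] →
          IsAutMinus B.volMat Y X .cyclic 1 (-1) (-1)) ∧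
        (HasType p q 2 → p ≡ 0 [MOD 4] → q ≡ 2 [MOD 4] →
          IsAutMinus B.volMat Y X .cyclic (-1) (-1) 1) ∧
        (HasType p q 2 → p ≡ 2 [MOD 4] → q ≡ 0 [MOD 4] →
          IsAutMinus B.volMat Y X .cyclic (-1) 1 (-1)) ∧
        -- non-Abelian groups: E = X, C = Y
        (Odd p → Odd q → B.Represents B.volMat X Y ∧ B.RepresentsOnAlgebra X Y) ∧
        (HasType p q 0 → p ≡ 3 [MOD 4] → q ≡ 3 [MOD 4] →
          IsAutPlus B.volMat X Y .dihedral 1 (-1) 1) ∧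
        (HasType p q 0 → p ≡ 1 [MOD 4] → q ≡ 1 [MOD 4] →
          IsAutPlus B.volMat X Y .dihedral 1 1 (-1)) ∧
        (HasType p q 2 → p ≡ 3 [MOD 4] → q ≡ 1 [MOD 4] →
          IsAutPlus B.volMat X Y .quaternion (-1) (-1) (-1)) ∧
        (HasType p q 2 → p ≡ 1 [MOD 4] → q ≡ 3 [MOD 4] →
          IsAutPlus B.volMat X Y .dihedral (-1) 1 1)) ∧
    -- division ring ℍ, types 4 and 6
    (∀ p q : ℕ, HasType p q 4 ∨ HasType p q 6 →
      Nonempty (SpinBasis ℝ (sgn p q) ℍ[ℝ] (2 ^ ((p + q) / 2 - 1))) ∧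
      ∀ (N : ℕ) (B : SpinBasis ℝ (sgn p q) ℍ[ℝ] N) (X Y : Matrix (Fin N) (Fin N) ℍ[ℝ])
        (k : ℕ) (l t h g : ℤ),
        X = B.prodOver B.IsSymm → Y = B.prodOver B.IsSkew → k = B.numSkew →
        l = B.numSkewPos → t = B.numSkewNeg → h = B.numSymmPos → g = B.numSymmNeg →
        -- Abelian groups: E = Y, C = X
        (Even k → B.Represents B.volMat Y X) ∧
        (Even k → HasType p q 4 → ResPlus (l - t) → ResPlus (h - g) →
          IsAutMinus B.volMat Y X .klein 1 1 1) ∧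
        (Even k → HasType p q 4 → ResMinus (l - t) → ResMinus (h - g) →
          IsAutMinus B.volMat Y X .cyclic 1 (-1) (-1)) ∧
        (Even k → HasType p q 6 → ResPlus (l - t) → ResMinus (h - g) →
          IsAutMinus B.volMat Y X .cyclic (-1) 1 (-1)) ∧
        (Even k → HasType p q 6 → ResMinus (l - t) → ResPlus (h - g) →
          IsAutMinus B.volMat Y X .cyclic (-1) (-1) 1) ∧
        -- non-Abelian groups: E = X, C = Y
        (Odd k → B.Represents B.volMat X Y) ∧
        (Odd k → HasType p q 4 → ResMinus (h - g) → ResPlus (l - t) →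
          IsAutPlus B.volMat X Y .dihedral 1 (-1) 1) ∧
        (Odd k → HasType p q 4 → ResPlus (h - g) → ResMinus (l - t) →
          IsAutPlus B.volMat X Y .dihedral 1 1 (-1)) ∧
        (Odd k → HasType p q 6 → ResMinus (h - g) → ResMinus (l - t) →
          IsAutPlus B.volMat X Y .quaternion (-1) (-1) (-1)) ∧
        (Odd k → HasType p q 6 → ResPlus (h - g) → ResPlus (l - t) →
          IsAutPlus B.volMat X Y .dihedral (-1) 1 1)) ∧
    -- all the eight quaternionic cases occur
    (∀ (ab : Bool) (τ : AutType) (a b c : ℤˣ),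
      (PosList ab τ a b c → ∃ p q, HasType p q 4 ∧
        ∃ (N : ℕ) (B : SpinBasis ℝ (sgn p q) ℍ[ℝ] N),
          if ab then Even B.numSkew ∧
            IsAutMinus B.volMat (B.prodOver B.IsSkew) (B.prodOver B.IsSymm) τ a b c
          else Odd B.numSkew ∧
            IsAutPlus B.volMat (B.prodOver B.IsSymm) (B.prodOver B.IsSkew) τ a b c) ∧
      (NegList ab τ a b c → ∃ p q, HasType p q 6 ∧
        ∃ (N : ℕ) (B : SpinBasis ℝ (sgn p q) ℍ[ℝ] N),
          if ab then Even B.numSkew ∧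
            IsAutMinus B.volMat (B.prodOver B.IsSkew) (B.prodOver B.IsSymm) τ a b c
          else Odd B.numSkew ∧
            IsAutPlus B.volMat (B.prodOver B.IsSymm) (B.prodOver B.IsSkew) τ a b c)) ∧
    -- division rings ℝ ⊕ ℝ and ℍ ⊕ ℍ, types 1 and 5
    ((∀ p q p' q' : ℕ, HasType p q 1 ∨ HasType p q 5 →
        (p' = p ∧ q' + 1 = q) ∨ (p' = q ∧ q' + 1 = p) → Decomposes p q p' q') ∧
      (∀ (ab : Bool) (τ : AutType) (a b c : ℤˣ),
        ((∃ q, (HasType 0 q 1 ∨ HasType 0 q 5) ∧ SemisimpleAdmits 0 q ab τ a b c) ↔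
          NegList ab τ a b c) ∧
        ((∃ p, (HasType p 0 1 ∨ HasType p 0 5) ∧ SemisimpleAdmits p 0 ab τ a b c) ↔
          PosList ab τ a b c) ∧
        (NegList ab τ a b c ∨ PosList ab τ a b c →
          (∃ p q, HasType p q 1 ∧ SemisimpleAdmits p q ab τ a b c) ∧
          (∃ p q, HasType p q 5 ∧ SemisimpleAdmits p q ab τ a b c)))) ∧
    -- division ring ℂ, types 3 and 7
    (∀ p q m : ℕ, HasType p q 3 ∨ HasType p q 7 → p + q = 2 * m + 1 →
      (Even p → Odd q → Even m ∧
        (∀ R : ComplexRealization p q m,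
          R.basis.Represents R.basis.volMat R.lastProd R.firstProd ∧
          R.basis.RepresentsOnAlgebra R.lastProd R.firstProd ∧
          Commuting R.basis.volMat R.lastProd R.firstProd) ∧
        ∃ R : ComplexRealization p q m,
          IsAutMinus R.basis.volMat R.lastProd R.firstProd .klein 1 1 1) ∧
      (Odd p → Even q → Odd m ∧
        (∀ R : ComplexRealization p q m,
          R.basis.Represents R.basis.volMat R.firstProd R.lastProd ∧
          R.basis.RepresentsOnAlgebra R.firstProd R.lastProd ∧
          Anticommuting R.basis.volMat R.firstProd R.lastProd) ∧
        ∃ R : ComplexRealization p q m,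
          IsAutPlus R.basis.volMat R.firstProd R.lastProd .quaternion (-1) (-1) (-1))) :=
  ⟨fun p q h => ⟨exists_real_spinBasis p q h, real_case p q h⟩,
    fun p q h => ⟨exists_quat_spinBasis p q h, quat_case p q h⟩,
    fun _ _ _ _ _ => ⟨fun h => ⟨0, exists_quatAdmits_pos h⟩,
      fun h => ⟨0, exists_quatAdmits_neg h⟩⟩,
    ⟨fun _ _ _ _ => decomposes_of_type, semisimple_case⟩, complex_case⟩
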